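/- Let $n\ge 1$, let $t_1,\dots,t_n\in\mathbb C\setminus\{0,1\}$ be pairwise distinct, and let $s_1,\dots,s_{n+2},r_1,r_2\in\mathbb C$ satisfy $s_1+\dots+s_{n+2}=r_1+r_2+1$. Assume that none of $s_1,s_3,s_4,\dots,s_{n+2}$ is a non-positive integer. For $\lambda=(\lambda_1,\dots,\lambda_n)\in\mathbb C^n$ let $$D_x=x(x-1)\prod_{k=1}^n(x-t_k)\left(\frac{d^2}{dx^2}+\left(\frac{s_1}{x}+\frac{s_2}{x-1}+\sum_{k=1}^n\frac{s_{k+2}}{x-t_k}\right)\frac{d}{dx}\right)+\lambda_1+\lambda_2x+\dots+\lambda_nx^{n-1}+r_1r_2x^n .$$ **(1)** For every $\lambda$ the equation $D_xf=0$ has a solution $f_\lambda$ analytic at $x=0$ with $f_\lambda(0)=1$. Its germ at $0$ is unique, and $f_\lambda(x)=\sum_{i\ge0}p_i(\lambda)x^i$ for unique polynomials $p_i\in\mathbb C[\lambda_1,\dots,\lambda_n]$. The products $p_{j_1}\cdots p_{j_n}$ with $0\le j_1\le\dots\le j_n$ form a basis of $\mathbb C[\lambda_1,\dots,\lambda_n]$.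 Hence there are unique constants $C_{i_1\dots i_{n+1}}^{j_1\dots j_n}$, symmetric in $j_1,\dots,j_n$ and, for each fixed $(i_1,\dots,i_{n+1})$, zero for all but finitely many $(j_1,\dots,j_n)$, such that $$p_{i_1}\cdots p_{i_{n+1}}=\sum_{j_1,\dots,j_n\ge0}C_{i_1\dots i_{n+1}}^{j_1\dots j_n}\,p_{j_1}\cdots p_{j_n}.$$ Define the kernel, a formal series in non-negative powers of $x_1,\dots,x_{n+1}$ and negative powers of $y_1,\dots,y_n$, by $$K(x_1,\dots,x_{n+1},y_1,\dots,y_n)=\sum_{i_1,\dots,i_{n+1},j_1,\dots,j_n\ge0}C_{i_1\dots i_{n+1}}^{j_1\dots j_n}\,x_1^{i_1}\cdots x_{n+1}^{i_{n+1}}\,y_1^{-j_1-1}\cdots y_n^{-j_n-1}.$$ For $i=(i_1,\dots,i_n)\in\mathbb Z_{\ge0}^n$ write $|i|=i_1+\dots+i_n$, let $F(a,b,c,z)=\sum_{m\ge0}\frac{(a)_m(b)_m}{(c)_m}\frac{z^m}{m!}$, and put $$u_0=\frac{\prod_{k=1}^{n+1}(x_k-1)}{\prod_{l=1}^n(t_l-1)},\qquad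 u_i=\frac{\prod_{k=1}^{n+1}(x_k-t_i)}{t_i(t_i-1)\prod_{l\ne i}(t_l-t_i)}\quad(1\le i\le n),$$ $$P_{i_1,\dots,i_n}(v_1,\dots,v_n)=\sum_{j_1,\dots,j_n\ge0}\frac{\prod_{l=1}^{|j|}(s_2+|i|-l)\;\prod_{k=1}^n\prod_{l=1}^{j_k}(i_k-l+1)}{\prod_{k=1}^n\prod_{l=1}^{j_k}(s_{k+2}+l-1)}\;\frac{v_1^{j_1}\cdots v_n^{j_n}}{j_1!\cdots j_n!},$$ which is a finite sum. Let $\tilde u_i=u_i|_{x_{n+1}=0}$. Consider families $(Q_i)_{i\in\mathbb Z_{\ge0}^n}$ of formal power series in $1/y_1,\dots,1/y_n$ over $\mathbb C$ in which each monomial in $1/y_1,\dots,1/y_n$ occurs in only finitely many $Q_i$, and which satisfy $$\sum_{i\in\mathbb Z_{\ge0}^n}\tilde u_0^{|i|}P_i\!\left(\frac{\tilde u_1}{\tilde u_0},\dots,\frac{\tilde u_n}{\tilde u_0}\right)Q_i(y_1,\dots,y_n)=\frac1{n!}\sum_{\sigma\in S_n}\frac1{(y_{\sigma_1}-x_1)\cdots(y_{\sigma_n}-x_n)},\qquad(*)$$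 where the right-hand side is expanded in negative powers of $y_1,\dots,y_n$. **(2)** For every such family, $$K(x_1,\dots,x_{n+1},y_1,\dots,y_n)=\sum_{i\in\mathbb Z_{\ge0}^n}F\!\left(r_1+|i|,\,r_2+|i|,\,s_1,\,\frac{x_1\cdots x_{n+1}}{t_1\cdots t_n}\right)u_0^{|i|}P_i\!\left(\frac{u_1}{u_0},\dots,\frac{u_n}{u_0}\right)Q_i(y_1,\dots,y_n)$$ as formal series. **(3)** If $s_2+s_3+\dots+s_{n+2}$ is not a non-positive integer and, in case $n\ge2$, $s_2$ is not a non-positive integer either, then $(*)$ determines the $Q_i$: there is exactly one such family. -/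

import Mathlib

open scoped Topology Nat

noncomputable section

namespace FuchsianKernel

/-! ### The differential operator -/

/-- The finite singular points `0, 1, t₁, …, tₙ`. -/
def singularPoint {n : ℕ} (t : Fin n → ℂ) : Fin (n + 2) → ℂ :=
  Fin.cons 0 (Fin.cons 1 t)

/-- The leading coefficient `x (x - 1) (x - t₁) ⋯ (x - tₙ)`. -/
def leadingCoeff {n : ℕ} (t : Fin n → ℂ) (x : ℂ) : ℂ :=
  ∏ k, (x - singularPoint t k)

/-- The coefficient of `d/dx`, that is
`x (x - 1) (x - t₁) ⋯ (x - tₙ) * (s₁ / x + s₂ / (x - 1) + s₃ / (x - t₁) + ⋯)`,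
written as a polynomial in `x`. The entry `s k` (with `k` counted from `0`) is `s_{k+1}`. -/
def firstOrderCoeff {n : ℕ} (t : Fin n → ℂ) (s : Fin (n + 2) → ℂ) (x : ℂ) : ℂ :=
  ∑ k, s k * ∏ l ∈ Finset.univ.erase k, (x - singularPoint t l)

/-- The coefficient of order zero, `lam₁ + lam₂ x + ⋯ + lamₙ x^(n-1) + r₁ r₂ x^n`. -/
def zerothOrderCoeff {n : ℕ} (r₁ r₂ : ℂ) (lam : Fin n → ℂ) (x : ℂ) : ℂ :=
  (∑ k : Fin n, lam k * x ^ (k : ℕ)) + r₁ * r₂ * x ^ n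

/-- `(D_x f)(x)`. -/
def fuchsOp {n : ℕ} (t : Fin n → ℂ) (s : Fin (n + 2) → ℂ) (r₁ r₂ : ℂ) (lam : Fin n → ℂ)
    (f : ℂ → ℂ) (x : ℂ) : ℂ :=
  leadingCoeff t x * deriv (deriv f) x + firstOrderCoeff t s x * deriv f x
    + zerothOrderCoeff r₁ r₂ lam x * f x

/-- `f` is a solution of `D_x f = 0` which is analytic at `x = 0` and has `f(0) = 1`. -/
structure IsNormalizedSolution {n : ℕ} (t : Fin n → ℂ) (s : Fin (n + 2) → ℂ) (r₁ r₂ : ℂ)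
    (lam : Fin n → ℂ) (f : ℂ → ℂ) : Prop where
  analytic : AnalyticAt ℂ f 0
  ode : ∀ᶠ x in 𝓝 (0 : ℂ), fuchsOp t s r₁ r₂ lam f x = 0
  value : f 0 = 1

/-- `p₀, p₁, …` are the polynomials in `lam₁, …, lamₙ` with `f_lam(x) = ∑ pᵢ(lam) xⁱ`, where `f_lam`
is the analytic solution at `x = 0` with `f_lam(0) = 1`: for every `lam` such a solution exists,
and every such solution has the Taylor coefficients `pᵢ(lam)` at `0`. -/
def IsTaylorFamily {n : ℕ} (t : Fin n → ℂ) (s : Fin (n + 2) → ℂ) (r₁ r₂ : ℂ)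
    (p : ℕ → MvPolynomial (Fin n) ℂ) : Prop :=
  ∀ lam : Fin n → ℂ,
    (∃ f, IsNormalizedSolution t s r₁ r₂ lam f) ∧
    ∀ f, IsNormalizedSolution t s r₁ r₂ lam f →
      ∀ i, iteratedDeriv i f 0 / (i ! : ℂ) = MvPolynomial.eval lam (p i)

/-! ### Structure constants and the kernel -/

/-- `C i j` are the structure constants `C_{i₁,…,iₙ₊₁}^{j₁,…,jₙ}`:
`p_{i₁} ⋯ p_{iₙ₊₁} = ∑_{j₁,…,jₙ ≥ 0} C_{i₁,…,iₙ₊₁}^{j₁,…,jₙ} p_{j₁} ⋯ p_{jₙ}`, a finite sum over all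
ordered tuples, with coefficients symmetric in `j₁, …, jₙ`. -/
structure IsStructureConstants {n : ℕ} (p : ℕ → MvPolynomial (Fin n) ℂ)
    (C : (Fin (n + 1) → ℕ) → (Fin n → ℕ) → ℂ) : Prop where
  finite : ∀ i, {j | C i j ≠ 0}.Finite
  symm : ∀ i j, ∀ σ : Equiv.Perm (Fin n), C i (j ∘ σ) = C i j
  expand : ∀ i, ∏ k, p (i k) = ∑ᶠ j, C i j • ∏ k, p (j k)

/-- Formal series in the variables `1 / y₁, …, 1 / yₙ` with coefficients in `A`: the variable
`MvPowerSeries.X k` stands for `1 / yₖ`. -/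
abbrev InvYSeries (n : ℕ) (A : Type*) := MvPowerSeries (Fin n) A

/-- The kernel
`K = ∑ C_{i₁,…,iₙ₊₁}^{j₁,…,jₙ} x₁^{i₁} ⋯ xₙ₊₁^{iₙ₊₁} y₁^{-j₁-1} ⋯ yₙ^{-jₙ-1}`,
a formal series in the `1 / yₖ` with coefficients in `ℂ⟦x₁, …, xₙ₊₁⟧`. -/
def kernel {n : ℕ} (C : (Fin (n + 1) → ℕ) → (Fin n → ℕ) → ℂ) :
    InvYSeries n (MvPowerSeries (Fin (n + 1)) ℂ) :=
  let generatingSeries : InvYSeries n (MvPowerSeries (Fin (n + 1)) ℂ) := fun j i => C i j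
  (∏ k, MvPowerSeries.X k) * generatingSeries

/-! ### The hypergeometric factor -/

/-- The Gauss hypergeometric series `F(a, b, c, z) = ∑ (a)ₘ (b)ₘ / (c)ₘ zᵐ / m!`. -/
def gaussSeries (a b c : ℂ) : PowerSeries ℂ :=
  PowerSeries.mk (ordinaryHypergeometricCoefficient a b c)

/-- `F(a, b, c, x₁ ⋯ xₙ₊₁ / (t₁ ⋯ tₙ))` as a power series in `x₁, …, xₙ₊₁`. -/
def gaussFactor {n : ℕ} (t : Fin n → ℂ) (a b c : ℂ) : MvPowerSeries (Fin (n + 1)) ℂ :=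
  (gaussSeries a b c).subst
    ((∏ k, t k)⁻¹ • ∏ k : Fin (n + 1), (MvPowerSeries.X k : MvPowerSeries (Fin (n + 1)) ℂ))

/-! ### The polynomial factors -/

/-- `u₀ = ∏ₖ (xₖ - 1) / ∏ₗ (tₗ - 1)`, for `x₁, …, xₙ₊₁` in a `ℂ`-algebra. -/
def u₀ {n : ℕ} {A : Type*} [CommRing A] [Algebra ℂ A] (t : Fin n → ℂ) (x : Fin (n + 1) → A) : A :=
  (∏ l, (t l - 1))⁻¹ • ∏ k, (x k - 1)

/-- `uᵢ = ∏ₖ (xₖ - tᵢ) / (tᵢ (tᵢ - 1) ∏_{l ≠ i} (tₗ - tᵢ))`, for `x₁, …, xₙ₊₁` in a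
`ℂ`-algebra. -/
def u {n : ℕ} {A : Type*} [CommRing A] [Algebra ℂ A] (t : Fin n → ℂ) (x : Fin (n + 1) → A)
    (i : Fin n) : A :=
  (t i * (t i - 1) * ∏ l ∈ Finset.univ.erase i, (t l - t i))⁻¹ •
    ∏ k, (x k - algebraMap ℂ A (t i))

/-- The polynomial `P_{i₁,…,iₙ}(v₁, …, vₙ)`. The product over `l = 1, …, jₖ` of `iₖ - l + 1`
vanishes as soon as `jₖ > iₖ`, so the sum over all `j` is the sum over `j ≤ i`. -/
def P {n : ℕ} (s : Fin (n + 2) → ℂ) (i : Fin n → ℕ) : MvPolynomial (Fin n) ℂ :=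
  ∑ j ∈ Finset.Iic i,
    MvPolynomial.C
      (((∏ l ∈ Finset.Icc 1 (∑ k, j k), (s 1 + (∑ k, (i k : ℂ)) - (l : ℂ))) *
          ∏ k, ∏ l ∈ Finset.Icc 1 (j k), ((i k : ℂ) - (l : ℂ) + 1)) /
        ((∏ k : Fin n, ∏ l ∈ Finset.Icc 1 (j k), (s k.succ.succ + (l : ℂ) - 1)) *
          ∏ k, ((j k)! : ℂ))) *
      ∏ k, MvPolynomial.X k ^ j k

/-- `u₀^{i₁+⋯+iₙ} P_{i₁,…,iₙ}(u₁ / u₀, …, uₙ / u₀)` for `x₁, …, xₙ₊₁` in a power series ring over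
`ℂ`; it is used where the constant term of `u₀` is nonzero, so that `u₀⁻¹` is a true inverse. -/
def homogenizedP {n m : ℕ} (t : Fin n → ℂ) (s : Fin (n + 2) → ℂ)
    (x : Fin (n + 1) → MvPowerSeries (Fin m) ℂ) (i : Fin n → ℕ) : MvPowerSeries (Fin m) ℂ :=
  u₀ t x ^ (∑ k, i k) * MvPolynomial.aeval (fun k => u t x k * (u₀ t x)⁻¹) (P s i)

/-! ### Sums over `i₁, …, iₙ` and the boundary condition -/

/-- Only finitely many of the series `Qᵢ` contribute to a given monomial in the `1 / yₖ`. -/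
def IsLocallyFinite {n : ℕ} (Q : (Fin n → ℕ) → InvYSeries n ℂ) : Prop :=
  ∀ j, {i | MvPowerSeries.coeff j (Q i) ≠ 0}.Finite

/-- The formal sum `∑_{i₁,…,iₙ} aᵢ Qᵢ(y)` of a locally finite family, taken monomial by monomial
in the `1 / yₖ`. -/
def formalSum {n : ℕ} {A : Type*} [CommRing A] [Algebra ℂ A] (a : (Fin n → ℕ) → A)
    (Q : (Fin n → ℕ) → InvYSeries n ℂ) : InvYSeries n A :=
  fun j => ∑ᶠ i, MvPowerSeries.coeff j (Q i) • a i

/-- `1 / (yₖ - a) = y_k⁻¹ (1 - a y_k⁻¹)⁻¹`, expanded in negative powers of `yₖ`. -/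
def cauchyFactor {n : ℕ} {A : Type*} [CommRing A] (k : Fin n) (a : A) : InvYSeries n A :=
  MvPowerSeries.X k *
    MvPowerSeries.invOfUnit (1 - MvPowerSeries.C a * MvPowerSeries.X k) 1

/-- `(1 / n!) ∑_σ 1 / ((y_{σ₁} - x₁) ⋯ (y_{σₙ} - xₙ))`. -/
def boundaryValue (n : ℕ) : InvYSeries n (MvPowerSeries (Fin n) ℂ) :=
  ((n ! : ℂ)⁻¹) • ∑ σ : Equiv.Perm (Fin n),
    ∏ k, cauchyFactor (σ k) (MvPowerSeries.X k : MvPowerSeries (Fin n) ℂ)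

/-- The variables `x₁, …, xₙ₊₁` themselves. -/
def xVars (n : ℕ) : Fin (n + 1) → MvPowerSeries (Fin (n + 1)) ℂ :=
  fun k => MvPowerSeries.X k

/-- The variables `x₁, …, xₙ, 0`, that is, `xₙ₊₁ = 0`. -/
def xVarsBoundary (n : ℕ) : Fin (n + 1) → MvPowerSeries (Fin n) ℂ :=
  Fin.snoc (fun k => MvPowerSeries.X k) 0

/-- The system of equations for the functions `Q_{i₁,…,iₙ}(y₁, …, yₙ)`. -/
structure IsBoundaryFamily {n : ℕ} (t : Fin n → ℂ) (s : Fin (n + 2) → ℂ)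
    (Q : (Fin n → ℕ) → InvYSeries n ℂ) : Prop where
  locallyFinite : IsLocallyFinite Q
  system : formalSum (homogenizedP t s (xVarsBoundary n)) Q = boundaryValue n

/-- The general term, without `Qᵢ(y)`, of the expansion of the kernel:
`F(r₁ + |i|, r₂ + |i|, s₁, x₁ ⋯ xₙ₊₁ / (t₁ ⋯ tₙ)) u₀^{|i|} P_i(u₁ / u₀, …, uₙ / u₀)`. -/
def expansionTerm {n : ℕ} (t : Fin n → ℂ) (s : Fin (n + 2) → ℂ) (r₁ r₂ : ℂ) (i : Fin n → ℕ) :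
    MvPowerSeries (Fin (n + 1)) ℂ :=
  gaussFactor t (r₁ + ∑ k, (i k : ℂ)) (r₂ + ∑ k, (i k : ℂ)) (s 0) * homogenizedP t s (xVars n) i

end FuchsianKernel

end

noncomputable section

namespace FuchsianKernel

/-! ### Taylor series of analytic functions -/

/-! Write L for the leading coefficient, Λ(x) = λ₁ + λ₂x + ⋯ + λₙxⁿ⁻¹, and Δ for the product `discr`
of all differences of the variables. The theorem comes from eliminating λ by Lagrange interpolation,
using n variables for the basis and n + 1 variables for the kernel.

The point 0 is a regular singularity with indicial polynomial ρ(ρ - 1 + s₁). The hypothesis on s₁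
therefore makes the Taylor recurrence solvable, and its solutions grow at most geometrically
(`fuchsSeriesOp_eq_zero_iff`, `exists_norm_solSeq_le`). Running the same recurrence over ℂ[λ]
produces the pᵢ.

Basis. The λ-free part of D in the variable xᵢ, applied to f(x₁)⋯f(xₙ), gives -Λ(xᵢ) f(x₁)⋯f(xₙ).
Interpolating Λ at the n nodes xᵢ recovers multiplication by each λₖ. Keeping track of degrees, λₖ
(k counted from 1) maps products p_J with |J| ≤ d into the span of those with |J| ≤ d + k
(`X_mul_mem_productSpan`). So every monomial of weight at most N is a combination of products of
weight at most N. Monotone tuples of weight at most N embed into such monomials, and a dimension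
count gives independence.

Kernel equation. With n + 1 nodes, Λ has degree below the top one, so a suitable combination
`kernelOp` of the operators in x₁, …, xₙ₊₁ annihilates f(x₁)⋯f(xₙ₊₁) and is free of λ. It commutes
with every linear map applied to the coefficients in ℂ[λ], hence annihilates each y-coefficient of
K.

Explicit solutions. In the coordinates w_a = (-1)ⁿ ∏ₖ(xₖ - a)/L'(a), one for each singular point a,
the second order form becomes Γ(w_a, w_b) = Δ w_a (w_b + δ_ab), and the operator without its
constant term maps w_a to Δ(σ w_a + s_a), where σ is the sum of all s_a. On polynomials in the w_a
with a ≠ 0 it is Δ times an Euler operator part plus a Laplacian. The polynomial u₀^|i| Pᵢ(u/u₀) is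
homogeneous and harmonic in these coordinates (`laplaceOp_homPoly`). Multiplying it by F(-w₀) leaves
exactly the Gauss equation with parameters shifted by |i| (`kernelOp_expansionTerm`).

Comparison. Both sides of the expansion solve the kernel equation, are symmetric in x, and agree at
xₙ₊₁ = 0. Their difference is divisible by every xₖ, and such a solution vanishes, because the
indicial factor (m + 1)(m + s₁) forces ever higher powers of w₀ to divide it
(`nodeCoord_zero_dvd_of_kernelOp`, `eq_formalSum_expansionTerm`).

Uniqueness of Q. The w_a sum to -1, so at xₙ₊₁ = 0 the harmonic polynomials are restricted to an
affine hyperplane. There the degree d part is an eigenspace with eigenvalue d(d - 1 + s₂ + ⋯ +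
sₙ₊₂). These eigenvalues are distinct, so the restrictions are independent, and counting degrees
makes them a basis of polynomials in n variables. The restricted uₖ freely generate the symmetric
polynomials, among which lie all y-coefficients of the right-hand side of (*)
(`existsUnique_isBoundaryFamily`). -/

/-- The Taylor series of `g` at `0`. -/
def taylorSeries (g : ℂ → ℂ) : PowerSeries ℂ :=
  PowerSeries.mk fun i => iteratedDeriv i g 0 / (i ! : ℂ)

lemma taylorSeries_add {f g : ℂ → ℂ} (hf : AnalyticAt ℂ f 0) (hg : AnalyticAt ℂ g 0) :
    taylorSeries (fun x => f x + g x) = taylorSeries f + taylorSeries g := by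
  ext i
  simp only [taylorSeries, PowerSeries.coeff_mk, map_add]
  rw [iteratedDeriv_fun_add hf.contDiffAt hg.contDiffAt, add_div]

lemma taylorSeries_mul {f g : ℂ → ℂ} (hf : AnalyticAt ℂ f 0) (hg : AnalyticAt ℂ g 0) :
    taylorSeries (fun x => f x * g x) = taylorSeries f * taylorSeries g := by
  ext i
  rw [PowerSeries.coeff_mul, Finset.Nat.sum_antidiagonal_eq_sum_range_succ_mk]
  simp only [taylorSeries, PowerSeries.coeff_mk]
  rw [iteratedDeriv_fun_mul hf.contDiffAt hg.contDiffAt, Finset.sum_div]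
  refine Finset.sum_congr rfl fun k hk => ?_
  have hk' : k ≤ i := Nat.lt_succ_iff.mp (Finset.mem_range.mp hk)
  rw [Nat.cast_choose ℂ hk']
  have h1 : (i ! : ℂ) ≠ 0 := Nat.cast_ne_zero.mpr (Nat.factorial_ne_zero _)
  have h2 : (k ! : ℂ) ≠ 0 := Nat.cast_ne_zero.mpr (Nat.factorial_ne_zero _)
  have h3 : ((i - k) ! : ℂ) ≠ 0 := Nat.cast_ne_zero.mpr (Nat.factorial_ne_zero _)
  field_simp

lemma taylorSeries_deriv (f : ℂ → ℂ) :
    taylorSeries (deriv f) = PowerSeries.derivative ℂ (taylorSeries f) := by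
  ext i
  rw [PowerSeries.coeff_derivative]
  simp only [taylorSeries, PowerSeries.coeff_mk]
  rw [iteratedDeriv_succ', Nat.factorial_succ]
  have h1 : (i ! : ℂ) ≠ 0 := Nat.cast_ne_zero.mpr (Nat.factorial_ne_zero _)
  have h2 : (i + 1 : ℂ) ≠ 0 := Nat.cast_add_one_ne_zero i
  push_cast
  field_simp

lemma taylorSeries_const (c : ℂ) : taylorSeries (fun _ => c) = PowerSeries.C c := by
  ext i
  simp only [taylorSeries, PowerSeries.coeff_mk, iteratedDeriv_const, PowerSeries.coeff_C]
  split_ifs with h <;> simp [h]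

lemma taylorSeries_id : taylorSeries (fun x => x) = PowerSeries.X := by
  ext i
  simp only [taylorSeries, PowerSeries.coeff_mk, iteratedDeriv_fun_id_zero, PowerSeries.coeff_X]
  split_ifs with h <;> simp [h]

lemma analyticAt_polynomial_eval (q : Polynomial ℂ) : AnalyticAt ℂ (fun x => q.eval x) 0 :=
  AnalyticAt.aeval_polynomial (f := fun x : ℂ => x) analyticAt_id q

lemma taylorSeries_polynomial (q : Polynomial ℂ) :
    taylorSeries (fun x => q.eval x) = (q : PowerSeries ℂ) := by
  induction q using Polynomial.induction_on' with
  | add p q hp hq =>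
    simp only [Polynomial.eval_add, Polynomial.coe_add]
    rw [taylorSeries_add (analyticAt_polynomial_eval p) (analyticAt_polynomial_eval q), hp, hq]
  | monomial m a =>
    induction m with
    | zero => simpa using taylorSeries_const a
    | succ m ih =>
      have h : (fun x => (Polynomial.monomial (m + 1) a).eval x) =
          fun x => (Polynomial.monomial m a).eval x * x := by
        funext x; simp [pow_succ, mul_assoc]
      rw [h, taylorSeries_mul (analyticAt_polynomial_eval _) (g := fun x => x) analyticAt_id, ih, taylorSeries_id,
        ← Polynomial.coe_X, ← Polynomial.coe_mul, Polynomial.monomial_mul_X]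

lemma taylorSeries_congr {f g : ℂ → ℂ} (h : f =ᶠ[𝓝 0] g) : taylorSeries f = taylorSeries g := by
  ext i
  simp only [taylorSeries, PowerSeries.coeff_mk, h.iteratedDeriv_eq i]

lemma eventually_eq_zero_of_taylorSeries {f : ℂ → ℂ} (hf : AnalyticAt ℂ f 0)
    (h : taylorSeries f = 0) : ∀ᶠ x in 𝓝 (0 : ℂ), f x = 0 := by
  have h1 := hf.hasFPowerSeriesAt
  have h2 : (fun n => iteratedDeriv n f 0 / (n ! : ℂ)) = 0 := by
    funext i
    have := congrArg (PowerSeries.coeff i) h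
    simpa [taylorSeries] using this
  rw [h2, FormalMultilinearSeries.ofScalars_series_eq_zero_of_scalar_zero] at h1
  exact h1.eventually_eq_zero

lemma exists_analyticAt_taylorSeries_eq {a : ℕ → ℂ} {R : ℝ} (hR : 0 < R)
    (ha : ∀ i, ‖a i‖ ≤ R ^ i) :
    ∃ f : ℂ → ℂ, AnalyticAt ℂ f 0 ∧ taylorSeries f = PowerSeries.mk a := by
  set q := FormalMultilinearSeries.ofScalars ℂ (𝕜 := ℂ) a with hq
  have hrad : 0 < q.radius := by
    have h1 : ((Real.toNNReal R⁻¹ : NNReal) : ENNReal) ≤ q.radius := by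
      refine q.le_radius_of_bound 1 fun i => ?_
      rw [hq, FormalMultilinearSeries.ofScalars_norm, Real.coe_toNNReal _ (inv_nonneg.mpr hR.le),
        inv_pow, ← div_eq_mul_inv]
      exact div_le_one_of_le₀ (ha i) (by positivity)
    refine lt_of_lt_of_le ?_ h1
    simpa using hR
  have hb := q.hasFPowerSeriesOnBall hrad
  refine ⟨q.sum, hb.analyticAt, ?_⟩
  have h2 := hb.hasFPowerSeriesAt.eq_formalMultilinearSeries hb.analyticAt.hasFPowerSeriesAt
  rw [hq] at h2
  have h3 := FormalMultilinearSeries.ofScalars_series_injective ℂ ℂ h2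
  rw [taylorSeries, ← h3]

/-! ### The differential equation for formal power series -/

/-- The leading coefficient as a polynomial. -/
def leadingPoly {n : ℕ} (t : Fin n → ℂ) : Polynomial ℂ :=
  ∏ k, (Polynomial.X - Polynomial.C (singularPoint t k))

/-- The coefficient of `d/dx` as a polynomial. -/
def firstOrderPoly {n : ℕ} (t : Fin n → ℂ) (s : Fin (n + 2) → ℂ) : Polynomial ℂ :=
  ∑ k, Polynomial.C (s k) * ∏ l ∈ Finset.univ.erase k,
    (Polynomial.X - Polynomial.C (singularPoint t l))

lemma eval_leadingPoly {n : ℕ} (t : Fin n → ℂ) (x : ℂ) :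
    (leadingPoly t).eval x = leadingCoeff t x := by
  simp [leadingPoly, leadingCoeff, Polynomial.eval_prod]

lemma eval_firstOrderPoly {n : ℕ} (t : Fin n → ℂ) (s : Fin (n + 2) → ℂ) (x : ℂ) :
    (firstOrderPoly t s).eval x = firstOrderCoeff t s x := by
  simp [firstOrderPoly, firstOrderCoeff, Polynomial.eval_prod, Polynomial.eval_finsetSum]

/-- The coefficients of the zeroth order polynomial, with the parameters `lam` in an algebra. -/
def zerothSeq {n : ℕ} {B : Type*} [CommRing B] [Algebra ℂ B] (r₁ r₂ : ℂ) (lam : Fin n → B)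
    (i : ℕ) : B :=
  if h : i < n then lam ⟨i, h⟩ else if i = n then algebraMap ℂ B (r₁ * r₂) else 0

/-- The coefficient of order zero as a polynomial. -/
def zerothPoly {n : ℕ} {B : Type*} [CommRing B] [Algebra ℂ B] (r₁ r₂ : ℂ) (lam : Fin n → B) :
    Polynomial B :=
  (∑ k : Fin n, Polynomial.C (lam k) * Polynomial.X ^ (k : ℕ)) +
    Polynomial.C (algebraMap ℂ B (r₁ * r₂)) * Polynomial.X ^ n

lemma coe_zerothPoly {n : ℕ} {B : Type*} [CommRing B] [Algebra ℂ B] (r₁ r₂ : ℂ) (lam : Fin n → B) :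
    (zerothPoly r₁ r₂ lam : PowerSeries B) = PowerSeries.mk (zerothSeq r₁ r₂ lam) := by
  ext i
  rw [Polynomial.coeff_coe, PowerSeries.coeff_mk, zerothPoly]
  simp only [Polynomial.coeff_add, Polynomial.finsetSum_coeff, Polynomial.coeff_C_mul,
    Polynomial.coeff_X_pow, zerothSeq]
  rcases lt_trichotomy i n with h | h | h
  · rw [dif_pos h, if_neg h.ne, mul_zero, add_zero, Finset.sum_eq_single (⟨i, h⟩ : Fin n)]
    · simp
    · intro b _ hb
      rw [if_neg, mul_zero]
      intro h; exact hb (Fin.ext h.symm)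
    · simp
  · rw [dif_neg h.not_lt, if_pos h, if_pos h, Finset.sum_eq_zero]
    · simp
    · intro b _
      rw [if_neg (by omega), mul_zero]
  · rw [dif_neg h.not_gt, if_neg h.ne', if_neg h.ne', Finset.sum_eq_zero]
    · simp
    · intro b _
      rw [if_neg (by omega), mul_zero]

lemma map_zerothSeq {n : ℕ} {B B' : Type*} [CommRing B] [Algebra ℂ B] [CommRing B'] [Algebra ℂ B']
    (g : B →ₐ[ℂ] B') (r₁ r₂ : ℂ) (lam : Fin n → B) (i : ℕ) :
    g (zerothSeq r₁ r₂ lam i) = zerothSeq r₁ r₂ (fun k => g (lam k)) i := by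
  unfold zerothSeq
  split_ifs <;> simp

/-- The operator `D_x` on formal power series. -/
def fuchsSeriesOp {n : ℕ} {B : Type*} [CommRing B] [Algebra ℂ B] (t : Fin n → ℂ)
    (s : Fin (n + 2) → ℂ) (r₁ r₂ : ℂ) (lam : Fin n → B) (f : PowerSeries B) : PowerSeries B :=
  (((leadingPoly t).map (algebraMap ℂ B) : Polynomial B) : PowerSeries B) *
      PowerSeries.derivative B (PowerSeries.derivative B f)
    + (((firstOrderPoly t s).map (algebraMap ℂ B) : Polynomial B) : PowerSeries B) *
      PowerSeries.derivative B f
    + PowerSeries.mk (zerothSeq r₁ r₂ lam) * f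

lemma leadingPoly_eq_X_mul {n : ℕ} (t : Fin n → ℂ) :
    leadingPoly t = Polynomial.X * ∏ k : Fin (n + 1),
      (Polynomial.X - Polynomial.C (singularPoint t k.succ)) := by
  rw [leadingPoly, Fin.prod_univ_succ]
  simp [singularPoint]

/-- The coefficient of the `m`-th Taylor coefficient in the `i`-th recurrence relation. -/
def recCoeff {n : ℕ} (t : Fin n → ℂ) (s : Fin (n + 2) → ℂ) (i m : ℕ) : ℂ :=
  m * ((m - 1) * (leadingPoly t).coeff (i + 2 - m) + (firstOrderPoly t s).coeff (i + 1 - m))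

/-- Grouping by the index of the Taylor coefficient isolates the newest one, number i + 1. Its
factor does not involve λ, so the recurrence can be solved over any algebra. -/
lemma coeff_fuchsSeriesOp {n : ℕ} {B : Type*} [CommRing B] [Algebra ℂ B] (t : Fin n → ℂ)
    (s : Fin (n + 2) → ℂ) (r₁ r₂ : ℂ) (lam : Fin n → B) (f : PowerSeries B) (i : ℕ) :
    PowerSeries.coeff i (fuchsSeriesOp t s r₁ r₂ lam f) =
      recCoeff t s i (i + 1) • PowerSeries.coeff (i + 1) f +
      ∑ m ∈ Finset.range (i + 1), (recCoeff t s i m • PowerSeries.coeff m f +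
        zerothSeq r₁ r₂ lam (i - m) * PowerSeries.coeff m f) := by
  have hL : PowerSeries.coeff i ((((leadingPoly t).map (algebraMap ℂ B) : Polynomial B) :
      PowerSeries B) * PowerSeries.derivative B (PowerSeries.derivative B f)) =
      ∑ m ∈ Finset.range (i + 2), ((m : ℂ) * ((m - 1) * (leadingPoly t).coeff (i + 2 - m))) •
        PowerSeries.coeff m f := by
    rw [mul_comm, PowerSeries.coeff_mul, Finset.Nat.sum_antidiagonal_eq_sum_range_succ_mk,
      Finset.sum_range_succ, Finset.sum_range_succ', Finset.sum_range_succ']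
    -- Since 0 is a singular point, the term with Taylor coefficient i + 2 drops out.
    have h0 : (leadingPoly t).coeff 0 = 0 := by simp [leadingPoly_eq_X_mul]
    simp only [PowerSeries.coeff_derivative, Polynomial.coeff_coe, Polynomial.coeff_map,
      Nat.sub_self, h0, map_zero, mul_zero, add_zero, Nat.cast_zero, zero_mul, zero_smul,
      zero_add, Nat.cast_one, sub_self]
    refine Finset.sum_congr rfl fun m _ => ?_
    rw [show i + 2 - (m + 1 + 1) = i - m by omega, Algebra.smul_def]
    simp only [Nat.cast_add, Nat.cast_one, map_mul, map_add, map_sub, map_natCast, map_one]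
    ring
  have hM : PowerSeries.coeff i ((((firstOrderPoly t s).map (algebraMap ℂ B) : Polynomial B) :
      PowerSeries B) * PowerSeries.derivative B f) =
      ∑ m ∈ Finset.range (i + 2), ((m : ℂ) * ((firstOrderPoly t s).coeff (i + 1 - m))) •
        PowerSeries.coeff m f := by
    rw [mul_comm, PowerSeries.coeff_mul, Finset.Nat.sum_antidiagonal_eq_sum_range_succ_mk,
      Finset.sum_range_succ' _ (i + 1)]
    simp only [PowerSeries.coeff_derivative, Polynomial.coeff_coe, Polynomial.coeff_map,
      Nat.cast_zero, zero_mul, zero_smul, add_zero]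
    refine Finset.sum_congr rfl fun m _ => ?_
    rw [show i + 1 - (m + 1) = i - m by omega, Algebra.smul_def]
    simp only [Nat.cast_add, Nat.cast_one, map_mul, map_add, map_natCast, map_one]
    ring
  have hZ : PowerSeries.coeff i (PowerSeries.mk (zerothSeq r₁ r₂ lam) * f) =
      ∑ m ∈ Finset.range (i + 1), zerothSeq r₁ r₂ lam (i - m) * PowerSeries.coeff m f := by
    rw [mul_comm, PowerSeries.coeff_mul, Finset.Nat.sum_antidiagonal_eq_sum_range_succ_mk]
    exact Finset.sum_congr rfl fun m _ => by rw [PowerSeries.coeff_mk, mul_comm]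
  rw [fuchsSeriesOp, map_add, map_add, hL, hM, hZ, ← Finset.sum_add_distrib,
    Finset.sum_range_succ, Finset.sum_add_distrib (s := Finset.range (i + 1)) (f := fun m =>
      recCoeff t s i m • PowerSeries.coeff m f)]
  simp only [recCoeff, ← add_smul, ← mul_add]
  ring

lemma taylorSeries_fuchsOp {n : ℕ} (t : Fin n → ℂ) (s : Fin (n + 2) → ℂ) (r₁ r₂ : ℂ)
    (lam : Fin n → ℂ) {f : ℂ → ℂ} (hf : AnalyticAt ℂ f 0) :
    AnalyticAt ℂ (fuchsOp t s r₁ r₂ lam f) 0 ∧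
    taylorSeries (fuchsOp t s r₁ r₂ lam f) = fuchsSeriesOp t s r₁ r₂ lam (taylorSeries f) := by
  set q : Polynomial ℂ := zerothPoly r₁ r₂ lam with hq
  have hqc := coe_zerothPoly r₁ r₂ lam
  have hfun : fuchsOp t s r₁ r₂ lam f = fun x => ((leadingPoly t).eval x * deriv (deriv f) x +
      (firstOrderPoly t s).eval x * deriv f x) + q.eval x * f x := by
    funext x
    simp [fuchsOp, eval_leadingPoly, eval_firstOrderPoly, zerothOrderCoeff, hq,
      zerothPoly, Polynomial.eval_finsetSum]
  have h1 := (analyticAt_polynomial_eval (leadingPoly t)).fun_mul hf.deriv.deriv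
  have h2 := (analyticAt_polynomial_eval (firstOrderPoly t s)).fun_mul hf.deriv
  have h3 := (analyticAt_polynomial_eval q).fun_mul hf
  rw [hfun]
  refine ⟨(h1.fun_add h2).fun_add h3, ?_⟩
  rw [taylorSeries_add (h1.fun_add h2) h3, taylorSeries_add h1 h2,
    taylorSeries_mul (analyticAt_polynomial_eval _) hf.deriv.deriv,
    taylorSeries_mul (analyticAt_polynomial_eval _) hf.deriv,
    taylorSeries_mul (analyticAt_polynomial_eval _) hf, taylorSeries_deriv, taylorSeries_deriv,
    taylorSeries_polynomial, taylorSeries_polynomial, taylorSeries_polynomial, hqc]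
  simp [fuchsSeriesOp]

/-! ### The solution of the recurrence relation -/

/-- This is the indicial polynomial ρ(ρ - 1 + s₁) at ρ = i + 1, up to the factor L'(0). -/
lemma recCoeff_succ {n : ℕ} (t : Fin n → ℂ) (s : Fin (n + 2) → ℂ) (i : ℕ) :
    recCoeff t s i (i + 1) = (i + 1) * (i + s 0) * ∏ k : Fin (n + 1), -singularPoint t k.succ := by
  have h1 : (leadingPoly t).coeff 1 = ∏ k : Fin (n + 1), -singularPoint t k.succ := by
    have := Polynomial.coeff_X_mul
      (∏ k : Fin (n + 1), (Polynomial.X - Polynomial.C (singularPoint t k.succ))) 0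
    rw [← leadingPoly_eq_X_mul, zero_add, Polynomial.coeff_zero_eq_eval_zero] at this
    rw [this]
    simp [Polynomial.eval_prod]
  have h2 : (firstOrderPoly t s).coeff 0 = s 0 * ∏ k : Fin (n + 1), -singularPoint t k.succ := by
    rw [Polynomial.coeff_zero_eq_eval_zero, eval_firstOrderPoly, firstOrderCoeff,
      Finset.sum_eq_single 0]
    · congr 1
      rw [show (Finset.univ.erase (0 : Fin (n + 2))) = Finset.univ.image Fin.succ by
        ext k; simp, Finset.prod_image (by intro a _ b _ h; simpa using h)]
      simp
    · intro k _ hk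
      rw [Finset.prod_eq_zero (i := 0), mul_zero]
      · simpa using hk.symm
      · simp [singularPoint]
    · simp
  rw [recCoeff, show i + 2 - (i + 1) = 1 by omega, show i + 1 - (i + 1) = 0 by omega, h1, h2]
  push_cast
  ring

lemma prod_neg_singularPoint_ne_zero {n : ℕ} {t : Fin n → ℂ} (ht₀ : ∀ i, t i ≠ 0) :
    ∏ k : Fin (n + 1), -singularPoint t k.succ ≠ 0 := by
  rw [Finset.prod_ne_zero_iff]
  intro k _
  rw [neg_ne_zero]
  refine Fin.cases ?_ (fun i => ?_) k
  · simp [singularPoint]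
  · simpa [singularPoint] using ht₀ i

lemma recCoeff_succ_ne_zero {n : ℕ} {t : Fin n → ℂ} {s : Fin (n + 2) → ℂ} (ht₀ : ∀ i, t i ≠ 0)
    (hs₁ : ∀ m : ℕ, s 0 ≠ -(m : ℂ)) (i : ℕ) : recCoeff t s i (i + 1) ≠ 0 := by
  rw [recCoeff_succ]
  refine mul_ne_zero (mul_ne_zero (Nat.cast_add_one_ne_zero i) fun h => hs₁ i ?_)
    (prod_neg_singularPoint_ne_zero ht₀)
  exact eq_neg_of_add_eq_zero_right h

/-- The Taylor coefficients of the normalized solution. -/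
def solSeq {n : ℕ} {B : Type*} [CommRing B] [Algebra ℂ B] (t : Fin n → ℂ)
    (s : Fin (n + 2) → ℂ) (r₁ r₂ : ℂ) (lam : Fin n → B) : ℕ → B
  | 0 => 1
  | i + 1 => -(recCoeff t s i (i + 1))⁻¹ • ∑ m : Fin (i + 1),
      (recCoeff t s i m • solSeq t s r₁ r₂ lam m +
        zerothSeq r₁ r₂ lam (i - m) * solSeq t s r₁ r₂ lam m)

/-- Naturality of the recurrence in the coefficient algebra. Applied to evaluation at λ, it
identifies the values of the polynomials pᵢ with Taylor coefficients of actual solutions. -/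
lemma map_solSeq {n : ℕ} {B B' : Type*} [CommRing B] [Algebra ℂ B] [CommRing B'] [Algebra ℂ B']
    (g : B →ₐ[ℂ] B') (t : Fin n → ℂ) (s : Fin (n + 2) → ℂ) (r₁ r₂ : ℂ) (lam : Fin n → B) (i : ℕ) :
    g (solSeq t s r₁ r₂ lam i) = solSeq t s r₁ r₂ (fun k => g (lam k)) i := by
  induction i using Nat.strong_induction_on with
  | _ i ih =>
    cases i with
    | zero => simp [solSeq]
    | succ i =>
      rw [solSeq, solSeq, map_smul, map_sum]
      congr 1
      refine Finset.sum_congr rfl fun m _ => ?_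
      rw [map_add, map_smul, map_mul, ih m m.2, map_zerothSeq]

lemma fuchsSeriesOp_eq_zero_iff {n : ℕ} {B : Type*} [CommRing B] [Algebra ℂ B] {t : Fin n → ℂ}
    {s : Fin (n + 2) → ℂ} (r₁ r₂ : ℂ) (ht₀ : ∀ i, t i ≠ 0) (hs₁ : ∀ m : ℕ, s 0 ≠ -(m : ℂ))
    (lam : Fin n → B) (f : PowerSeries B) (hf : PowerSeries.coeff 0 f = 1) :
    fuchsSeriesOp t s r₁ r₂ lam f = 0 ↔ f = PowerSeries.mk (solSeq t s r₁ r₂ lam) := by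
  have key : ∀ i, PowerSeries.coeff i (fuchsSeriesOp t s r₁ r₂ lam f) = 0 ↔
      PowerSeries.coeff (i + 1) f = -(recCoeff t s i (i + 1))⁻¹ • ∑ m : Fin (i + 1),
      (recCoeff t s i m • PowerSeries.coeff m f +
        zerothSeq r₁ r₂ lam (i - m) * PowerSeries.coeff m f) := by
    intro i
    rw [coeff_fuchsSeriesOp, Finset.sum_range, add_eq_zero_iff_eq_neg, neg_smul, ← smul_neg,
      eq_inv_smul_iff₀ (recCoeff_succ_ne_zero ht₀ hs₁ i)]
  constructor
  · intro h
    ext i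
    rw [PowerSeries.coeff_mk]
    induction i using Nat.strong_induction_on with
    | _ i ih =>
      cases i with
      | zero => rw [hf, solSeq]
      | succ i =>
        rw [(key i).mp (by rw [h, map_zero]), solSeq]
        congr 1
        refine Finset.sum_congr rfl fun m _ => ?_
        rw [ih m m.2]
  · intro h
    ext i
    rw [map_zero, key, h]
    simp only [PowerSeries.coeff_mk]
    rw [solSeq]

lemma exists_norm_coeff_le (q : Polynomial ℂ) : ∃ b : ℝ, 0 ≤ b ∧ ∀ i, ‖q.coeff i‖ ≤ b := by
  refine ⟨∑ i ∈ q.support, ‖q.coeff i‖, Finset.sum_nonneg fun _ _ => norm_nonneg _, fun i => ?_⟩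
  by_cases h : i ∈ q.support
  · exact Finset.single_le_sum (f := fun i => ‖q.coeff i‖) (fun _ _ => norm_nonneg _) h
  · rw [Polynomial.notMem_support_iff.mp h, norm_zero]
    exact Finset.sum_nonneg fun _ _ => norm_nonneg _

lemma exists_add_one_le_mul_norm_add {c : ℂ} (hc : ∀ m : ℕ, c ≠ -(m : ℂ)) :
    ∃ b : ℝ, 0 ≤ b ∧ ∀ i : ℕ, (i + 1 : ℝ) ≤ b * ‖(i : ℂ) + c‖ := by
  -- From this threshold on, i - ‖c‖ ≥ (i + 1)/2, so the constant 2 suffices. The finitely many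
  -- smaller i are absorbed by the sum added to it.
  obtain ⟨N, hN⟩ := exists_nat_ge (2 * ‖c‖ + 1)
  have hpos : ∀ i : ℕ, 0 < ‖(i : ℂ) + c‖ := fun i =>
    norm_pos_iff.mpr fun h => hc i (eq_neg_of_add_eq_zero_right h)
  have hnn : ∀ i ∈ Finset.range N, (0 : ℝ) ≤ (i + 1) / ‖(i : ℂ) + c‖ := fun i _ => by positivity
  refine ⟨2 + ∑ i ∈ Finset.range N, (i + 1) / ‖(i : ℂ) + c‖,
    add_nonneg zero_le_two (Finset.sum_nonneg hnn), fun i => ?_⟩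
  by_cases h : i < N
  · have h1 := Finset.single_le_sum hnn (Finset.mem_range.mpr h)
    rw [← div_le_iff₀ (hpos i)]
    linarith
  · have h1 : (N : ℝ) ≤ i := by exact_mod_cast not_lt.mp h
    have h2 : (i : ℝ) - ‖c‖ ≤ ‖(i : ℂ) + c‖ := by
      have := norm_sub_le ((i : ℂ) + c) c
      rw [add_sub_cancel_right, Complex.norm_natCast] at this
      linarith
    have h3 := mul_nonneg (Finset.sum_nonneg hnn) (hpos i).le
    rw [add_mul]
    linarith

/-- The factors in the recurrence grow at most like (i + 1)², and so does the indicial factor one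
divides by, from below. Hence each coefficient is at most a constant times the sum of the norms of
its predecessors. -/
lemma exists_norm_solSeq_le {n : ℕ} {t : Fin n → ℂ} {s : Fin (n + 2) → ℂ} (r₁ r₂ : ℂ)
    (ht₀ : ∀ i, t i ≠ 0) (hs₁ : ∀ m : ℕ, s 0 ≠ -(m : ℂ)) (lam : Fin n → ℂ) :
    ∃ R : ℝ, 0 < R ∧ ∀ i, ‖solSeq t s r₁ r₂ lam i‖ ≤ R ^ i := by
  obtain ⟨b₁, hb₁, hL⟩ := exists_norm_coeff_le (leadingPoly t)
  obtain ⟨b₂, hb₂, hM⟩ := exists_norm_coeff_le (firstOrderPoly t s)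
  obtain ⟨b₃, hb₃, hs⟩ := exists_add_one_le_mul_norm_add hs₁
  set d := ∏ k : Fin (n + 1), -singularPoint t k.succ with hd
  have hd0 : 0 < ‖d‖ := norm_pos_iff.mpr (prod_neg_singularPoint_ne_zero ht₀)
  set b₄ : ℝ := (∑ k, ‖lam k‖) + ‖r₁ * r₂‖ with hb₄
  have hb₄0 : 0 ≤ b₄ := by positivity
  have hZ : ∀ i, ‖zerothSeq r₁ r₂ lam i‖ ≤ b₄ := by
    intro i
    have hsum : 0 ≤ ∑ k, ‖lam k‖ := Finset.sum_nonneg fun _ _ => norm_nonneg _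
    unfold zerothSeq
    split_ifs with h1 h2
    · have := Finset.single_le_sum (f := fun k => ‖lam k‖) (fun _ _ => norm_nonneg _)
        (Finset.mem_univ (⟨i, h1⟩ : Fin n))
      have h3 := norm_nonneg (r₁ * r₂)
      linarith
    · rw [Algebra.algebraMap_self_apply]
      linarith
    · simpa using hb₄0
  set c := (b₁ + b₂ + b₄) * (b₃ / ‖d‖) with hc
  have hc0 : 0 ≤ c := by positivity
  have hstep : ∀ i, ‖solSeq t s r₁ r₂ lam (i + 1)‖ ≤
      c * ∑ m ∈ Finset.range (i + 1), ‖solSeq t s r₁ r₂ lam m‖ := by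
    intro i
    have hi : (0 : ℝ) < i + 1 := by positivity
    have hk : (i + 1 : ℝ) ^ 2 ≤ (b₃ / ‖d‖) * ‖recCoeff t s i (i + 1)‖ := by
      rw [recCoeff_succ, norm_mul, norm_mul, ← hd]
      have : ‖((i : ℂ) + 1)‖ = i + 1 := by
        rw [← Nat.cast_add_one, Complex.norm_natCast]; push_cast; ring
      rw [this]
      have h1 := mul_le_mul_of_nonneg_left (hs i) hi.le
      calc (i + 1 : ℝ) ^ 2 = (i + 1) * (i + 1) := by ring
        _ ≤ _ := h1
        _ = _ := by field_simp
    have hκ : 0 < ‖recCoeff t s i (i + 1)‖ := norm_pos_iff.mpr (recCoeff_succ_ne_zero ht₀ hs₁ i)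
    rw [solSeq, norm_smul, norm_neg, norm_inv, inv_mul_le_iff₀ hκ]
    have hterm : ∀ m : Fin (i + 1), ‖recCoeff t s i m • solSeq t s r₁ r₂ lam m +
        zerothSeq r₁ r₂ lam (i - m) * solSeq t s r₁ r₂ lam m‖ ≤
        ((b₁ + b₂ + b₄) * (i + 1) ^ 2) * ‖solSeq t s r₁ r₂ lam m‖ := by
      intro m
      rw [smul_eq_mul, ← add_mul, norm_mul]
      refine mul_le_mul_of_nonneg_right ?_ (norm_nonneg _)
      have hm : ((m : ℕ) : ℝ) ≤ i + 1 := by exact_mod_cast m.2.le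
      have hm1 : ‖(((m : ℕ) : ℂ) - 1)‖ ≤ i + 1 := by
        rcases Nat.eq_zero_or_pos (m : ℕ) with h | h
        · rw [h]; simp
        · have h5 : ((m : ℕ) : ℂ) - 1 = (((m : ℕ) - 1 : ℕ) : ℂ) := by
            rw [Nat.cast_sub h, Nat.cast_one]
          rw [h5, Complex.norm_natCast]
          have : (((m : ℕ) - 1 : ℕ) : ℝ) ≤ (m : ℕ) := by exact_mod_cast Nat.sub_le _ _
          linarith
      have hrec : ‖recCoeff t s i m‖ ≤ (i + 1) * ((i + 1) * b₁ + b₂) := by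
        rw [recCoeff, norm_mul, Complex.norm_natCast]
        refine mul_le_mul hm ((norm_add_le _ _).trans (add_le_add ?_ (hM _))) (norm_nonneg _) hi.le
        rw [norm_mul]
        exact mul_le_mul hm1 (hL _) (norm_nonneg _) hi.le
      have h1 : (1 : ℝ) ≤ i + 1 := by
        have : (0 : ℝ) ≤ i := Nat.cast_nonneg i
        linarith
      have h2 : (i + 1 : ℝ) ≤ (i + 1) ^ 2 := by nlinarith
      calc _ ≤ _ := norm_add_le _ _
        _ ≤ (i + 1) * ((i + 1) * b₁ + b₂) + b₄ := add_le_add hrec (hZ _)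
        _ ≤ (i + 1) ^ 2 * b₁ + (i + 1) ^ 2 * b₂ + (i + 1) ^ 2 * b₄ := by
          have h3 := mul_le_mul_of_nonneg_right h2 hb₂
          have h4 := mul_le_mul_of_nonneg_right (h1.trans h2) hb₄0
          linarith
        _ = _ := by ring
    calc _ ≤ ∑ m : Fin (i + 1), ((b₁ + b₂ + b₄) * (i + 1) ^ 2) * ‖solSeq t s r₁ r₂ lam m‖ :=
          norm_sum_le_of_le _ fun m _ => hterm m
      _ = ((b₁ + b₂ + b₄) * (i + 1) ^ 2) *
          ∑ m ∈ Finset.range (i + 1), ‖solSeq t s r₁ r₂ lam m‖ := by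
          rw [← Finset.mul_sum, Finset.sum_range]
      _ ≤ ((b₁ + b₂ + b₄) * ((b₃ / ‖d‖) * ‖recCoeff t s i (i + 1)‖)) *
          ∑ m ∈ Finset.range (i + 1), ‖solSeq t s r₁ r₂ lam m‖ := by
          gcongr
      _ = _ := by rw [hc]; ring
  -- The ratio c + 1 is chosen so that c times the geometric sum of (c + 1)ᵐ over m ≤ i telescopes
  -- to (c + 1)ⁱ⁺¹ - 1.
  refine ⟨c + 1, by linarith, fun i => ?_⟩
  have hsum : ∀ i, c * ∑ m ∈ Finset.range (i + 1), (c + 1) ^ m ≤ (c + 1) ^ (i + 1) := by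
    intro i
    have := mul_geom_sum (c + 1) (i + 1)
    rw [add_sub_cancel_right] at this
    rw [this]
    linarith
  induction i using Nat.strong_induction_on with
  | _ i ih =>
    cases i with
    | zero => simp [solSeq]
    | succ i =>
      refine (hstep i).trans (le_trans ?_ (hsum i))
      exact mul_le_mul_of_nonneg_left
        (Finset.sum_le_sum fun m hm => ih m (Finset.mem_range.mp hm)) hc0

lemma isNormalizedSolution_iff {n : ℕ} {t : Fin n → ℂ}
    {s : Fin (n + 2) → ℂ} (r₁ r₂ : ℂ) (ht₀ : ∀ i, t i ≠ 0) (hs₁ : ∀ m : ℕ, s 0 ≠ -(m : ℂ))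
    (lam : Fin n → ℂ) (f : ℂ → ℂ) :
    IsNormalizedSolution t s r₁ r₂ lam f ↔
      AnalyticAt ℂ f 0 ∧ taylorSeries f = PowerSeries.mk (solSeq t s r₁ r₂ lam) := by
  have h0 : PowerSeries.coeff 0 (taylorSeries f) = f 0 := by simp [taylorSeries]
  constructor
  · rintro ⟨h1, h2, h3⟩
    refine ⟨h1, (fuchsSeriesOp_eq_zero_iff r₁ r₂ ht₀ hs₁ lam _ (by rw [h0, h3])).mp ?_⟩
    rw [← (taylorSeries_fuchsOp t s r₁ r₂ lam h1).2, taylorSeries_congr h2, taylorSeries_const,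
      map_zero]
  · rintro ⟨h1, h2⟩
    have h3 : f 0 = 1 := by rw [← h0, h2, PowerSeries.coeff_mk, solSeq]
    refine ⟨h1, eventually_eq_zero_of_taylorSeries (taylorSeries_fuchsOp t s r₁ r₂ lam h1).1 ?_, h3⟩
    rw [(taylorSeries_fuchsOp t s r₁ r₂ lam h1).2]
    exact (fuchsSeriesOp_eq_zero_iff r₁ r₂ ht₀ hs₁ lam _ (by rw [h0, h3])).mpr h2

/-- The Taylor coefficients of the normalized solution, as polynomials in the parameters. -/
def solPoly {n : ℕ} (t : Fin n → ℂ) (s : Fin (n + 2) → ℂ) (r₁ r₂ : ℂ) :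
    ℕ → MvPolynomial (Fin n) ℂ :=
  solSeq t s r₁ r₂ MvPolynomial.X

lemma isTaylorFamily_iff {n : ℕ} {t : Fin n → ℂ} {s : Fin (n + 2) → ℂ} (r₁ r₂ : ℂ)
    (ht₀ : ∀ i, t i ≠ 0) (hs₁ : ∀ m : ℕ, s 0 ≠ -(m : ℂ)) (p : ℕ → MvPolynomial (Fin n) ℂ) :
    IsTaylorFamily t s r₁ r₂ p ↔ p = solPoly t s r₁ r₂ := by
  have hex : ∀ lam : Fin n → ℂ, ∃ f, IsNormalizedSolution t s r₁ r₂ lam f := by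
    intro lam
    obtain ⟨R, hR, hle⟩ := exists_norm_solSeq_le r₁ r₂ ht₀ hs₁ lam
    obtain ⟨f, hf, hf'⟩ := exists_analyticAt_taylorSeries_eq hR hle
    exact ⟨f, (isNormalizedSolution_iff r₁ r₂ ht₀ hs₁ lam f).mpr ⟨hf, hf'⟩⟩
  have hev : ∀ (lam : Fin n → ℂ) f, IsNormalizedSolution t s r₁ r₂ lam f → ∀ i,
      iteratedDeriv i f 0 / (i ! : ℂ) = MvPolynomial.eval lam (solPoly t s r₁ r₂ i) := by
    intro lam f hf i
    have h := congrArg (PowerSeries.coeff i)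
      ((isNormalizedSolution_iff r₁ r₂ ht₀ hs₁ lam f).mp hf).2
    rw [taylorSeries, PowerSeries.coeff_mk, PowerSeries.coeff_mk] at h
    rw [h, solPoly, ← MvPolynomial.coe_aeval_eq_eval]
    have := map_solSeq (MvPolynomial.aeval lam) t s r₁ r₂ MvPolynomial.X i
    simp only [MvPolynomial.aeval_X] at this
    exact this.symm
  constructor
  · intro h
    funext i
    refine MvPolynomial.funext fun lam => ?_
    obtain ⟨⟨f, hf⟩, h2⟩ := h lam
    rw [← h2 f hf i, hev lam f hf i]
  · rintro rfl lam
    exact ⟨hex lam, hev lam⟩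

/-! ### Lagrange interpolation without denominators -/

section Lagrange

variable {ι R : Type*} [Fintype ι] [CommRing R]

/-- The product of all differences `x a - x b` with `a ≠ b`. -/
def discr (x : ι → R) : R := ∏ p ∈ Finset.univ.offDiag, (x p.1 - x p.2)

lemma discr_ne_zero [IsDomain R] {x : ι → R} (hx : Function.Injective x) : discr x ≠ 0 := by
  rw [discr, Finset.prod_ne_zero_iff]
  rintro ⟨a, b⟩ h
  simp only [Finset.mem_offDiag, Finset.mem_univ, true_and] at h
  exact sub_ne_zero.mpr fun h' => h (hx h')

variable [DecidableEq ι]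

/-- The product of all differences `x a - x b` with `a ≠ b` and `a ≠ i`. -/
def cofac (x : ι → R) (i : ι) : R :=
  ∏ p ∈ Finset.univ.offDiag.filter (fun p : ι × ι => p.1 ≠ i), (x p.1 - x p.2)

lemma filter_offDiag_fst (i : ι) :
    Finset.univ.offDiag.filter (fun p : ι × ι => ¬p.1 ≠ i) =
      (Finset.univ.erase i).image (fun b => (i, b)) := by
  ext ⟨a, b⟩
  simp only [Finset.mem_filter, Finset.mem_offDiag, Finset.mem_univ, true_and, not_not,
    Finset.mem_image, Finset.mem_erase, and_true, Prod.mk.injEq]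
  constructor
  · rintro ⟨h1, rfl⟩
    exact ⟨b, h1.symm, rfl, rfl⟩
  · rintro ⟨c, h1, rfl, rfl⟩
    exact ⟨h1.symm, rfl⟩

lemma discr_eq_cofac_mul (x : ι → R) (i : ι) :
    discr x = cofac x i * ∏ b ∈ Finset.univ.erase i, (x i - x b) := by
  rw [discr, ← Finset.prod_filter_mul_prod_filter_not _ (fun p : ι × ι => p.1 ≠ i),
    filter_offDiag_fst, Finset.prod_image (by intro a _ b _ h; exact (Prod.mk.inj h).2)]
  rfl

lemma card_filter_offDiag_add (i : ι) :
    (Finset.univ.offDiag.filter (fun p : ι × ι => p.1 ≠ i)).card + (Fintype.card ι - 1) =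
      (Finset.univ : Finset ι).offDiag.card := by
  rw [← Finset.card_filter_add_card_filter_not (s := Finset.univ.offDiag) (fun p : ι × ι => p.1 ≠ i),
    filter_offDiag_fst, Finset.card_image_of_injective _ (Prod.mk_right_injective i),
    Finset.card_erase_of_mem (Finset.mem_univ i), Finset.card_univ]

/-- Lagrange's formula for the top coefficient, ∑ q(xᵢ)/∏_{b ≠ i}(xᵢ - x_b), checked in the fraction
field and multiplied by `discr` so that it makes sense in power series rings. Every elimination
below rests on it. -/
lemma sum_cofac_mul_eval [IsDomain R] {x : ι → R} (hx : Function.Injective x)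
    {q : Polynomial R} (hq : q.degree < Fintype.card ι) :
    ∑ i, cofac x i * q.eval (x i) = discr x * q.coeff (Fintype.card ι - 1) := by
  set f := algebraMap R (FractionRing R) with hf
  have hinj : Function.Injective f := IsFractionRing.injective R (FractionRing R)
  have hx' : Function.Injective fun i => f (x i) := hinj.comp hx
  apply hinj
  have h1 := Lagrange.coeff_eq_sum (s := Finset.univ) (v := fun i => f (x i)) (P := q.map f)
    hx'.injOn (by rw [Polynomial.degree_map_eq_of_injective hinj]; exact hq)
  rw [Finset.card_univ, Polynomial.coeff_map] at h1
  rw [map_mul, h1, map_sum, Finset.mul_sum]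
  refine Finset.sum_congr rfl fun i _ => ?_
  rw [map_mul, discr_eq_cofac_mul x i, map_mul, map_prod, Polynomial.eval_map_apply]
  have h2 : ∏ b ∈ Finset.univ.erase i, (f (x i) - f (x b)) ≠ 0 := by
    rw [Finset.prod_ne_zero_iff]
    intro b hb
    exact sub_ne_zero.mpr fun h => (Finset.ne_of_mem_erase hb) (hx' h).symm
  simp only [map_sub]
  field_simp

end Lagrange

/-! ### Products of the solution in several variables -/

lemma coeff_X_mul {ι B : Type*} [DecidableEq ι] [CommRing B] (i : ι) (g : MvPowerSeries ι B)
    (a : ι →₀ ℕ) : MvPowerSeries.coeff a (MvPowerSeries.X i * g) =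
      if a i = 0 then 0 else MvPowerSeries.coeff (a - Finsupp.single i 1) g := by
  rw [MvPowerSeries.X_def, MvPowerSeries.coeff_monomial_mul, one_mul]
  simp only [Finsupp.single_le_iff, Nat.one_le_iff_ne_zero, ne_eq, ite_not]

section ProdSeries

variable {m : ℕ} {B : Type*} [CommRing B]

/-- The series `f(x₁) ⋯ f(xₘ)`, where `f` has coefficients `p`. -/
def prodSeries (m : ℕ) (p : ℕ → B) : MvPowerSeries (Fin m) B := fun a => ∏ k, p (a k)

/-- The series `g(xᵢ) ∏_{k ≠ i} f(xₖ)`, where `f` has coefficients `p`. -/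
def prodSeriesAt (p : ℕ → B) (i : Fin m) (g : PowerSeries B) : MvPowerSeries (Fin m) B :=
  fun a => PowerSeries.coeff (a i) g * ∏ k ∈ Finset.univ.erase i, p (a k)

lemma coeff_prodSeries (p : ℕ → B) (a : Fin m →₀ ℕ) :
    MvPowerSeries.coeff a (prodSeries m p) = ∏ k, p (a k) := rfl

lemma coeff_prodSeriesAt (p : ℕ → B) (i : Fin m) (g : PowerSeries B) (a : Fin m →₀ ℕ) :
    MvPowerSeries.coeff a (prodSeriesAt p i g) =
      PowerSeries.coeff (a i) g * ∏ k ∈ Finset.univ.erase i, p (a k) := rfl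

lemma prodSeriesAt_mk (p : ℕ → B) (i : Fin m) :
    prodSeriesAt p i (PowerSeries.mk p) = prodSeries m p := by
  ext a
  rw [coeff_prodSeriesAt, coeff_prodSeries, PowerSeries.coeff_mk,
    Finset.mul_prod_erase _ (fun k => p (a k)) (Finset.mem_univ i)]

lemma prodSeriesAt_add (p : ℕ → B) (i : Fin m) (g h : PowerSeries B) :
    prodSeriesAt p i (g + h) = prodSeriesAt p i g + prodSeriesAt p i h := by
  ext a
  simp only [coeff_prodSeriesAt, map_add, add_mul]

lemma prodSeriesAt_zero (p : ℕ → B) (i : Fin m) : prodSeriesAt p i (0 : PowerSeries B) = 0 := by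
  ext a
  simp only [coeff_prodSeriesAt, map_zero, zero_mul]

lemma prod_erase_congr_of_eq_off (p : ℕ → B) (i : Fin m) {a b : Fin m →₀ ℕ}
    (h : ∀ k, k ≠ i → a k = b k) :
    ∏ k ∈ Finset.univ.erase i, p (a k) = ∏ k ∈ Finset.univ.erase i, p (b k) :=
  Finset.prod_congr rfl fun k hk => by rw [h k (Finset.ne_of_mem_erase hk)]

lemma prodSeriesAt_X_mul (p : ℕ → B) (i : Fin m) (g : PowerSeries B) :
    prodSeriesAt p i (PowerSeries.X * g) = MvPowerSeries.X i * prodSeriesAt p i g := by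
  ext a
  rw [coeff_X_mul, coeff_prodSeriesAt, coeff_prodSeriesAt]
  split_ifs with h
  · rw [h, PowerSeries.coeff_zero_X_mul, zero_mul]
  · obtain ⟨l, hl⟩ := Nat.exists_eq_succ_of_ne_zero h
    rw [hl, PowerSeries.coeff_succ_X_mul]
    congr 1
    · simp [hl]
    · refine prod_erase_congr_of_eq_off p i fun k hk => ?_
      simp [hk.symm]

lemma prodSeriesAt_C_mul (p : ℕ → B) (i : Fin m) (c : B) (g : PowerSeries B) :
    prodSeriesAt p i (PowerSeries.C c * g) = MvPowerSeries.C c * prodSeriesAt p i g := by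
  ext a
  rw [MvPowerSeries.coeff_C_mul, coeff_prodSeriesAt, coeff_prodSeriesAt, PowerSeries.coeff_C_mul,
    mul_assoc]

lemma prodSeriesAt_polynomial_mul (p : ℕ → B) (i : Fin m) (q : Polynomial B) (g : PowerSeries B) :
    prodSeriesAt p i ((q : PowerSeries B) * g) =
      q.eval₂ MvPowerSeries.C (MvPowerSeries.X i) * prodSeriesAt p i g := by
  induction q using Polynomial.induction_on' with
  | add p q hp hq =>
    rw [Polynomial.coe_add, add_mul, prodSeriesAt_add, hp, hq, Polynomial.eval₂_add, add_mul]
  | monomial l c =>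
    rw [← Polynomial.C_mul_X_pow_eq_monomial, Polynomial.coe_mul, Polynomial.coe_C,
      Polynomial.coe_pow, Polynomial.coe_X, Polynomial.eval₂_mul, Polynomial.eval₂_C,
      Polynomial.eval₂_X_pow, mul_assoc, prodSeriesAt_C_mul, mul_assoc]
    congr 1
    induction l with
    | zero => simp
    | succ l ih => rw [pow_succ', mul_assoc, prodSeriesAt_X_mul, ih, pow_succ', mul_assoc]

lemma pderiv_prodSeriesAt (p : ℕ → B) (i : Fin m) (g : PowerSeries B) :
    MvPowerSeries.pderiv B i (prodSeriesAt p i g) =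
      prodSeriesAt p i (PowerSeries.derivative B g) := by
  ext a
  rw [MvPowerSeries.coeff_pderiv, coeff_prodSeriesAt, coeff_prodSeriesAt,
    PowerSeries.coeff_derivative, prod_erase_congr_of_eq_off p i (b := a)]
  · simp only [Finsupp.add_apply, Finsupp.single_eq_same]
    ring
  · intro k hk
    simp [hk.symm]

end ProdSeries

/-- The part of `D_{xᵢ}` which does not involve the parameters. -/
def partialOp {n m : ℕ} {B : Type*} [CommRing B] [Algebra ℂ B] (t : Fin n → ℂ)
    (s : Fin (n + 2) → ℂ) (r₁ r₂ : ℂ) (i : Fin m) (g : MvPowerSeries (Fin m) B) :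
    MvPowerSeries (Fin m) B :=
  Polynomial.aeval (MvPowerSeries.X i) (leadingPoly t) *
      MvPowerSeries.pderiv B i (MvPowerSeries.pderiv B i g) +
    Polynomial.aeval (MvPowerSeries.X i) (firstOrderPoly t s) * MvPowerSeries.pderiv B i g +
    (r₁ * r₂) • (MvPowerSeries.X i ^ n * g)

/-- Only the factor f(xᵢ) is differentiated, so this is the differential equation of f with the
λ-part moved to the right. -/
lemma partialOp_prodSeries {n m : ℕ} {B : Type*} [CommRing B] [Algebra ℂ B] {t : Fin n → ℂ}
    {s : Fin (n + 2) → ℂ} (r₁ r₂ : ℂ) (ht₀ : ∀ i, t i ≠ 0) (hs₁ : ∀ m : ℕ, s 0 ≠ -(m : ℂ))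
    (lam : Fin n → B) (i : Fin m) :
    partialOp t s r₁ r₂ i (prodSeries m (solSeq t s r₁ r₂ lam)) =
      -((∑ k : Fin n, MvPowerSeries.C (lam k) * MvPowerSeries.X i ^ (k : ℕ)) *
        prodSeries m (solSeq t s r₁ r₂ lam)) := by
  set p := solSeq t s r₁ r₂ lam with hp
  have h := (fuchsSeriesOp_eq_zero_iff r₁ r₂ ht₀ hs₁ lam (PowerSeries.mk p)
    (by rw [PowerSeries.coeff_mk, hp, solSeq])).mpr rfl
  have h2 := congrArg (prodSeriesAt p i) h
  rw [fuchsSeriesOp, ← coe_zerothPoly, prodSeriesAt_add, prodSeriesAt_add,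
    prodSeriesAt_polynomial_mul, prodSeriesAt_polynomial_mul, prodSeriesAt_polynomial_mul,
    ← pderiv_prodSeriesAt, ← pderiv_prodSeriesAt, prodSeriesAt_mk, prodSeriesAt_zero,
    Polynomial.eval₂_map, Polynomial.eval₂_map, zerothPoly, Polynomial.eval₂_add,
    Polynomial.eval₂_finsetSum] at h2
  simp only [Polynomial.eval₂_mul, Polynomial.eval₂_C, Polynomial.eval₂_X_pow] at h2
  have hC : (MvPowerSeries.C : B →+* MvPowerSeries (Fin m) B).comp (algebraMap ℂ B) =
      algebraMap ℂ (MvPowerSeries (Fin m) B) := by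
    ext1 c
    rw [MvPowerSeries.algebraMap_apply, RingHom.comp_apply]
  rw [hC, ← Polynomial.aeval_def, ← Polynomial.aeval_def] at h2
  rw [partialOp, eq_neg_iff_add_eq_zero, ← h2]
  have hr : MvPowerSeries.C (algebraMap ℂ B (r₁ * r₂)) * MvPowerSeries.X i ^ n *
      prodSeries m p = (r₁ * r₂) • (MvPowerSeries.X i ^ n * prodSeries m p) := by
    rw [Algebra.smul_def, ← hC, RingHom.comp_apply, mul_assoc]
  rw [add_mul (∑ k : Fin n, _), hr]
  ring

/-! ### Series whose coefficients lie in a filtration -/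

section Filtered

variable {m : ℕ} {A : Type*} [CommRing A] [Algebra ℂ A] {V : ℤ → Submodule ℂ A}

lemma coeff_smul_algebra (c : ℂ) (g : MvPowerSeries (Fin m) A) (a : Fin m →₀ ℕ) :
    MvPowerSeries.coeff a (c • g) = c • MvPowerSeries.coeff a g := rfl

/-- The series whose coefficient at `a` lies in `V (|a| + k)`. -/
def filteredSeries (m : ℕ) (V : ℤ → Submodule ℂ A) (k : ℤ) :
    Submodule ℂ (MvPowerSeries (Fin m) A) where
  carrier := {g | ∀ a : Fin m →₀ ℕ, MvPowerSeries.coeff a g ∈ V (a.degree + k)}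
  add_mem' := fun hf hg a => by rw [map_add]; exact add_mem (hf a) (hg a)
  zero_mem' := fun a => by rw [map_zero]; exact zero_mem _
  smul_mem' := fun c f hf a => by
    rw [coeff_smul_algebra]; exact Submodule.smul_mem _ c (hf a)

lemma filteredSeries_mono (hV : Monotone V) : Monotone (filteredSeries m V) :=
  fun _ _ hkl _ hg a => hV (by omega) (hg a)

lemma degree_sub_single {a : Fin m →₀ ℕ} {i : Fin m} (h : a i ≠ 0) :
    ((a - Finsupp.single i 1).degree : ℤ) = a.degree - 1 := by
  have h1 : a - Finsupp.single i 1 + Finsupp.single i 1 = a :=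
    tsub_add_cancel_of_le (Finsupp.single_le_iff.mpr (Nat.one_le_iff_ne_zero.mpr h))
  have h2 := congrArg Finsupp.degree h1
  rw [map_add, Finsupp.degree_single] at h2
  omega

lemma X_mul_mem_filteredSeries {k : ℤ} {g : MvPowerSeries (Fin m) A} (i : Fin m)
    (hg : g ∈ filteredSeries m V k) : MvPowerSeries.X i * g ∈ filteredSeries m V (k - 1) := by
  intro a
  rw [coeff_X_mul]
  split_ifs with h
  · exact zero_mem _
  · have := hg (a - Finsupp.single i 1)
    rw [degree_sub_single h] at this
    convert this using 2
    ring

lemma X_pow_mul_mem_filteredSeries {k : ℤ} {g : MvPowerSeries (Fin m) A} (i : Fin m) (l : ℕ)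
    (hg : g ∈ filteredSeries m V k) : MvPowerSeries.X i ^ l * g ∈ filteredSeries m V (k - l) := by
  induction l with
  | zero => simpa using hg
  | succ l ih =>
    rw [pow_succ', mul_assoc]
    have := X_mul_mem_filteredSeries i ih
    push_cast
    rwa [← sub_sub]

lemma pderiv_mem_filteredSeries {k : ℤ} {g : MvPowerSeries (Fin m) A} (i : Fin m)
    (hg : g ∈ filteredSeries m V k) : MvPowerSeries.pderiv A i g ∈ filteredSeries m V (k + 1) := by
  intro a
  have h1 := hg (a + Finsupp.single i 1)
  rw [map_add, Finsupp.degree_single] at h1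
  rw [MvPowerSeries.coeff_pderiv, ← Nat.cast_add_one, mul_comm, ← nsmul_eq_mul]
  refine nsmul_mem ?_ _
  convert h1 using 2
  push_cast
  ring

lemma aeval_mul_mem_filteredSeries (hV : Monotone V) {k : ℤ} {g : MvPowerSeries (Fin m) A}
    (i : Fin m) (q : Polynomial ℂ) (hg : g ∈ filteredSeries m V k) :
    Polynomial.aeval (MvPowerSeries.X i) q * g ∈ filteredSeries m V k := by
  induction q using Polynomial.induction_on' with
  | add p q hp hq => rw [map_add, add_mul]; exact add_mem hp hq
  | monomial l c =>
    rw [Polynomial.aeval_monomial, mul_assoc, ← Algebra.smul_def]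
    exact Submodule.smul_mem _ _ (filteredSeries_mono hV (by omega)
      (X_pow_mul_mem_filteredSeries i l hg))

/-- The coefficient of (Xᵢ - Xⱼ)g at a + eᵢ is g_a minus the coefficient of g at a + eᵢ - eⱼ. The
latter index has the same degree and a smaller j-th entry, so induction on a j applies. This is what
permits dividing by the differences in `discr`. -/
lemma mem_filteredSeries_of_sub_mul {k : ℤ} {g : MvPowerSeries (Fin m) A} {i j : Fin m}
    (hij : i ≠ j) (hg : (MvPowerSeries.X i - MvPowerSeries.X j) * g ∈ filteredSeries m V (k - 1)) :
    g ∈ filteredSeries m V k := by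
  suffices h : ∀ N : ℕ, ∀ a : Fin m →₀ ℕ, a j = N →
      MvPowerSeries.coeff a g ∈ V (a.degree + k) from fun a => h _ a rfl
  intro N
  induction N with
  | zero =>
    intro a ha
    have h1 := hg (a + Finsupp.single i 1)
    rw [sub_mul, map_sub, coeff_X_mul, coeff_X_mul, if_neg (by simp), if_pos (by simp [ha, hij]),
      add_tsub_cancel_right, sub_zero, map_add, Finsupp.degree_single] at h1
    convert h1 using 2
    push_cast
    ring
  | succ N ih =>
    intro a ha
    have h1 := hg (a + Finsupp.single i 1)
    have hne : (a + Finsupp.single i 1 : Fin m →₀ ℕ) j ≠ 0 := by simp [ha]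
    rw [sub_mul, map_sub, coeff_X_mul, coeff_X_mul, if_neg (by simp), if_neg hne,
      add_tsub_cancel_right] at h1
    have h2 := ih (a + Finsupp.single i 1 - Finsupp.single j 1) (by simp [ha, hij])
    rw [degree_sub_single hne] at h2
    rw [map_add, Finsupp.degree_single] at h1 h2
    have h3 : ((a.degree + 1 : ℕ) : ℤ) + (k - 1) = a.degree + k := by push_cast; ring
    have h4 : ((a.degree + 1 : ℕ) : ℤ) - 1 + k = a.degree + k := by push_cast; ring
    rw [h3] at h1
    rw [h4] at h2
    simpa using add_mem h1 h2

lemma prod_sub_mul_mem_filteredSeries {k : ℤ} {g : MvPowerSeries (Fin m) A}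
    (S : Finset (Fin m × Fin m)) (hg : g ∈ filteredSeries m V k) :
    (∏ p ∈ S, (MvPowerSeries.X p.1 - MvPowerSeries.X p.2)) * g ∈
      filteredSeries m V (k - S.card) := by
  induction S using Finset.induction_on with
  | empty => simpa using hg
  | insert p S hp ih =>
    rw [Finset.prod_insert hp, mul_assoc, Finset.card_insert_of_notMem hp, sub_mul]
    push_cast
    rw [← sub_sub]
    exact sub_mem (X_mul_mem_filteredSeries _ ih) (X_mul_mem_filteredSeries _ ih)

lemma mem_filteredSeries_of_prod_sub_mul {k : ℤ} {g : MvPowerSeries (Fin m) A}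
    (S : Finset (Fin m × Fin m)) (hS : ∀ p ∈ S, p.1 ≠ p.2)
    (hg : (∏ p ∈ S, (MvPowerSeries.X p.1 - MvPowerSeries.X p.2)) * g ∈
      filteredSeries m V (k - S.card)) : g ∈ filteredSeries m V k := by
  induction S using Finset.induction_on generalizing k with
  | empty => simpa using hg
  | insert p S hp ih =>
    rw [Finset.prod_insert hp, mul_assoc, Finset.card_insert_of_notMem hp] at hg
    push_cast at hg
    rw [← sub_sub] at hg
    exact ih (fun q hq => hS q (Finset.mem_insert_of_mem hq))
      (mem_filteredSeries_of_sub_mul (hS p (Finset.mem_insert_self p S)) hg)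

end Filtered

lemma X_injective {m : ℕ} {A : Type*} [CommRing A] [Nontrivial A] :
    Function.Injective (fun i : Fin m => (MvPowerSeries.X i : MvPowerSeries (Fin m) A)) :=
  fun _ _ h => MvPowerSeries.X_inj.mp h

/-- If the values of `∑ lamₖ yᵏ` at the variables multiply `g` into a filtration step, then so
do its coefficients. -/
lemma C_mul_mem_filteredSeries {n : ℕ} {A : Type*} [CommRing A] [IsDomain A] [Algebra ℂ A]
    {V : ℤ → Submodule ℂ A} {g : MvPowerSeries (Fin n) A}
    (lam : Fin n → A) (h : ∀ i : Fin n,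
      (∑ k : Fin n, MvPowerSeries.C (lam k) * MvPowerSeries.X i ^ (k : ℕ)) * g ∈
        filteredSeries n V 1) (k : Fin n) :
    MvPowerSeries.C (lam k) * g ∈ filteredSeries n V (k + 1) := by
  -- Downward induction on k: interpolation yields the top coefficient of Λ, which is then
  -- subtracted, leaving Λ truncated to a smaller degree.
  suffices H : ∀ d : ℕ, ∀ k : Fin n, n = k + 1 + d →
      (∀ i : Fin n, (∑ l : Fin n with l ≤ k, MvPowerSeries.C (lam l) *
        MvPowerSeries.X i ^ (l : ℕ)) * g ∈ filteredSeries n V 1) ∧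
      MvPowerSeries.C (lam k) * g ∈ filteredSeries n V (k + 1) from
    (H (n - (k + 1)) k (by omega)).2
  have top : ∀ k : Fin n, (∀ i : Fin n, (∑ l : Fin n with l ≤ k, MvPowerSeries.C (lam l) *
        MvPowerSeries.X i ^ (l : ℕ)) * g ∈ filteredSeries n V 1) →
      MvPowerSeries.C (lam k) * g ∈ filteredSeries n V (k + 1) := by
    intro k hk
    -- Multiplying the truncated Λ by this power moves its coefficient k to position n - 1, the one
    -- that Lagrange's formula on n nodes extracts.
    set q : Polynomial (MvPowerSeries (Fin n) A) := Polynomial.X ^ (n - 1 - k) *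
      ∑ l : Fin n with l ≤ k, Polynomial.C (MvPowerSeries.C (lam l)) * Polynomial.X ^ (l : ℕ)
      with hq
    have hdeg : q.degree < Fintype.card (Fin n) := by
      rw [Fintype.card_fin, hq, Polynomial.degree_lt_iff_coeff_zero]
      intro j hj
      rw [Polynomial.coeff_X_pow_mul', if_pos (by omega), Polynomial.finsetSum_coeff]
      refine Finset.sum_eq_zero fun l hl => ?_
      have hl' : l ≤ k := (Finset.mem_filter.mp hl).2
      rw [Polynomial.coeff_C_mul, Polynomial.coeff_X_pow, if_neg, mul_zero]
      have : (l : ℕ) ≤ k := hl'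
      omega
    have hcoef : q.coeff (Fintype.card (Fin n) - 1) = MvPowerSeries.C (lam k) := by
      rw [Fintype.card_fin, hq, Polynomial.coeff_X_pow_mul', if_pos (by omega),
        Polynomial.finsetSum_coeff, Finset.sum_eq_single k]
      · rw [Polynomial.coeff_C_mul, Polynomial.coeff_X_pow, if_pos (by omega), mul_one]
      · intro l hl hlk
        have hl' : l ≤ k := (Finset.mem_filter.mp hl).2
        rw [Polynomial.coeff_C_mul, Polynomial.coeff_X_pow, if_neg, mul_zero]
        have : (l : ℕ) ≠ k := fun h => hlk (Fin.ext h)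
        omega
      · simp
    have : IsDomain (MvPowerSeries (Fin n) A) := NoZeroDivisors.to_isDomain _
    have key := sum_cofac_mul_eval (X_injective (m := n) (A := A)) hdeg
    rw [hcoef] at key
    have key2 := congrArg (fun x => x * g) key
    beta_reduce at key2
    rw [mul_assoc, Finset.sum_mul] at key2
    refine mem_filteredSeries_of_prod_sub_mul (Finset.univ.offDiag)
      (fun p hp => (Finset.mem_offDiag.mp hp).2.2) ?_
    rw [discr] at key2
    rw [← key2]
    refine sum_mem fun i _ => ?_
    have h1 := X_pow_mul_mem_filteredSeries i (n - 1 - k) (hk i)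
    have h2 := prod_sub_mul_mem_filteredSeries
      (Finset.univ.offDiag.filter (fun p : Fin n × Fin n => p.1 ≠ i)) h1
    -- `cofac` has n - 1 factors fewer than `discr`. Together with the power of Xᵢ this accounts for
    -- the shift from 1 to k + 1.
    have h3 := card_filter_offDiag_add i
    rw [Fintype.card_fin] at h3
    have h4 : (1 : ℤ) - ((n - 1 - k : ℕ) : ℤ) -
        ((Finset.univ.offDiag.filter (fun p : Fin n × Fin n => p.1 ≠ i)).card : ℤ) =
        k + 1 - ((Finset.univ : Finset (Fin n)).offDiag.card : ℤ) := by
      rw [← h3]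
      have := k.2
      omega
    rw [h4] at h2
    convert h2 using 1
    rw [hq, cofac]
    simp only [Polynomial.eval_mul, Polynomial.eval_pow, Polynomial.eval_X,
      Polynomial.eval_finsetSum, Polynomial.eval_C]
    ring
  intro d
  induction d with
  | zero =>
    intro k hk
    have h1 : ∀ i : Fin n, (∑ l : Fin n with l ≤ k, MvPowerSeries.C (lam l) *
        MvPowerSeries.X i ^ (l : ℕ)) * g ∈ filteredSeries n V 1 := by
      intro i
      rw [Finset.filter_true_of_mem]
      · exact h i
      · intro l _
        rw [Fin.le_def]
        omega
    exact ⟨h1, top k h1⟩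
  | succ d ih =>
    intro k hk
    obtain ⟨h1, h2⟩ := ih ⟨k + 1, by omega⟩ (by simp; omega)
    have h3 : ∀ i : Fin n, (∑ l : Fin n with l ≤ k, MvPowerSeries.C (lam l) *
        MvPowerSeries.X i ^ (l : ℕ)) * g ∈ filteredSeries n V 1 := by
      intro i
      have h4 := X_pow_mul_mem_filteredSeries i (k + 1) h2
      have h5 : (((⟨k + 1, by omega⟩ : Fin n) : ℕ) : ℤ) + 1 - ((k + 1 : ℕ) : ℤ) = 1 := by simp
      rw [h5] at h4
      have h6 := (filteredSeries n V 1).sub_mem (h1 i) h4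
      convert h6 using 1
      have h7 : (Finset.univ.filter fun l : Fin n => l ≤ ⟨k + 1, by omega⟩) =
          insert ⟨k + 1, by omega⟩ (Finset.univ.filter fun l : Fin n => l ≤ k) := by
        ext l
        simp only [Finset.mem_filter, Finset.mem_univ, true_and, Finset.mem_insert, Fin.le_def,
          Fin.ext_iff]
        omega
      rw [h7, Finset.sum_insert (fun hm => by
        have h8 := Fin.le_def.mp (Finset.mem_filter.mp hm).2
        exact absurd h8 (Nat.not_succ_le_self _))]
      ring
    exact ⟨h3, top k h3⟩

/-! ### The basis of products -/

/-- The span of the products `p_{J₁} ⋯ p_{Jₙ}` with `|J| ≤ d`. -/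
def productSpan {n : ℕ} (p : ℕ → MvPolynomial (Fin n) ℂ) (d : ℤ) :
    Submodule ℂ (MvPolynomial (Fin n) ℂ) :=
  Submodule.span ℂ ((fun J : Fin n → ℕ => ∏ k, p (J k)) '' {J | ((∑ k, J k : ℕ) : ℤ) ≤ d})

lemma productSpan_mono {n : ℕ} (p : ℕ → MvPolynomial (Fin n) ℂ) : Monotone (productSpan p) :=
  fun _ _ h => Submodule.span_mono (Set.image_mono fun _ hJ => le_trans hJ h)

lemma prodSeries_mem_filteredSeries {n : ℕ} (p : ℕ → MvPolynomial (Fin n) ℂ) :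
    prodSeries n p ∈ filteredSeries n (productSpan p) 0 := by
  intro a
  refine Submodule.subset_span ⟨a, ?_, rfl⟩
  rw [Set.mem_ofPred_eq, Finsupp.degree_eq_sum, add_zero]

lemma aeval_leadingPoly_mul_mem {n m : ℕ} {A : Type*} [CommRing A] [Algebra ℂ A]
    {V : ℤ → Submodule ℂ A} (hV : Monotone V) {k : ℤ} {g : MvPowerSeries (Fin m) A}
    (t : Fin n → ℂ) (i : Fin m) (hg : g ∈ filteredSeries m V k) :
    Polynomial.aeval (MvPowerSeries.X i) (leadingPoly t) * g ∈ filteredSeries m V (k - 1) := by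
  rw [leadingPoly_eq_X_mul, map_mul, Polynomial.aeval_X, mul_assoc]
  exact X_mul_mem_filteredSeries i (aeval_mul_mem_filteredSeries hV i _ hg)

lemma partialOp_mem_filteredSeries {n m : ℕ} {A : Type*} [CommRing A] [Algebra ℂ A]
    {V : ℤ → Submodule ℂ A} (hV : Monotone V) {g : MvPowerSeries (Fin m) A} (t : Fin n → ℂ)
    (s : Fin (n + 2) → ℂ) (r₁ r₂ : ℂ) (i : Fin m) (hg : g ∈ filteredSeries m V 0) :
    partialOp t s r₁ r₂ i g ∈ filteredSeries m V 1 := by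
  refine Submodule.add_mem _ (Submodule.add_mem _ ?_ ?_) (Submodule.smul_mem _ _ ?_)
  · have := aeval_leadingPoly_mul_mem hV t i
      (pderiv_mem_filteredSeries i (pderiv_mem_filteredSeries i hg))
    simpa using this
  · simpa using aeval_mul_mem_filteredSeries hV i (firstOrderPoly t s)
      (pderiv_mem_filteredSeries i hg)
  · exact filteredSeries_mono hV (by omega) (X_pow_mul_mem_filteredSeries i n hg)

/-- The coefficient at J of λₖ f(x₁)⋯f(xₙ) is λₖ p_J. The differential operator raises the
filtration by one, because L vanishes at 0 and compensates one of the two derivatives, and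
interpolation accounts for the rest. -/
lemma X_mul_mem_productSpan {n : ℕ} {t : Fin n → ℂ} {s : Fin (n + 2) → ℂ} (r₁ r₂ : ℂ)
    (ht₀ : ∀ i, t i ≠ 0) (hs₁ : ∀ m : ℕ, s 0 ≠ -(m : ℂ)) (k : Fin n) {d : ℤ}
    {f : MvPolynomial (Fin n) ℂ} (hf : f ∈ productSpan (solPoly t s r₁ r₂) d) :
    MvPolynomial.X k * f ∈ productSpan (solPoly t s r₁ r₂) (d + (k + 1)) := by
  have hV := productSpan_mono (solPoly t s r₁ r₂)
  have hmem : ∀ i : Fin n, (∑ k : Fin n, MvPowerSeries.C (MvPolynomial.X k : MvPolynomial _ ℂ) *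
      MvPowerSeries.X i ^ (k : ℕ)) * prodSeries n (solPoly t s r₁ r₂) ∈
      filteredSeries n (productSpan (solPoly t s r₁ r₂)) 1 := by
    intro i
    have h1 := partialOp_prodSeries (m := n) r₁ r₂ ht₀ hs₁
      (MvPolynomial.X : Fin n → MvPolynomial (Fin n) ℂ) i
    rw [← neg_eq_iff_eq_neg] at h1
    have h2 := Submodule.neg_mem _ (partialOp_mem_filteredSeries hV t s r₁ r₂ i
      (prodSeries_mem_filteredSeries (solPoly t s r₁ r₂)))
    exact h1 ▸ h2
  have hk := C_mul_mem_filteredSeries _ hmem k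
  rw [productSpan] at hf
  induction hf using Submodule.span_induction with
  | mem x hx =>
    obtain ⟨J, hJ, rfl⟩ := hx
    have h1 := hk (Finsupp.equivFunOnFinite.symm J)
    rw [MvPowerSeries.coeff_C_mul, coeff_prodSeries, Finsupp.degree_eq_sum] at h1
    simp only [Finsupp.equivFunOnFinite_symm_apply_apply] at h1
    exact hV (by simpa using hJ) h1
  | zero => rw [mul_zero]; exact zero_mem _
  | add x y _ _ hx hy => rw [mul_add]; exact add_mem hx hy
  | smul c x _ hx => rw [mul_smul_comm]; exact Submodule.smul_mem _ _ hx

lemma monomial_mem_productSpan {n : ℕ} {t : Fin n → ℂ} {s : Fin (n + 2) → ℂ} (r₁ r₂ : ℂ)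
    (ht₀ : ∀ i, t i ≠ 0) (hs₁ : ∀ m : ℕ, s 0 ≠ -(m : ℂ)) (a : Fin n →₀ ℕ) :
    MvPolynomial.monomial a (1 : ℂ) ∈
      productSpan (solPoly t s r₁ r₂) ((∑ k, a k * (k + 1) : ℕ) : ℤ) := by
  suffices H : ∀ N : ℕ, ∀ a : Fin n →₀ ℕ, a.degree = N → MvPolynomial.monomial a (1 : ℂ) ∈
      productSpan (solPoly t s r₁ r₂) ((∑ k, a k * (k + 1) : ℕ) : ℤ) from H _ a rfl
  intro N
  induction N with
  | zero =>
    intro a ha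
    rw [Finsupp.degree_eq_zero_iff] at ha
    refine Submodule.subset_span ⟨0, ?_, ?_⟩
    · simp only [Set.mem_ofPred_eq, Pi.zero_apply, Finset.sum_const_zero, Nat.cast_le, zero_le]
    · simp [ha, solPoly, solSeq]
  | succ N ih =>
    intro a ha
    obtain ⟨k, hk⟩ : ∃ k, a k ≠ 0 := by
      by_contra! h
      rw [show a = 0 from Finsupp.ext h, map_zero] at ha
      omega
    obtain ⟨b, rfl⟩ : ∃ b, a = Finsupp.single k 1 + b :=
      ⟨a - Finsupp.single k 1, (add_tsub_cancel_of_le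
        (Finsupp.single_le_iff.mpr (Nat.one_le_iff_ne_zero.mpr hk))).symm⟩
    rw [map_add, Finsupp.degree_single] at ha
    have h1 := X_mul_mem_productSpan r₁ r₂ ht₀ hs₁ k (ih b (by omega))
    rw [← one_mul (1 : ℂ), ← MvPolynomial.monomial_mul]
    change MvPolynomial.X k * _ ∈ _
    convert h1 using 2
    simp only [Finsupp.add_apply, add_mul, Finset.sum_add_distrib]
    rw [Finset.sum_eq_single k]
    · simp
      ring
    · intro b _ hb
      simp [hb.symm]
    · simp

/-! ### Linear independence by counting -/

/-- In each weight at most N there are finitely many b's, and their span contains equally many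
independent e's. They are therefore independent. -/
lemma linearIndependent_of_mem_span_le {ι M : Type*} [AddCommGroup M] [Module ℂ M] (w : ι → ℕ)
    (hw : ∀ N, {i | w i ≤ N}.Finite) {e b : ι → M} (he : LinearIndependent ℂ e)
    (h : ∀ i, e i ∈ Submodule.span ℂ (b '' {j | w j ≤ w i})) : LinearIndependent ℂ b := by
  have key : ∀ N, LinearIndependent ℂ (fun i : {i | w i ≤ N} => b i) := by
    intro N
    have := (hw N).fintype
    rw [linearIndependent_iff_card_le_finrank_span]
    have h1 : LinearIndependent ℂ (fun i : {i | w i ≤ N} => e i) :=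
      he.comp _ Subtype.val_injective
    rw [linearIndependent_iff_card_eq_finrank_span.mp h1]
    have hle : Submodule.span ℂ (Set.range fun i : {i | w i ≤ N} => e i) ≤
        Submodule.span ℂ (Set.range fun i : {i | w i ≤ N} => b i) := by
      rw [Submodule.span_le]
      rintro _ ⟨i, rfl⟩
      refine Submodule.span_mono ?_ (h i)
      rintro _ ⟨j, hj, rfl⟩
      exact ⟨⟨j, show w j ≤ N from le_trans hj i.2⟩, rfl⟩
    have : FiniteDimensional ℂ (Submodule.span ℂ (Set.range fun i : {i | w i ≤ N} => b i)) :=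
      FiniteDimensional.span_of_finite ℂ (Set.finite_range _)
    exact Submodule.finrank_mono hle
  rw [linearIndependent_iff']
  intro S g hg i hi
  obtain ⟨N, hN⟩ : ∃ N, ∀ j ∈ S, w j ≤ N := ⟨S.sup w, fun j hj => Finset.le_sup hj⟩
  have hk := key N
  have h2 : LinearIndepOn ℂ b {i | w i ≤ N} := hk
  exact linearIndepOn_iff'.mp h2 S g (fun j hj => hN j hj) hg i hi

/-- Both families span spaces of the same finite dimension in weight at most w i, and one space
contains the other, so they coincide. -/
lemma mem_span_le_of_linearIndependent {ι M : Type*} [AddCommGroup M] [Module ℂ M] (w : ι → ℕ)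
    (hw : ∀ N, {i | w i ≤ N}.Finite) {e b : ι → M} (he : LinearIndependent ℂ e)
    (hb : LinearIndependent ℂ b) (h : ∀ i, b i ∈ Submodule.span ℂ (e '' {j | w j ≤ w i})) (i : ι) :
    e i ∈ Submodule.span ℂ (b '' {j | w j ≤ w i}) := by
  have := (hw (w i)).fintype
  have h1 : LinearIndependent ℂ (fun j : {j | w j ≤ w i} => e j) :=
    he.comp _ Subtype.val_injective
  have h2 : LinearIndependent ℂ (fun j : {j | w j ≤ w i} => b j) :=
    hb.comp _ Subtype.val_injective
  have hle : Submodule.span ℂ (Set.range fun j : {j | w j ≤ w i} => b j) ≤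
      Submodule.span ℂ (Set.range fun j : {j | w j ≤ w i} => e j) := by
    rw [Submodule.span_le]
    rintro _ ⟨j, rfl⟩
    refine Submodule.span_mono ?_ (h j)
    rintro _ ⟨l, hl, rfl⟩
    exact ⟨⟨l, show w l ≤ w i from le_trans hl j.2⟩, rfl⟩
  have : FiniteDimensional ℂ (Submodule.span ℂ (Set.range fun j : {j | w j ≤ w i} => e j)) :=
    FiniteDimensional.span_of_finite ℂ (Set.finite_range _)
  have heq := Submodule.eq_of_le_of_finrank_eq hle (by
    rw [← Set.finrank, ← Set.finrank, ← linearIndependent_iff_card_eq_finrank_span.mp h1,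
      ← linearIndependent_iff_card_eq_finrank_span.mp h2])
  rw [Set.image_eq_range]
  change e i ∈ Submodule.span ℂ (Set.range fun j : {j | w j ≤ w i} => b j)
  rw [heq]
  exact Submodule.subset_span ⟨⟨i, show w i ≤ w i from le_rfl⟩, rfl⟩

/-! ### Monotone tuples and monomials -/

lemma sum_range_sub_of_le {n : ℕ} {F : ℕ → ℕ} (h0 : F 0 = 0) (hF : ∀ j < n, F j ≤ F (j + 1))
    {i : ℕ} (hi : i ≤ n) : ∑ j ∈ Finset.range i, (F (j + 1) - F j) = F i := by
  induction i with
  | zero => simp [h0]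
  | succ i ih =>
    have := hF i hi
    rw [Finset.sum_range_succ, ih (by omega)]
    omega

/-- Summation by parts. Monotonicity keeps the natural subtractions honest. -/
lemma sum_range_eq_sum_mul_sub {n : ℕ} {F : ℕ → ℕ} (h0 : F 0 = 0)
    (hF : ∀ j < n, F j ≤ F (j + 1)) {i : ℕ} (hi : i ≤ n) :
    ∑ j ∈ Finset.range i, F (j + 1) = ∑ j ∈ Finset.range i, (F (j + 1) - F j) * (i - j) := by
  induction i with
  | zero => simp
  | succ i ih =>
    have h1 := sum_range_sub_of_le h0 hF hi
    rw [Finset.sum_range_succ, ih (by omega), ← h1, Finset.sum_range_succ,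
      Finset.sum_range_succ (fun j => (F (j + 1) - F j) * (i + 1 - j)), ← add_assoc,
      ← Finset.sum_add_distrib]
    congr 1
    · refine Finset.sum_congr rfl fun j hj => ?_
      have := Finset.mem_range.mp hj
      rw [show i + 1 - j = i - j + 1 by omega]
      ring
    · rw [show i + 1 - i = 1 by omega, mul_one]

/-- The tuple `J` extended by zero, with indices shifted by one. -/
def shiftedExtension {n : ℕ} (J : Fin n → ℕ) (i : ℕ) : ℕ :=
  if h : 0 < i ∧ i ≤ n then J ⟨i - 1, by omega⟩ else 0

lemma shiftedExtension_succ {n : ℕ} (J : Fin n → ℕ) (j : Fin n) :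
    shiftedExtension J (j + 1) = J j := by
  rw [shiftedExtension, dif_pos ⟨by omega, j.2⟩]
  rfl

lemma shiftedExtension_le {n : ℕ} {J : Fin n → ℕ} (hJ : Monotone J) :
    ∀ j < n, shiftedExtension J j ≤ shiftedExtension J (j + 1) := by
  intro j hj
  rw [shiftedExtension_succ J ⟨j, hj⟩, shiftedExtension]
  split_ifs with h
  · exact hJ (by simp)
  · exact Nat.zero_le _

/-- The exponents of the monomial attached to a monotone tuple. -/
def gapExponent {n : ℕ} (J : Fin n → ℕ) : Fin n →₀ ℕ :=
  Finsupp.equivFunOnFinite.symm fun k =>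
    shiftedExtension J ((Fin.rev k : ℕ) + 1) - shiftedExtension J (Fin.rev k)

/-- This is conjugation of partitions: at most n parts on one side, parts of size at most n on the
other. The gap below the entry with index `Fin.rev k` is counted in k + 1 entries of J, which is the
weight of the corresponding λ. -/
lemma sum_gapExponent {n : ℕ} {J : Fin n → ℕ} (hJ : Monotone J) :
    ∑ k, gapExponent J k * (k + 1) = ∑ k, J k := by
  have h := sum_range_eq_sum_mul_sub (F := shiftedExtension J) (by simp [shiftedExtension])
    (shiftedExtension_le hJ) (le_refl n)
  rw [Finset.sum_range, Finset.sum_range] at h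
  simp only [shiftedExtension_succ] at h
  rw [h, ← Equiv.sum_comp Fin.revPerm]
  refine Finset.sum_congr rfl fun k _ => ?_
  simp only [gapExponent, Finsupp.equivFunOnFinite_symm_apply_apply, Fin.revPerm_apply,
    Fin.rev_rev, shiftedExtension_succ]
  congr 1
  rw [Fin.val_rev]
  omega

lemma gapExponent_injOn {n : ℕ} {J J' : Fin n → ℕ} (hJ : Monotone J) (hJ' : Monotone J')
    (h : gapExponent J = gapExponent J') : J = J' := by
  funext j
  have h1 : ∀ {J : Fin n → ℕ}, Monotone J → ∑ l ∈ Finset.range (j + 1),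
      (shiftedExtension J (l + 1) - shiftedExtension J l) = J j := fun hJ => by
    rw [sum_range_sub_of_le (by simp [shiftedExtension]) (shiftedExtension_le hJ) j.2,
      shiftedExtension_succ]
  rw [← h1 hJ, ← h1 hJ']
  refine Finset.sum_congr rfl fun l hl => ?_
  have hl' : l < n := by have := Finset.mem_range.mp hl; omega
  have h2 := DFunLike.congr_fun h (Fin.rev ⟨l, hl'⟩)
  simpa only [gapExponent, Finsupp.equivFunOnFinite_symm_apply_apply, Fin.rev_rev] using h2

lemma productSpan_le_span_monotone {n : ℕ} (p : ℕ → MvPolynomial (Fin n) ℂ) (d : ℕ) :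
    productSpan p d ≤ Submodule.span ℂ
      ((fun J : {J : Fin n → ℕ // Monotone J} => ∏ k, p (J.1 k)) '' {J | ∑ k, J.1 k ≤ d}) := by
  rw [productSpan, Submodule.span_le]
  rintro _ ⟨J, hJ, rfl⟩
  refine Submodule.subset_span ⟨⟨J ∘ Tuple.sort J, Tuple.monotone_sort J⟩, ?_, ?_⟩
  · have h1 : ∑ k, J (Tuple.sort J k) = ∑ k, J k := Equiv.sum_comp (Tuple.sort J) J
    have h2 : ((∑ k, J k : ℕ) : ℤ) ≤ d := hJ
    change ∑ k, J (Tuple.sort J k) ≤ d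
    omega
  · exact Equiv.prod_comp (Tuple.sort J) fun k => p (J k)

/-- The monomials with exponents `gapExponent J` are distinct, hence independent, and lie in the
spans of products of no larger weight. Counting transfers the independence to the products. -/
lemma linearIndependent_prod_solPoly {n : ℕ} {t : Fin n → ℂ} {s : Fin (n + 2) → ℂ} (r₁ r₂ : ℂ)
    (ht₀ : ∀ i, t i ≠ 0) (hs₁ : ∀ m : ℕ, s 0 ≠ -(m : ℂ)) :
    LinearIndependent ℂ
      (fun J : {J : Fin n → ℕ // Monotone J} => ∏ k, solPoly t s r₁ r₂ (J.1 k)) := by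
  refine linearIndependent_of_mem_span_le (fun J => ∑ k, J.1 k) (fun N => ?_)
    (e := fun J => MvPolynomial.monomial (gapExponent J.1) (1 : ℂ)) ?_ fun J => ?_
  · refine Set.Finite.subset ((Set.finite_Iic (fun _ : Fin n => N)).preimage
      Subtype.val_injective.injOn) ?_
    intro J hJ k
    exact (Finset.single_le_sum (f := J.1) (fun _ _ => Nat.zero_le _) (Finset.mem_univ k)).trans hJ
  · have h1 := (MvPolynomial.basisMonomials (Fin n) ℂ).linearIndependent
    rw [MvPolynomial.coe_basisMonomials] at h1
    exact h1.comp (fun J : {J : Fin n → ℕ // Monotone J} => gapExponent J.1)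
      fun J J' h => Subtype.ext (gapExponent_injOn J.2 J'.2 h)
  · have h1 := monomial_mem_productSpan (s := s) r₁ r₂ ht₀ hs₁ (gapExponent J.1)
    rw [sum_gapExponent J.2] at h1
    exact productSpan_le_span_monotone _ _ h1

lemma span_prod_solPoly {n : ℕ} {t : Fin n → ℂ} {s : Fin (n + 2) → ℂ} (r₁ r₂ : ℂ)
    (ht₀ : ∀ i, t i ≠ 0) (hs₁ : ∀ m : ℕ, s 0 ≠ -(m : ℂ)) :
    Submodule.span ℂ (Set.range
      fun J : {J : Fin n → ℕ // Monotone J} => ∏ k, solPoly t s r₁ r₂ (J.1 k)) = ⊤ := by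
  rw [eq_top_iff, ← (MvPolynomial.basisMonomials (Fin n) ℂ).span_eq, Submodule.span_le]
  rintro _ ⟨a, rfl⟩
  rw [MvPolynomial.coe_basisMonomials]
  exact Submodule.span_mono (Set.image_subset_range _ _)
    (productSpan_le_span_monotone _ _ (monomial_mem_productSpan (s := s) r₁ r₂ ht₀ hs₁ a))

/-! ### Structure constants -/

/-- The symmetrization of the indicator function of `b`. -/
def symSingle {n : ℕ} (b : Fin n → ℕ) : (Fin n → ℕ) →₀ ℂ :=
  (n ! : ℂ)⁻¹ • ∑ σ : Equiv.Perm (Fin n), Finsupp.single (b ∘ σ) 1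

lemma symSingle_comp_perm {n : ℕ} (b : Fin n → ℕ) (τ : Equiv.Perm (Fin n)) :
    symSingle (b ∘ τ) = symSingle b := by
  rw [symSingle, symSingle,
    ← Equiv.sum_comp (Equiv.mulLeft τ) fun σ => Finsupp.single (b ∘ σ) (1 : ℂ)]
  rfl

lemma symSingle_apply_comp_perm {n : ℕ} (b j : Fin n → ℕ) (τ : Equiv.Perm (Fin n)) :
    symSingle b (j ∘ τ) = symSingle b j := by
  simp only [symSingle, Finsupp.smul_apply, Finsupp.finsetSum_apply]
  rw [← Equiv.sum_comp (Equiv.mulRight τ)]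
  congr 1
  refine Finset.sum_congr rfl fun σ _ => ?_
  rw [Finsupp.single_apply, Finsupp.single_apply]
  have : b ∘ (Equiv.mulRight τ σ : Equiv.Perm (Fin n)) = j ∘ τ ↔ b ∘ σ = j := by
    rw [Equiv.coe_mulRight, Equiv.Perm.coe_mul, ← Function.comp_assoc]
    exact τ.surjective.injective_comp_right.eq_iff
  simp only [this]

section StructureConstants

variable {n : ℕ} {p : ℕ → MvPolynomial (Fin n) ℂ}

/-- One linear map encodes all structure constants: expand in the basis of monotone tuples, then
spread each coefficient evenly over the rearrangements. Linearity is what later lets differential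
operators pass through it. -/
lemma exists_symCoeff
    (hli : LinearIndependent ℂ (fun J : {J : Fin n → ℕ // Monotone J} => ∏ k, p (J.1 k)))
    (hsp : Submodule.span ℂ
      (Set.range fun J : {J : Fin n → ℕ // Monotone J} => ∏ k, p (J.1 k)) = ⊤) :
    ∃ g : MvPolynomial (Fin n) ℂ →ₗ[ℂ] ((Fin n → ℕ) →₀ ℂ),
      ∀ b : Fin n → ℕ, g (∏ k, p (b k)) = symSingle b := by
  let B := Module.Basis.mk hli hsp.ge
  refine ⟨B.constr ℂ fun J => symSingle J.1, fun b => ?_⟩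
  have h1 : ∏ k, p (b k) = B ⟨b ∘ Tuple.sort b, Tuple.monotone_sort b⟩ := by
    rw [Module.Basis.mk_apply]
    exact (Equiv.prod_comp (Tuple.sort b) fun k => p (b k)).symm
  rw [h1, Module.Basis.constr_basis, symSingle_comp_perm]

lemma linearCombination_symCoeff {g : MvPolynomial (Fin n) ℂ →ₗ[ℂ] ((Fin n → ℕ) →₀ ℂ)}
    (hg : ∀ b : Fin n → ℕ, g (∏ k, p (b k)) = symSingle b)
    (hsp : Submodule.span ℂ
      (Set.range fun J : {J : Fin n → ℕ // Monotone J} => ∏ k, p (J.1 k)) = ⊤)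
    (f : MvPolynomial (Fin n) ℂ) :
    Finsupp.linearCombination ℂ (fun j : Fin n → ℕ => ∏ k, p (j k)) (g f) = f := by
  have hf : f ∈ Submodule.span ℂ
      (Set.range fun J : {J : Fin n → ℕ // Monotone J} => ∏ k, p (J.1 k)) := hsp ▸ trivial
  induction hf using Submodule.span_induction with
  | mem x hx =>
    obtain ⟨J, rfl⟩ := hx
    rw [hg, symSingle, map_smul, map_sum]
    simp only [Finsupp.linearCombination_single, one_smul, Function.comp_apply]
    rw [Finset.sum_congr rfl fun σ _ => Equiv.prod_comp σ fun k => p (J.1 k), Finset.sum_const,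
      Finset.card_univ, Fintype.card_perm, Fintype.card_fin, ← Nat.cast_smul_eq_nsmul ℂ,
      inv_smul_smul₀ (Nat.cast_ne_zero.mpr (Nat.factorial_ne_zero n))]
  | zero => simp
  | add x y _ _ hx hy => rw [map_add, map_add, hx, hy]
  | smul c x _ hx => rw [map_smul, map_smul, hx]

lemma symCoeff_apply_comp_perm {g : MvPolynomial (Fin n) ℂ →ₗ[ℂ] ((Fin n → ℕ) →₀ ℂ)}
    (hg : ∀ b : Fin n → ℕ, g (∏ k, p (b k)) = symSingle b)
    (hsp : Submodule.span ℂ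
      (Set.range fun J : {J : Fin n → ℕ // Monotone J} => ∏ k, p (J.1 k)) = ⊤)
    (f : MvPolynomial (Fin n) ℂ) (j : Fin n → ℕ) (τ : Equiv.Perm (Fin n)) :
    g f (j ∘ τ) = g f j := by
  have hf : f ∈ Submodule.span ℂ
      (Set.range fun J : {J : Fin n → ℕ // Monotone J} => ∏ k, p (J.1 k)) := hsp ▸ trivial
  induction hf using Submodule.span_induction with
  | mem x hx =>
    obtain ⟨J, rfl⟩ := hx
    rw [hg, symSingle_apply_comp_perm]
  | zero => simp
  | add x y _ _ hx hy => rw [map_add, Finsupp.add_apply, Finsupp.add_apply, hx, hy]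
  | smul c x _ hx => rw [map_smul, Finsupp.smul_apply, Finsupp.smul_apply, hx]

/-- Averaging over permutations does nothing to a function that is already symmetric. This gives
uniqueness of the structure constants. -/
lemma symCoeff_linearCombination {g : MvPolynomial (Fin n) ℂ →ₗ[ℂ] ((Fin n → ℕ) →₀ ℂ)}
    (hg : ∀ b : Fin n → ℕ, g (∏ k, p (b k)) = symSingle b) (c : (Fin n → ℕ) →₀ ℂ)
    (hc : ∀ (j : Fin n → ℕ) (τ : Equiv.Perm (Fin n)), c (j ∘ τ) = c j) :
    g (Finsupp.linearCombination ℂ (fun j : Fin n → ℕ => ∏ k, p (j k)) c) = c := by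
  ext j
  rw [Finsupp.linearCombination_apply, Finsupp.sum, map_sum, Finsupp.finsetSum_apply]
  simp only [map_smul, hg, Finsupp.smul_apply, symSingle, Finsupp.finsetSum_apply]
  have h1 : ∀ σ : Equiv.Perm (Fin n),
      ∑ b ∈ c.support, c b * Finsupp.single (b ∘ σ) (1 : ℂ) j = c j := by
    intro σ
    rw [← hc j σ⁻¹]
    have h2 : ∀ b : Fin n → ℕ, b ∘ σ = j ↔ b = j ∘ (σ⁻¹ : Equiv.Perm (Fin n)) := by
      intro b
      constructor
      · rintro rfl; funext k; simp
      · rintro rfl; funext k; simp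
    simp only [Finsupp.single_apply, h2, mul_ite, mul_one, mul_zero]
    rw [Finset.sum_ite_eq']
    split_ifs with h
    · rfl
    · exact (Finsupp.notMem_support_iff.mp h).symm
  have h3 : ∀ b : Fin n → ℕ, c b • ((n ! : ℂ)⁻¹ • ∑ σ : Equiv.Perm (Fin n),
      Finsupp.single (b ∘ σ) (1 : ℂ) j) = (n ! : ℂ)⁻¹ * ∑ σ : Equiv.Perm (Fin n),
        c b * Finsupp.single (b ∘ σ) (1 : ℂ) j := by
    intro b
    rw [smul_eq_mul, smul_eq_mul, ← Finset.mul_sum]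
    ring
  rw [Finset.sum_congr rfl fun b _ => h3 b, ← Finset.mul_sum, Finset.sum_comm,
    Finset.sum_congr rfl fun σ _ => h1 σ, Finset.sum_const, Finset.card_univ, Fintype.card_perm,
    Fintype.card_fin, nsmul_eq_mul, inv_mul_cancel_left₀]
  exact Nat.cast_ne_zero.mpr (Nat.factorial_ne_zero n)

lemma finsum_smul_eq_linearCombination {ι M : Type*} [AddCommGroup M] [Module ℂ M] (c : ι →₀ ℂ)
    (v : ι → M) : ∑ᶠ j, c j • v j = Finsupp.linearCombination ℂ v c := by
  rw [Finsupp.linearCombination_apply, Finsupp.sum]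
  refine finsum_eq_sum_of_support_subset _ fun j hj => ?_
  rw [Finset.mem_coe, Finsupp.mem_support_iff]
  intro h
  exact hj (by simp [h])

lemma isStructureConstants_iff {g : MvPolynomial (Fin n) ℂ →ₗ[ℂ] ((Fin n → ℕ) →₀ ℂ)}
    (hg : ∀ b : Fin n → ℕ, g (∏ k, p (b k)) = symSingle b)
    (hsp : Submodule.span ℂ
      (Set.range fun J : {J : Fin n → ℕ // Monotone J} => ∏ k, p (J.1 k)) = ⊤)
    (C : (Fin (n + 1) → ℕ) → (Fin n → ℕ) → ℂ) :
    IsStructureConstants p C ↔ C = fun i => ⇑(g (∏ k, p (i k))) := by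
  constructor
  · rintro ⟨h1, h2, h3⟩
    funext i
    set c : (Fin n → ℕ) →₀ ℂ := Finsupp.ofSupportFinite (C i) (h1 i) with hc
    have h4 : ∀ j, c j = C i j := fun j => rfl
    have h5 : ∏ k, p (i k) = Finsupp.linearCombination ℂ (fun j : Fin n → ℕ => ∏ k, p (j k)) c := by
      rw [h3 i, ← finsum_smul_eq_linearCombination]
      rfl
    rw [h5, symCoeff_linearCombination hg c fun j τ => h2 i j τ]
    rfl
  · rintro rfl
    refine ⟨fun i => (g (∏ k, p (i k))).hasFiniteSupport,
      fun i j σ => symCoeff_apply_comp_perm hg hsp _ j σ, fun i => ?_⟩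
    rw [finsum_smul_eq_linearCombination, linearCombination_symCoeff hg hsp]

end StructureConstants

/-! ### The differential operator annihilating the kernel -/

/-- The operator which is free of the parameters and annihilates `f(x₁) ⋯ f(xₙ₊₁)`. -/
def kernelOp {n : ℕ} {B : Type*} [CommRing B] [Algebra ℂ B] (t : Fin n → ℂ)
    (s : Fin (n + 2) → ℂ) (r₁ r₂ : ℂ) (g : MvPowerSeries (Fin (n + 1)) B) :
    MvPowerSeries (Fin (n + 1)) B :=
  ∑ i, cofac MvPowerSeries.X i * partialOp t s r₁ r₂ i g

/-- On n + 1 nodes Lagrange's formula extracts the coefficient of xⁿ, which is zero for Λ. All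
parameters disappear at once. -/
lemma kernelOp_prodSeries {n : ℕ} {B : Type*} [CommRing B] [IsDomain B] [Algebra ℂ B]
    {t : Fin n → ℂ} {s : Fin (n + 2) → ℂ} (r₁ r₂ : ℂ) (ht₀ : ∀ i, t i ≠ 0)
    (hs₁ : ∀ m : ℕ, s 0 ≠ -(m : ℂ)) (lam : Fin n → B) :
    kernelOp t s r₁ r₂ (prodSeries (n + 1) (solSeq t s r₁ r₂ lam)) = 0 := by
  have : IsDomain (MvPowerSeries (Fin (n + 1)) B) := NoZeroDivisors.to_isDomain _
  set q : Polynomial (MvPowerSeries (Fin (n + 1)) B) :=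
    ∑ k : Fin n, Polynomial.C (MvPowerSeries.C (lam k)) * Polynomial.X ^ (k : ℕ) with hq
  have hc : ∀ j, n ≤ j → q.coeff j = 0 := by
    intro j hj
    rw [hq, Polynomial.finsetSum_coeff]
    refine Finset.sum_eq_zero fun k _ => ?_
    rw [Polynomial.coeff_C_mul, Polynomial.coeff_X_pow, if_neg (by omega), mul_zero]
  have hdeg : q.degree < Fintype.card (Fin (n + 1)) := by
    rw [Fintype.card_fin, Polynomial.degree_lt_iff_coeff_zero]
    exact fun j hj => hc j (by omega)
  have key := sum_cofac_mul_eval (X_injective (m := n + 1) (A := B)) hdeg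
  rw [Fintype.card_fin, hc _ (by omega), mul_zero] at key
  rw [kernelOp]
  have h1 : ∀ i : Fin (n + 1), cofac (MvPowerSeries.X : _ → MvPowerSeries (Fin (n + 1)) B) i *
      partialOp t s r₁ r₂ i (prodSeries (n + 1) (solSeq t s r₁ r₂ lam)) =
      -(cofac (fun i => MvPowerSeries.X i) i * q.eval (MvPowerSeries.X i)) *
        prodSeries (n + 1) (solSeq t s r₁ r₂ lam) := by
    intro i
    rw [partialOp_prodSeries r₁ r₂ ht₀ hs₁, hq]
    simp only [Polynomial.eval_finsetSum, Polynomial.eval_mul, Polynomial.eval_C,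
      Polynomial.eval_pow, Polynomial.eval_X]
    ring
  rw [Finset.sum_congr rfl fun i _ => h1 i, ← Finset.sum_mul, Finset.sum_neg_distrib, key,
    neg_zero, zero_mul]

section MapCoeff

variable {m : ℕ} {B B' : Type*} [CommRing B] [Algebra ℂ B] [CommRing B'] [Algebra ℂ B']
  (f : B →ₗ[ℂ] B')

/-- Apply a linear map to all coefficients of a power series. -/
def mapCoeff (m : ℕ) : MvPowerSeries (Fin m) B →ₗ[ℂ] MvPowerSeries (Fin m) B' where
  toFun g := fun a => f (MvPowerSeries.coeff a g)
  map_add' g h := by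
    ext a
    change f (MvPowerSeries.coeff a (g + h)) =
      f (MvPowerSeries.coeff a g) + f (MvPowerSeries.coeff a h)
    rw [map_add, map_add]
  map_smul' c g := by
    ext a
    change f (MvPowerSeries.coeff a (c • g)) = c • f (MvPowerSeries.coeff a g)
    rw [coeff_smul_algebra, map_smul]

lemma coeff_mapCoeff (g : MvPowerSeries (Fin m) B) (a : Fin m →₀ ℕ) :
    MvPowerSeries.coeff a (mapCoeff f m g) = f (MvPowerSeries.coeff a g) := rfl

lemma mapCoeff_X_mul (i : Fin m) (g : MvPowerSeries (Fin m) B) :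
    mapCoeff f m (MvPowerSeries.X i * g) = MvPowerSeries.X i * mapCoeff f m g := by
  ext a
  rw [coeff_mapCoeff, coeff_X_mul, coeff_X_mul]
  split_ifs
  · exact map_zero f
  · rw [coeff_mapCoeff]

lemma mapCoeff_X_pow_mul (i : Fin m) (l : ℕ) (g : MvPowerSeries (Fin m) B) :
    mapCoeff f m (MvPowerSeries.X i ^ l * g) = MvPowerSeries.X i ^ l * mapCoeff f m g := by
  induction l with
  | zero => simp
  | succ l ih => rw [pow_succ', mul_assoc, mapCoeff_X_mul, ih, pow_succ', mul_assoc]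

lemma mapCoeff_aeval_mul (i : Fin m) (q : Polynomial ℂ) (g : MvPowerSeries (Fin m) B) :
    mapCoeff f m (Polynomial.aeval (MvPowerSeries.X i) q * g) =
      Polynomial.aeval (MvPowerSeries.X i) q * mapCoeff f m g := by
  induction q using Polynomial.induction_on' with
  | add p q hp hq => rw [map_add, map_add, add_mul, add_mul, map_add, hp, hq]
  | monomial l c =>
    rw [Polynomial.aeval_monomial, Polynomial.aeval_monomial, mul_assoc, mul_assoc,
      ← Algebra.smul_def, ← Algebra.smul_def, map_smul, mapCoeff_X_pow_mul]

lemma mapCoeff_pderiv (i : Fin m) (g : MvPowerSeries (Fin m) B) :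
    mapCoeff f m (MvPowerSeries.pderiv B i g) = MvPowerSeries.pderiv B' i (mapCoeff f m g) := by
  ext a
  rw [coeff_mapCoeff, MvPowerSeries.coeff_pderiv, MvPowerSeries.coeff_pderiv, coeff_mapCoeff,
    ← Nat.cast_add_one, ← Nat.cast_add_one, mul_comm, ← nsmul_eq_mul, map_nsmul, nsmul_eq_mul,
    mul_comm]

lemma mapCoeff_prod_sub_mul (S : Finset (Fin m × Fin m)) (g : MvPowerSeries (Fin m) B) :
    mapCoeff f m ((∏ p ∈ S, (MvPowerSeries.X p.1 - MvPowerSeries.X p.2)) * g) =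
      (∏ p ∈ S, (MvPowerSeries.X p.1 - MvPowerSeries.X p.2)) * mapCoeff f m g := by
  induction S using Finset.induction_on with
  | empty => simp
  | insert p S hp ih =>
    rw [Finset.prod_insert hp, mul_assoc, sub_mul, map_sub, mapCoeff_X_mul, mapCoeff_X_mul, ih,
      Finset.prod_insert hp, mul_assoc, sub_mul]

lemma mapCoeff_partialOp {n : ℕ} (t : Fin n → ℂ) (s : Fin (n + 2) → ℂ) (r₁ r₂ : ℂ) (i : Fin m)
    (g : MvPowerSeries (Fin m) B) :
    mapCoeff f m (partialOp t s r₁ r₂ i g) = partialOp t s r₁ r₂ i (mapCoeff f m g) := by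
  rw [partialOp, partialOp, map_add, map_add, map_smul, mapCoeff_aeval_mul, mapCoeff_aeval_mul,
    mapCoeff_X_pow_mul, mapCoeff_pderiv, mapCoeff_pderiv]

/-- The operator has scalars in ℂ only, so it commutes with any ℂ-linear map on coefficients,
multiplicative or not. In particular it commutes with taking structure constants. -/
lemma mapCoeff_kernelOp {n : ℕ} (t : Fin n → ℂ) (s : Fin (n + 2) → ℂ) (r₁ r₂ : ℂ)
    (g : MvPowerSeries (Fin (n + 1)) B) :
    mapCoeff f (n + 1) (kernelOp t s r₁ r₂ g) = kernelOp t s r₁ r₂ (mapCoeff f (n + 1) g) := by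
  rw [kernelOp, kernelOp, map_sum]
  refine Finset.sum_congr rfl fun i _ => ?_
  rw [cofac, mapCoeff_prod_sub_mul, mapCoeff_partialOp]
  rfl

end MapCoeff

/-! ### Second order and first order parts -/

section Gamma

variable {n : ℕ} (t : Fin n → ℂ) (s : Fin (n + 2) → ℂ)

/-- The part of `kernelOp` without constant term. -/
def diffusionOp (g : MvPowerSeries (Fin (n + 1)) ℂ) : MvPowerSeries (Fin (n + 1)) ℂ :=
  ∑ i, cofac MvPowerSeries.X i * (Polynomial.aeval (MvPowerSeries.X i) (leadingPoly t) *
      MvPowerSeries.pderiv ℂ i (MvPowerSeries.pderiv ℂ i g) +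
    Polynomial.aeval (MvPowerSeries.X i) (firstOrderPoly t s) * MvPowerSeries.pderiv ℂ i g)

/-- The bilinear form measuring the failure of `diffusionOp` to be a derivation. -/
def gammaForm (f g : MvPowerSeries (Fin (n + 1)) ℂ) : MvPowerSeries (Fin (n + 1)) ℂ :=
  ∑ i, cofac MvPowerSeries.X i * (Polynomial.aeval (MvPowerSeries.X i) (leadingPoly t) *
      (MvPowerSeries.pderiv ℂ i f * MvPowerSeries.pderiv ℂ i g))

lemma diffusionOp_mul (f g : MvPowerSeries (Fin (n + 1)) ℂ) :
    diffusionOp t s (f * g) =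
      f * diffusionOp t s g + g * diffusionOp t s f + 2 * gammaForm t f g := by
  simp only [diffusionOp, gammaForm, Finset.mul_sum, ← Finset.sum_add_distrib]
  refine Finset.sum_congr rfl fun i _ => ?_
  simp only [Derivation.leibniz, map_add, smul_eq_mul]
  ring

lemma diffusionOp_add (f g : MvPowerSeries (Fin (n + 1)) ℂ) :
    diffusionOp t s (f + g) = diffusionOp t s f + diffusionOp t s g := by
  simp only [diffusionOp, ← Finset.sum_add_distrib]
  refine Finset.sum_congr rfl fun i _ => ?_
  simp only [map_add]
  ring

lemma diffusionOp_C (c : ℂ) : diffusionOp t s (MvPowerSeries.C c) = 0 := by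
  simp [diffusionOp]

lemma gammaForm_comm (f g : MvPowerSeries (Fin (n + 1)) ℂ) :
    gammaForm t f g = gammaForm t g f :=
  Finset.sum_congr rfl fun i _ => by ring

lemma gammaForm_mul (f g h : MvPowerSeries (Fin (n + 1)) ℂ) :
    gammaForm t f (g * h) = g * gammaForm t f h + h * gammaForm t f g := by
  simp only [gammaForm, Finset.mul_sum, ← Finset.sum_add_distrib]
  refine Finset.sum_congr rfl fun i _ => ?_
  simp only [Derivation.leibniz, smul_eq_mul]
  ring

lemma gammaForm_add (f g h : MvPowerSeries (Fin (n + 1)) ℂ) :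
    gammaForm t f (g + h) = gammaForm t f g + gammaForm t f h := by
  simp only [gammaForm, ← Finset.sum_add_distrib]
  refine Finset.sum_congr rfl fun i _ => ?_
  simp only [map_add]
  ring

lemma gammaForm_C (f : MvPowerSeries (Fin (n + 1)) ℂ) (c : ℂ) :
    gammaForm t f (MvPowerSeries.C c) = 0 := by
  simp [gammaForm]

lemma gammaForm_C_mul (f g : MvPowerSeries (Fin (n + 1)) ℂ) (c : ℂ) :
    gammaForm t f (MvPowerSeries.C c * g) = MvPowerSeries.C c * gammaForm t f g := by
  rw [gammaForm_mul, gammaForm_C, mul_zero, add_zero]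

lemma diffusionOp_C_mul (g : MvPowerSeries (Fin (n + 1)) ℂ) (c : ℂ) :
    diffusionOp t s (MvPowerSeries.C c * g) = MvPowerSeries.C c * diffusionOp t s g := by
  rw [diffusionOp_mul, diffusionOp_C, gammaForm_comm, gammaForm_C]
  ring

end Gamma

/-! ### Residue formulas -/

lemma exists_eq_add_X_sub_C_mul {R : Type*} [CommRing R] [Nontrivial R] {N : ℕ} (q : Polynomial R)
    (hq : q.natDegree ≤ N + 1) (a : R) : ∃ h : Polynomial R,
      q = Polynomial.C (q.eval a) + (Polynomial.X - Polynomial.C a) * h ∧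
        h.degree < (N + 1 : ℕ) ∧ h.coeff N = q.coeff (N + 1) := by
  have h1 := Polynomial.modByMonic_add_div q (Polynomial.X - Polynomial.C a)
  rw [Polynomial.modByMonic_X_sub_C_eq_C_eval] at h1
  set h := q /ₘ (Polynomial.X - Polynomial.C a) with hh
  have hd : h.natDegree ≤ N := by
    rw [hh, Polynomial.natDegree_divByMonic _ (Polynomial.monic_X_sub_C a),
      Polynomial.natDegree_X_sub_C]
    omega
  refine ⟨h, h1.symm, lt_of_le_of_lt (Polynomial.degree_le_of_natDegree_le hd)
    (by exact_mod_cast Nat.lt_succ_self N), ?_⟩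
  rw [← h1, Polynomial.coeff_add, Polynomial.coeff_C_succ, zero_add, sub_mul, Polynomial.coeff_sub,
    Polynomial.coeff_X_mul, Polynomial.coeff_C_mul,
    Polynomial.coeff_eq_zero_of_natDegree_lt (by omega : h.natDegree < N + 1)]
  ring

/-- The product `∏ₖ (xₖ - a)`. -/
def shiftProd {m : ℕ} (a : ℂ) : MvPowerSeries (Fin m) ℂ :=
  ∏ k, (MvPowerSeries.X k - MvPowerSeries.C a)

/-- The product `∏_{k ≠ i} (xₖ - a)`. -/
def shiftProdErase {m : ℕ} (a : ℂ) (i : Fin m) : MvPowerSeries (Fin m) ℂ :=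
  ∏ k ∈ Finset.univ.erase i, (MvPowerSeries.X k - MvPowerSeries.C a)

lemma X_sub_C_mul_shiftProdErase {m : ℕ} (a : ℂ) (i : Fin m) :
    (MvPowerSeries.X i - MvPowerSeries.C a) * shiftProdErase a i = shiftProd a :=
  Finset.mul_prod_erase _ (fun k => (MvPowerSeries.X k - MvPowerSeries.C a)) (Finset.mem_univ i)

lemma pderiv_prod_erase {m : ℕ} (a : ℂ) (i : Fin m) (S : Finset (Fin m)) (hS : i ∉ S) :
    MvPowerSeries.pderiv ℂ i (∏ k ∈ S, (MvPowerSeries.X k - MvPowerSeries.C a)) = 0 := by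
  induction S using Finset.induction_on with
  | empty => rw [Finset.prod_empty, MvPowerSeries.pderiv_one]
  | insert k S hk ih =>
    rw [Finset.mem_insert, not_or] at hS
    rw [Finset.prod_insert hk, Derivation.leibniz, ih hS.2, map_sub, MvPowerSeries.pderiv_C,
      MvPowerSeries.pderiv_X_of_ne (Ne.symm hS.1)]
    simp

lemma pderiv_shiftProd {m : ℕ} (a : ℂ) (i : Fin m) :
    MvPowerSeries.pderiv ℂ i (shiftProd a) = shiftProdErase a i := by
  rw [← X_sub_C_mul_shiftProdErase a i, Derivation.leibniz, shiftProdErase,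
    pderiv_prod_erase a i _ (Finset.notMem_erase i _), map_sub, MvPowerSeries.pderiv_C,
    MvPowerSeries.pderiv_X_self]
  simp

lemma pderiv_shiftProdErase {m : ℕ} (a : ℂ) (i : Fin m) :
    MvPowerSeries.pderiv ℂ i (shiftProdErase a i) = 0 :=
  pderiv_prod_erase a i _ (Finset.notMem_erase i _)

section Residue

variable {n : ℕ}

lemma X_sub_C_ne_zero {m : ℕ} (a : ℂ) (i : Fin m) :
    (MvPowerSeries.X i - MvPowerSeries.C a : MvPowerSeries (Fin m) ℂ) ≠ 0 := by
  intro h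
  have h1 := congrArg (MvPowerSeries.coeff (Finsupp.single i 1)) h
  rw [map_sub, MvPowerSeries.coeff_X, if_pos rfl, MvPowerSeries.coeff_C, if_neg, map_zero,
    sub_zero] at h1
  · exact one_ne_zero h1
  · simp

instance : IsDomain (MvPowerSeries (Fin n) ℂ) := NoZeroDivisors.to_isDomain _

lemma sum_cofac_mul_aeval (q : Polynomial ℂ) (hq : q.degree < (n + 1 : ℕ)) :
    ∑ i : Fin (n + 1), cofac MvPowerSeries.X i * Polynomial.aeval (MvPowerSeries.X i) q =
      discr (MvPowerSeries.X : _ → MvPowerSeries (Fin (n + 1)) ℂ) *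
        MvPowerSeries.C (q.coeff n) := by
  have hinj : Function.Injective (MvPowerSeries.C : ℂ →+* MvPowerSeries (Fin (n + 1)) ℂ) :=
    MvPowerSeries.C_injective
  have h1 := sum_cofac_mul_eval (X_injective (m := n + 1) (A := ℂ)) (q := q.map MvPowerSeries.C)
    (by rwa [Polynomial.degree_map_eq_of_injective hinj, Fintype.card_fin])
  rw [Fintype.card_fin, Polynomial.coeff_map, Nat.add_sub_cancel] at h1
  rw [← h1]
  refine Finset.sum_congr rfl fun i _ => ?_
  rw [Polynomial.eval_map]
  rfl

/-- Divide N(y) = ∏(y - xₖ) by y - a. Since N vanishes at y = xᵢ, the quotient takes there the value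
(-1)ⁿ ∏_{k ≠ i}(xₖ - a); being monic of degree n, it interpolates to 1. -/
lemma sum_cofac_mul_shiftProdErase (a : ℂ) :
    ∑ i : Fin (n + 1), cofac MvPowerSeries.X i * shiftProdErase a i =
      (-1) ^ n * discr (MvPowerSeries.X : _ → MvPowerSeries (Fin (n + 1)) ℂ) := by
  set N : Polynomial (MvPowerSeries (Fin (n + 1)) ℂ) :=
    ∏ k : Fin (n + 1), (Polynomial.X - Polynomial.C (MvPowerSeries.X k)) with hN
  have hdeg : N.natDegree = n + 1 := by
    rw [hN, Polynomial.natDegree_finsetProd_X_sub_C_eq_card, Finset.card_univ, Fintype.card_fin]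
  have hmon : N.Monic := Polynomial.monic_prod_X_sub_C _ _
  obtain ⟨q, hq, hqd, hqc⟩ := exists_eq_add_X_sub_C_mul N hdeg.le (MvPowerSeries.C a)
  have hlead := hmon.coeff_natDegree
  rw [hdeg] at hlead
  rw [hlead] at hqc
  have h1 := sum_cofac_mul_eval (X_injective (m := n + 1) (A := ℂ)) (q := q)
    (by rwa [Fintype.card_fin])
  rw [Fintype.card_fin, Nat.add_sub_cancel, hqc, mul_one] at h1
  rw [← h1, Finset.mul_sum]
  refine Finset.sum_congr rfl fun i _ => ?_
  have h2 := congrArg (Polynomial.eval (MvPowerSeries.X i)) hq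
  have h3 : N.eval (MvPowerSeries.X i) = 0 := by
    rw [hN, Polynomial.eval_prod]
    exact Finset.prod_eq_zero (Finset.mem_univ i) (by simp)
  have h4 : N.eval (MvPowerSeries.C a) = (-1) ^ (n + 1) * shiftProd a := by
    rw [hN, Polynomial.eval_prod, shiftProd]
    have : ∀ k : Fin (n + 1), Polynomial.eval (MvPowerSeries.C a : MvPowerSeries (Fin (n + 1)) ℂ)
        (Polynomial.X - Polynomial.C (MvPowerSeries.X k)) =
        (-1) * (MvPowerSeries.X k - MvPowerSeries.C a) := by
      intro k; simp
    rw [Finset.prod_congr rfl fun k _ => this k, Finset.prod_mul_distrib, Finset.prod_const,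
      Finset.card_univ, Fintype.card_fin]
  rw [h3, Polynomial.eval_add, Polynomial.eval_C, Polynomial.eval_mul, h4,
    ← X_sub_C_mul_shiftProdErase a i, Polynomial.eval_sub, Polynomial.eval_X,
    Polynomial.eval_C] at h2
  have h5 : q.eval (MvPowerSeries.X i) = (-1) ^ n * shiftProdErase a i := by
    refine mul_left_cancel₀ (X_sub_C_ne_zero a i) ?_
    linear_combination -h2
  rw [h5]
  ring_nf
  rw [mul_comm n 2, pow_mul]
  simp

/-- Splitting q as q(a) + (y - a)h separates a multiple of the previous sum from the interpolation
of h, whose top coefficient is that of q. -/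
lemma sum_cofac_mul_aeval_mul_shiftProdErase (q : Polynomial ℂ) (hq : q.natDegree ≤ n + 1)
    (a : ℂ) :
    ∑ i : Fin (n + 1), cofac MvPowerSeries.X i *
        (Polynomial.aeval (MvPowerSeries.X i) q * shiftProdErase a i) =
      discr (MvPowerSeries.X : _ → MvPowerSeries (Fin (n + 1)) ℂ) *
        (MvPowerSeries.C (q.coeff (n + 1)) * shiftProd a +
          (-1) ^ n * MvPowerSeries.C (q.eval a)) := by
  obtain ⟨h, hh, hd, hc⟩ := exists_eq_add_X_sub_C_mul q hq a
  have h1 : ∀ i : Fin (n + 1), cofac MvPowerSeries.X i *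
        (Polynomial.aeval (MvPowerSeries.X i) q * shiftProdErase a i) =
      MvPowerSeries.C (q.eval a) * (cofac MvPowerSeries.X i * shiftProdErase a i) +
      shiftProd a * (cofac MvPowerSeries.X i * Polynomial.aeval (MvPowerSeries.X i) h) := by
    intro i
    have h2 := congrArg (Polynomial.aeval (MvPowerSeries.X i : MvPowerSeries (Fin (n + 1)) ℂ)) hh
    rw [map_add, map_mul, map_sub, Polynomial.aeval_X, Polynomial.aeval_C,
      Polynomial.aeval_C] at h2
    rw [h2, ← X_sub_C_mul_shiftProdErase a i]
    change _ * ((MvPowerSeries.C _ + (_ - MvPowerSeries.C _) * _) * _) = _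
    ring
  rw [Finset.sum_congr rfl fun i _ => h1 i, Finset.sum_add_distrib, ← Finset.mul_sum,
    ← Finset.mul_sum, sum_cofac_mul_shiftProdErase, sum_cofac_mul_aeval h hd, hc]
  ring

end Residue

/-! ### The coordinates attached to the singular points -/

section NodeCoordinates

variable {n : ℕ} (t : Fin n → ℂ) (s : Fin (n + 2) → ℂ)

/-- The leading coefficient with one linear factor removed. -/
def leadingPolyErase (a : Fin (n + 2)) : Polynomial ℂ :=
  ∏ l ∈ Finset.univ.erase a, (Polynomial.X - Polynomial.C (singularPoint t l))

lemma leadingPoly_eq_mul_erase (a : Fin (n + 2)) : leadingPoly t =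
    (Polynomial.X - Polynomial.C (singularPoint t a)) * leadingPolyErase t a :=
  (Finset.mul_prod_erase _ (fun l => Polynomial.X - Polynomial.C (singularPoint t l))
    (Finset.mem_univ a)).symm

/-- The derivative of the leading coefficient at a singular point. -/
def nodeValue (a : Fin (n + 2)) : ℂ :=
  ∏ l ∈ Finset.univ.erase a, (singularPoint t a - singularPoint t l)

lemma eval_leadingPolyErase_self (a : Fin (n + 2)) :
    (leadingPolyErase t a).eval (singularPoint t a) = nodeValue t a := by
  simp [leadingPolyErase, nodeValue, Polynomial.eval_prod]

lemma eval_leadingPolyErase_of_ne {a b : Fin (n + 2)} (h : a ≠ b) :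
    (leadingPolyErase t a).eval (singularPoint t b) = 0 := by
  rw [leadingPolyErase, Polynomial.eval_prod]
  exact Finset.prod_eq_zero (Finset.mem_erase.mpr ⟨h.symm, Finset.mem_univ b⟩) (by simp)

lemma natDegree_leadingPolyErase (a : Fin (n + 2)) : (leadingPolyErase t a).natDegree = n + 1 := by
  rw [leadingPolyErase, Polynomial.natDegree_finsetProd_X_sub_C_eq_card,
    Finset.card_erase_of_mem (Finset.mem_univ a), Finset.card_univ, Fintype.card_fin]
  rfl

lemma coeff_leadingPolyErase (a : Fin (n + 2)) : (leadingPolyErase t a).coeff (n + 1) = 1 := by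
  have h : (leadingPolyErase t a).Monic := Polynomial.monic_prod_X_sub_C _ _
  have := h.coeff_natDegree
  rwa [natDegree_leadingPolyErase] at this

lemma firstOrderPoly_eq : firstOrderPoly t s = ∑ k, Polynomial.C (s k) * leadingPolyErase t k := rfl

lemma natDegree_firstOrderPoly : (firstOrderPoly t s).natDegree ≤ n + 1 := by
  rw [firstOrderPoly_eq]
  refine Polynomial.natDegree_sum_le_of_forall_le _ _ fun k _ => ?_
  exact (Polynomial.natDegree_C_mul_le _ _).trans (natDegree_leadingPolyErase t k).le

lemma coeff_firstOrderPoly : (firstOrderPoly t s).coeff (n + 1) = ∑ k, s k := by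
  rw [firstOrderPoly_eq, Polynomial.finsetSum_coeff]
  exact Finset.sum_congr rfl fun k _ => by
    rw [Polynomial.coeff_C_mul, coeff_leadingPolyErase, mul_one]

lemma eval_firstOrderPoly_node (a : Fin (n + 2)) :
    (firstOrderPoly t s).eval (singularPoint t a) = s a * nodeValue t a := by
  rw [firstOrderPoly_eq, Polynomial.eval_finsetSum, Finset.sum_eq_single a]
  · rw [Polynomial.eval_mul, Polynomial.eval_C, eval_leadingPolyErase_self]
  · intro b _ hb
    rw [Polynomial.eval_mul, eval_leadingPolyErase_of_ne t hb, mul_zero]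
  · simp

/-- The normalized coordinate `(-1)ⁿ ∏ₖ (xₖ - a) / L'(a)` at the singular point `a`. -/
def nodeCoord (a : Fin (n + 2)) : MvPowerSeries (Fin (n + 1)) ℂ :=
  MvPowerSeries.C ((-1) ^ n * (nodeValue t a)⁻¹) * shiftProd (singularPoint t a)

lemma gammaForm_shiftProd_left (a : Fin (n + 2)) (g : MvPowerSeries (Fin (n + 1)) ℂ) :
    gammaForm t (shiftProd (singularPoint t a)) g = shiftProd (singularPoint t a) *
      ∑ i, cofac MvPowerSeries.X i *
        (Polynomial.aeval (MvPowerSeries.X i) (leadingPolyErase t a) *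
          MvPowerSeries.pderiv ℂ i g) := by
  rw [gammaForm, Finset.mul_sum]
  refine Finset.sum_congr rfl fun i _ => ?_
  rw [pderiv_shiftProd, leadingPoly_eq_mul_erase t a, map_mul, map_sub, Polynomial.aeval_X,
    Polynomial.aeval_C, ← X_sub_C_mul_shiftProdErase (singularPoint t a) i]
  change _ * ((_ - MvPowerSeries.C _) * _ * _) = _
  ring

/-- The factor x - a of L completes ∏_{k ≠ i}(xₖ - a) to the full product. What remains of L
vanishes at every singular point other than a, which produces the Kronecker delta. -/
lemma gammaForm_shiftProd (a b : Fin (n + 2)) :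
    gammaForm t (shiftProd (singularPoint t a)) (shiftProd (singularPoint t b)) =
      discr MvPowerSeries.X * shiftProd (singularPoint t a) * (shiftProd (singularPoint t b) +
        (-1) ^ n * MvPowerSeries.C (if a = b then nodeValue t a else 0)) := by
  rw [gammaForm_shiftProd_left]
  simp only [pderiv_shiftProd]
  rw [sum_cofac_mul_aeval_mul_shiftProdErase _ (natDegree_leadingPolyErase t a).le,
    coeff_leadingPolyErase, map_one, one_mul]
  have : (leadingPolyErase t a).eval (singularPoint t b) = if a = b then nodeValue t a else 0 := by
    split_ifs with h
    · rw [← h, eval_leadingPolyErase_self]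
    · exact eval_leadingPolyErase_of_ne t h
  rw [this]
  ring

lemma diffusionOp_shiftProd (a : Fin (n + 2)) :
    diffusionOp t s (shiftProd (singularPoint t a)) =
      discr MvPowerSeries.X * (MvPowerSeries.C (∑ k, s k) * shiftProd (singularPoint t a) +
        (-1) ^ n * MvPowerSeries.C (s a * nodeValue t a)) := by
  simp only [diffusionOp, pderiv_shiftProd, pderiv_shiftProdErase, mul_zero, zero_add]
  rw [sum_cofac_mul_aeval_mul_shiftProdErase _ (natDegree_firstOrderPoly t s),
    coeff_firstOrderPoly, eval_firstOrderPoly_node]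

lemma singularPoint_injective {t : Fin n → ℂ} (ht : Function.Injective t) (ht₀ : ∀ i, t i ≠ 0)
    (ht₁ : ∀ i, t i ≠ 1) : Function.Injective (singularPoint t) := by
  rw [singularPoint, Fin.cons_injective_iff, Fin.cons_injective_iff]
  refine ⟨?_, ?_, ht⟩
  · rintro ⟨k, hk⟩
    revert hk
    refine Fin.cases (by simp) (fun i => ?_) k
    simpa using ht₀ i
  · rintro ⟨k, hk⟩
    exact ht₁ k hk

variable {t} (hinj : Function.Injective (singularPoint t))

lemma nodeValue_ne_zero (hinj : Function.Injective (singularPoint t)) (a : Fin (n + 2)) :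
    nodeValue t a ≠ 0 := by
  rw [nodeValue, Finset.prod_ne_zero_iff]
  exact fun l hl => sub_ne_zero.mpr fun h => Finset.ne_of_mem_erase hl (hinj h).symm

lemma C_mul_C_eq_one (hinj : Function.Injective (singularPoint t)) (a : Fin (n + 2)) :
    (MvPowerSeries.C ((-1) ^ n * (nodeValue t a)⁻¹) : MvPowerSeries (Fin (n + 1)) ℂ) *
      ((-1) ^ n * MvPowerSeries.C (nodeValue t a)) = 1 := by
  have h1 : ((-1) ^ n : MvPowerSeries (Fin (n + 1)) ℂ) = MvPowerSeries.C ((-1) ^ n) := by simp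
  rw [h1, ← map_mul, ← map_mul, ← map_one MvPowerSeries.C]
  congr 1
  have h2 := nodeValue_ne_zero hinj a
  field_simp
  rw [← pow_mul, mul_comm, pow_mul]
  simp

lemma gammaForm_nodeCoord (hinj : Function.Injective (singularPoint t)) (a b : Fin (n + 2)) :
    gammaForm t (nodeCoord t a) (nodeCoord t b) =
      discr MvPowerSeries.X * nodeCoord t a * (nodeCoord t b + if a = b then 1 else 0) := by
  rw [nodeCoord, nodeCoord, gammaForm_C_mul, gammaForm_comm, gammaForm_C_mul, gammaForm_comm,
    gammaForm_shiftProd]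
  split_ifs with h
  · have h2 := C_mul_C_eq_one hinj a
    rw [← h]
    linear_combination (MvPowerSeries.C ((-1) ^ n * (nodeValue t a)⁻¹) * discr MvPowerSeries.X *
      shiftProd (singularPoint t a)) * h2
  · rw [map_zero]
    ring

lemma diffusionOp_nodeCoord (hinj : Function.Injective (singularPoint t)) (a : Fin (n + 2)) :
    diffusionOp t s (nodeCoord t a) =
      discr MvPowerSeries.X * (MvPowerSeries.C (∑ k, s k) * nodeCoord t a +
        MvPowerSeries.C (s a)) := by
  rw [nodeCoord, diffusionOp_C_mul, diffusionOp_shiftProd, map_mul MvPowerSeries.C (s a)]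
  have h2 := C_mul_C_eq_one hinj a
  linear_combination (discr MvPowerSeries.X * MvPowerSeries.C (s a)) * h2

end NodeCoordinates

/-! ### The operator on polynomials in the coordinates -/

section PolynomialOps

variable {N : ℕ}

/-- The Euler operator. -/
def eulerOp (h : MvPolynomial (Fin N) ℂ) : MvPolynomial (Fin N) ℂ :=
  ∑ a, MvPolynomial.X a * MvPolynomial.pderiv a h

/-- The operator `∑ₐ (Xₐ ∂ₐ² + cₐ ∂ₐ)`. -/
def laplaceOp (c : Fin N → ℂ) (h : MvPolynomial (Fin N) ℂ) : MvPolynomial (Fin N) ℂ :=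
  ∑ a, (MvPolynomial.X a * MvPolynomial.pderiv a (MvPolynomial.pderiv a h) +
    MvPolynomial.C (c a) * MvPolynomial.pderiv a h)

lemma eulerOp_add (g h : MvPolynomial (Fin N) ℂ) : eulerOp (g + h) = eulerOp g + eulerOp h := by
  simp only [eulerOp, map_add, mul_add, Finset.sum_add_distrib]

lemma eulerOp_C (c : ℂ) : eulerOp (MvPolynomial.C c : MvPolynomial (Fin N) ℂ) = 0 := by
  simp [eulerOp]

lemma eulerOp_mul (g h : MvPolynomial (Fin N) ℂ) :
    eulerOp (g * h) = eulerOp g * h + g * eulerOp h := by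
  simp only [eulerOp, Finset.sum_mul, Finset.mul_sum, ← Finset.sum_add_distrib]
  refine Finset.sum_congr rfl fun a _ => ?_
  rw [MvPolynomial.pderiv_mul]
  ring

lemma eulerOp_X (b : Fin N) : eulerOp (MvPolynomial.X b : MvPolynomial (Fin N) ℂ) =
    MvPolynomial.X b := by
  rw [eulerOp, Finset.sum_eq_single b]
  · rw [MvPolynomial.pderiv_X_self, mul_one]
  · intro a _ ha
    rw [MvPolynomial.pderiv_X_of_ne ha.symm, mul_zero]
  · simp

lemma laplaceOp_add (c : Fin N → ℂ) (g h : MvPolynomial (Fin N) ℂ) :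
    laplaceOp c (g + h) = laplaceOp c g + laplaceOp c h := by
  simp only [laplaceOp, ← Finset.sum_add_distrib]
  refine Finset.sum_congr rfl fun a _ => ?_
  simp only [map_add]
  ring

lemma laplaceOp_C (c : Fin N → ℂ) (x : ℂ) : laplaceOp c (MvPolynomial.C x) = 0 := by
  simp [laplaceOp]

lemma laplaceOp_mul (c : Fin N → ℂ) (g h : MvPolynomial (Fin N) ℂ) :
    laplaceOp c (g * h) = g * laplaceOp c h + h * laplaceOp c g +
      2 * ∑ a, MvPolynomial.X a * (MvPolynomial.pderiv a g * MvPolynomial.pderiv a h) := by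
  simp only [laplaceOp, Finset.mul_sum, ← Finset.sum_add_distrib]
  refine Finset.sum_congr rfl fun a _ => ?_
  simp only [MvPolynomial.pderiv_mul, map_add]
  ring

lemma laplaceOp_X (c : Fin N → ℂ) (b : Fin N) :
    laplaceOp c (MvPolynomial.X b) = MvPolynomial.C (c b) := by
  rw [laplaceOp, Finset.sum_eq_single b]
  · simp
  · intro a _ ha
    simp [MvPolynomial.pderiv_X_of_ne ha.symm]
  · simp

lemma laplaceOp_mul_X (c : Fin N → ℂ) (h : MvPolynomial (Fin N) ℂ) (b : Fin N) :
    laplaceOp c (h * MvPolynomial.X b) = MvPolynomial.X b * laplaceOp c h +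
      MvPolynomial.C (c b) * h + 2 * MvPolynomial.X b * MvPolynomial.pderiv b h := by
  rw [laplaceOp_mul, laplaceOp_X, Finset.sum_eq_single b]
  · rw [MvPolynomial.pderiv_X_self]
    ring
  · intro a _ ha
    rw [MvPolynomial.pderiv_X_of_ne ha.symm, mul_zero, mul_zero]
  · simp

end PolynomialOps

/-! ### The operators in node coordinates -/

section Aeval

variable {n : ℕ} {t : Fin n → ℂ} (s : Fin (n + 2) → ℂ)

lemma aeval_C_eq (y : Fin (n + 1) → MvPowerSeries (Fin (n + 1)) ℂ) (c : ℂ) :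
    MvPolynomial.aeval y (MvPolynomial.C c) = MvPowerSeries.C c := by
  rw [MvPolynomial.aeval_C]
  rfl

/-- Γ is a derivation in its second argument, so its values on the coordinates determine it. -/
lemma gammaForm_nodeCoord_aeval (hinj : Function.Injective (singularPoint t)) (a : Fin (n + 1))
    (h : MvPolynomial (Fin (n + 1)) ℂ) :
    gammaForm t (nodeCoord t a.succ) (MvPolynomial.aeval (fun k => nodeCoord t (Fin.succ k)) h) =
      discr MvPowerSeries.X * nodeCoord t a.succ *
        MvPolynomial.aeval (fun k => nodeCoord t (Fin.succ k))
          (eulerOp h + MvPolynomial.pderiv a h) := by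
  induction h using MvPolynomial.induction_on with
  | C c => rw [aeval_C_eq, gammaForm_C, eulerOp_C, MvPolynomial.pderiv_C]; simp
  | add p q hp hq =>
    rw [map_add, gammaForm_add, hp, hq, eulerOp_add]
    simp only [map_add]
    ring
  | mul_X p b hp =>
    rw [map_mul, gammaForm_mul, hp, MvPolynomial.aeval_X, gammaForm_nodeCoord hinj, eulerOp_mul,
      eulerOp_X, MvPolynomial.pderiv_mul, MvPolynomial.pderiv_X]
    simp only [map_add, map_mul, MvPolynomial.aeval_X, Fin.succ_inj, Pi.single_apply]
    by_cases hab : a = b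
    · subst hab
      simp only [if_true, map_one]
      ring
    · simp only [if_neg hab, if_neg (Ne.symm hab), map_zero]
      ring

lemma gammaForm_nodeCoord_zero_aeval (hinj : Function.Injective (singularPoint t))
    (h : MvPolynomial (Fin (n + 1)) ℂ) :
    gammaForm t (nodeCoord t 0) (MvPolynomial.aeval (fun k => nodeCoord t (Fin.succ k)) h) =
      discr MvPowerSeries.X * nodeCoord t 0 *
        MvPolynomial.aeval (fun k => nodeCoord t (Fin.succ k)) (eulerOp h) := by
  induction h using MvPolynomial.induction_on with
  | C c => rw [aeval_C_eq, gammaForm_C, eulerOp_C]; simp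
  | add p q hp hq =>
    rw [map_add, gammaForm_add, hp, hq, eulerOp_add]
    simp only [map_add]
    ring
  | mul_X p b hp =>
    rw [map_mul, gammaForm_mul, hp, MvPolynomial.aeval_X, gammaForm_nodeCoord hinj, eulerOp_mul,
      eulerOp_X, if_neg (Fin.succ_ne_zero b).symm]
    simp only [map_add, map_mul, MvPolynomial.aeval_X]
    ring

/-- The w_b with b ≠ 0 close up under the operator, which up to the factor Δ is the Euler part E² -
E + σE, preserving degree, plus a Laplacian, lowering it by one. -/
lemma diffusionOp_aeval (hinj : Function.Injective (singularPoint t))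
    (h : MvPolynomial (Fin (n + 1)) ℂ) :
    diffusionOp t s (MvPolynomial.aeval (fun k => nodeCoord t (Fin.succ k)) h) =
      discr MvPowerSeries.X * MvPolynomial.aeval (fun k => nodeCoord t (Fin.succ k))
        (eulerOp (eulerOp h) - eulerOp h + MvPolynomial.C (∑ k, s k) * eulerOp h +
          laplaceOp (fun a => s a.succ) h) := by
  induction h using MvPolynomial.induction_on with
  | C c => rw [aeval_C_eq, diffusionOp_C, eulerOp_C, laplaceOp_C]; simp [eulerOp]
  | add p q hp hq =>
    rw [map_add, diffusionOp_add, hp, hq]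
    simp only [eulerOp_add, laplaceOp_add]
    simp only [map_add, map_sub, map_mul]
    ring
  | mul_X p b hp =>
    rw [map_mul, diffusionOp_mul, hp, MvPolynomial.aeval_X, gammaForm_comm,
      gammaForm_nodeCoord_aeval hinj, diffusionOp_nodeCoord s hinj, laplaceOp_mul_X]
    simp only [eulerOp_mul, eulerOp_X, eulerOp_add]
    simp only [map_add, map_sub, map_mul, MvPolynomial.aeval_X, aeval_C_eq, map_ofNat]
    ring

end Aeval

/-! ### The homogeneous polynomials `u₀^|i| Pᵢ(u / u₀)` -/

section HomPoly

variable {n : ℕ}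

/-- The coefficients of the polynomial `P s i`. -/
def pCoeff (s : Fin (n + 2) → ℂ) (i j : Fin n → ℕ) : ℂ :=
  ((∏ l ∈ Finset.Icc 1 (∑ k, j k), (s 1 + (∑ k, (i k : ℂ)) - (l : ℂ))) *
      ∏ k, ∏ l ∈ Finset.Icc 1 (j k), ((i k : ℂ) - (l : ℂ) + 1)) /
    ((∏ k : Fin n, ∏ l ∈ Finset.Icc 1 (j k), (s k.succ.succ + (l : ℂ) - 1)) *
      ∏ k, ((j k)! : ℂ))

lemma pCoeff_eq_zero (s : Fin (n + 2) → ℂ) {i j : Fin n → ℕ} (h : ¬j ≤ i) : pCoeff s i j = 0 := by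
  obtain ⟨k, hk⟩ : ∃ k, i k < j k := by
    rw [Pi.le_def] at h
    push Not at h
    exact h
  have h1 : ∏ l ∈ Finset.Icc 1 (j k), ((i k : ℂ) - (l : ℂ) + 1) = 0 :=
    Finset.prod_eq_zero (i := i k + 1) (Finset.mem_Icc.mpr ⟨by omega, hk⟩) (by push_cast; ring)
  rw [pCoeff, Finset.prod_eq_zero (f := fun k => ∏ l ∈ Finset.Icc 1 (j k),
    ((i k : ℂ) - (l : ℂ) + 1)) (Finset.mem_univ k) h1, mul_zero, zero_div]

/-- The ratio of neighbouring coefficients of Pᵢ. The hypothesis on s₃, …, sₙ₊₂ keeps the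
denominators nonzero. -/
lemma pCoeff_add_single {s : Fin (n + 2) → ℂ}
    (hs₃ : ∀ (k : Fin n) (m : ℕ), s k.succ.succ ≠ -(m : ℂ)) (i j : Fin n → ℕ) (k : Fin n) :
    ((j k : ℂ) + 1) * (j k + s k.succ.succ) * pCoeff s i (j + Pi.single k 1) =
      (s 1 + (∑ l, (i l : ℂ)) - (∑ l, (j l : ℂ)) - 1) * (i k - j k) * pCoeff s i j := by
  have hprod : ∀ f : Fin n → ℕ → ℂ, ∏ l, f l ((j + Pi.single k 1 : Fin n → ℕ) l) =
      f k (j k + 1) * ∏ l ∈ Finset.univ.erase k, f l (j l) := by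
    intro f
    rw [← Finset.mul_prod_erase _ _ (Finset.mem_univ k)]
    congr 1
    · simp
    · refine Finset.prod_congr rfl fun l hl => ?_
      simp [Finset.ne_of_mem_erase hl]
  have hprod' : ∀ f : Fin n → ℕ → ℂ, ∏ l, f l (j l) =
      f k (j k) * ∏ l ∈ Finset.univ.erase k, f l (j l) := fun f =>
    (Finset.mul_prod_erase _ (fun l => f l (j l)) (Finset.mem_univ k)).symm
  have hsum : ∑ l, (j + Pi.single k 1 : Fin n → ℕ) l = (∑ l, j l) + 1 := by
    simp [Finset.sum_add_distrib, Finset.sum_pi_single']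
  have hne : ∀ (l : Fin n) (q : ℕ), ∏ r ∈ Finset.Icc 1 q, (s l.succ.succ + (r : ℂ) - 1) ≠ 0 := by
    intro l q
    rw [Finset.prod_ne_zero_iff]
    intro r hr h
    have h1 := (Finset.mem_Icc.mp hr).1
    refine hs₃ l (r - 1) ?_
    rw [Nat.cast_sub h1]
    push_cast
    linear_combination h
  have hfac : ∀ q : ℕ, (q ! : ℂ) ≠ 0 := fun q => Nat.cast_ne_zero.mpr (Nat.factorial_ne_zero q)
  have hk : s k.succ.succ + ((j k + 1 : ℕ) : ℂ) - 1 ≠ 0 := by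
    intro h
    refine hs₃ k (j k) ?_
    push_cast at h
    linear_combination h
  rw [pCoeff, pCoeff, hsum, hprod (fun l q => ∏ r ∈ Finset.Icc 1 q, ((i l : ℂ) - (r : ℂ) + 1)),
    hprod (fun l q => ∏ r ∈ Finset.Icc 1 q, (s l.succ.succ + (r : ℂ) - 1)),
    hprod (fun _ q => (q ! : ℂ)),
    hprod' (fun l q => ∏ r ∈ Finset.Icc 1 q, ((i l : ℂ) - (r : ℂ) + 1)),
    hprod' (fun l q => ∏ r ∈ Finset.Icc 1 q, (s l.succ.succ + (r : ℂ) - 1)),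
    hprod' (fun _ q => (q ! : ℂ)), Finset.prod_Icc_succ_top (by omega),
    Finset.prod_Icc_succ_top (by omega), Finset.prod_Icc_succ_top (by omega), Nat.factorial_succ]
  have h1 := hne k (j k)
  have h2 : ∏ l ∈ Finset.univ.erase k, ∏ r ∈ Finset.Icc 1 (j l),
      (s l.succ.succ + (r : ℂ) - 1) ≠ 0 := Finset.prod_ne_zero_iff.mpr fun l _ => hne l (j l)
  have h3 : ∏ l ∈ Finset.univ.erase k, ((j l) ! : ℂ) ≠ 0 :=
    Finset.prod_ne_zero_iff.mpr fun l _ => hfac (j l)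
  have h4 := hfac (j k)
  have h5 : ((j k : ℂ) + 1) ≠ 0 := Nat.cast_add_one_ne_zero (j k)
  push_cast at hk ⊢
  generalize ∏ l ∈ Finset.univ.erase k, ∏ r ∈ Finset.Icc 1 (j l),
      (s l.succ.succ + (r : ℂ) - 1) = a2 at *
  generalize ∏ l ∈ Finset.univ.erase k, ((j l) ! : ℂ) = a3 at *
  generalize ∏ r ∈ Finset.Icc 1 (j k), (s k.succ.succ + (r : ℂ) - 1) = a1 at *
  generalize ∏ l ∈ Finset.univ.erase k, ∏ r ∈ Finset.Icc 1 (j l), ((i l : ℂ) - (r : ℂ) + 1) = b1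
  generalize ∏ r ∈ Finset.Icc 1 (j k), ((i k : ℂ) - (r : ℂ) + 1) = b2
  generalize ∏ r ∈ Finset.Icc 1 (∑ l, j l), (s 1 + (∑ l, (i l : ℂ)) - (r : ℂ)) = b3
  have h6 : s k.succ.succ + (j k : ℂ) ≠ 0 := by
    intro h; apply hk; linear_combination h
  have h7 : s k.succ.succ + ((j k : ℂ) + 1) - 1 = s k.succ.succ + (j k : ℂ) := by ring
  rw [h7]
  field_simp
  ring

/-- The exponents of a monomial of degree `|i|` in `u₀, u₁, …, uₙ`. -/
def homExponent (i j : Fin n → ℕ) : Fin (n + 1) →₀ ℕ :=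
  Finsupp.equivFunOnFinite.symm (Fin.cons (∑ k, i k - ∑ k, j k) j)

/-- The homogeneous polynomial `u₀^|i| Pᵢ(u₁ / u₀, …, uₙ / u₀)` in `u₀, -u₁, …, -uₙ`. -/
def homPoly (s : Fin (n + 2) → ℂ) (i : Fin n → ℕ) : MvPolynomial (Fin (n + 1)) ℂ :=
  ∑ j ∈ Finset.Iic i, MvPolynomial.monomial (homExponent i j) ((-1) ^ (∑ k, j k) * pCoeff s i j)

lemma coeff_homPoly (s : Fin (n + 2) → ℂ) (i : Fin n → ℕ) (m : Fin (n + 1) →₀ ℕ) :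
    MvPolynomial.coeff m (homPoly s i) = if ∑ a, m a = ∑ k, i k then
      (-1) ^ (∑ k : Fin n, m k.succ) * pCoeff s i (fun k => m k.succ) else 0 := by
  rw [homPoly, MvPolynomial.coeff_sum]
  simp only [MvPolynomial.coeff_monomial]
  have hiff : ∀ j ∈ Finset.Iic i, homExponent i j = m ↔
      j = (fun k : Fin n => m k.succ) ∧ ∑ a, m a = ∑ k, i k := by
    intro j hj
    have hle : ∑ k, j k ≤ ∑ k, i k :=
      Finset.sum_le_sum fun k _ => (Finset.mem_Iic.mp hj) k
    rw [Fin.sum_univ_succ]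
    constructor
    · rintro rfl
      refine ⟨by funext k; simp [homExponent], ?_⟩
      simp only [homExponent, Finsupp.equivFunOnFinite_symm_apply_apply, Fin.cons_zero,
        Fin.cons_succ]
      omega
    · rintro ⟨rfl, h⟩
      ext a
      refine Fin.cases ?_ (fun k => ?_) a
      · simp only [homExponent, Finsupp.equivFunOnFinite_symm_apply_apply, Fin.cons_zero]
        omega
      · simp [homExponent]
  split_ifs with h
  · by_cases hm : (fun k : Fin n => m k.succ) ≤ i
    · rw [Finset.sum_eq_single (fun k : Fin n => m k.succ)]
      · rw [if_pos ((hiff _ (Finset.mem_Iic.mpr hm)).mpr ⟨rfl, h⟩)]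
      · intro j hj hne
        rw [if_neg]
        exact fun h' => hne ((hiff j hj).mp h').1
      · intro h'
        exact absurd (Finset.mem_Iic.mpr hm) h'
    · rw [pCoeff_eq_zero s hm, mul_zero]
      refine Finset.sum_eq_zero fun j hj => ?_
      rw [if_neg]
      intro h'
      exact hm (((hiff j hj).mp h').1 ▸ Finset.mem_Iic.mp hj)
  · refine Finset.sum_eq_zero fun j hj => ?_
    rw [if_neg]
    exact fun h' => h ((hiff j hj).mp h').2

lemma coeff_X_mul_pderiv {N : ℕ} (a : Fin N) (h : MvPolynomial (Fin N) ℂ) (m : Fin N →₀ ℕ) :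
    MvPolynomial.coeff m (MvPolynomial.X a * MvPolynomial.pderiv a h) =
      m a * MvPolynomial.coeff m h := by
  rw [MvPolynomial.coeff_X_mul']
  split_ifs with hm
  · have h1 : m a ≠ 0 := Finsupp.mem_support_iff.mp hm
    rw [MvPolynomial.coeff_pderiv, tsub_add_cancel_of_le
      (Finsupp.single_le_iff.mpr (Nat.one_le_iff_ne_zero.mpr h1)), Finsupp.tsub_apply,
      Finsupp.single_eq_same, Nat.cast_sub (Nat.one_le_iff_ne_zero.mpr h1)]
    push_cast
    ring
  · rw [Finsupp.notMem_support_iff.mp hm, Nat.cast_zero, zero_mul]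

lemma eulerOp_homPoly (s : Fin (n + 2) → ℂ) (i : Fin n → ℕ) :
    eulerOp (homPoly s i) = MvPolynomial.C (∑ k, (i k : ℂ)) * homPoly s i := by
  ext m
  rw [eulerOp, MvPolynomial.coeff_sum, MvPolynomial.coeff_C_mul]
  simp only [coeff_X_mul_pderiv]
  rw [← Finset.sum_mul, coeff_homPoly]
  split_ifs with h
  · rw [← Nat.cast_sum, ← Nat.cast_sum, h]
  · simp

lemma coeff_laplaceOp {N : ℕ} (c : Fin N → ℂ) (h : MvPolynomial (Fin N) ℂ) (m : Fin N →₀ ℕ) :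
    MvPolynomial.coeff m (laplaceOp c h) =
      ∑ a, (m a + 1) * (m a + c a) * MvPolynomial.coeff (m + Finsupp.single a 1) h := by
  rw [laplaceOp, MvPolynomial.coeff_sum]
  refine Finset.sum_congr rfl fun a _ => ?_
  rw [MvPolynomial.coeff_add, coeff_X_mul_pderiv, MvPolynomial.coeff_C_mul,
    MvPolynomial.coeff_pderiv]
  ring

/-- The ratio recursion makes each term with index l ≥ 1 proportional to i_l - j_l, with a common
factor and opposite sign. These differences add up to |i| - |j| = m₀ + 1, which cancels the term of
u₀. -/
lemma laplaceOp_homPoly {s : Fin (n + 2) → ℂ}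
    (hs₃ : ∀ (k : Fin n) (m : ℕ), s k.succ.succ ≠ -(m : ℂ)) (i : Fin n → ℕ) :
    laplaceOp (fun a => s a.succ) (homPoly s i) = 0 := by
  ext m
  rw [coeff_laplaceOp, MvPolynomial.coeff_zero]
  simp only [coeff_homPoly]
  have hdeg : ∀ a : Fin (n + 1), ∑ b, (m + Finsupp.single a 1 : Fin (n + 1) →₀ ℕ) b = (∑ b, m b) + 1 := by
    intro a
    simp [Finset.sum_add_distrib, Finsupp.single_apply]
  simp only [hdeg]
  split_ifs with h
  · set j : Fin n → ℕ := fun k => m k.succ with hj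
    have h0 : (fun k : Fin n => (m + Finsupp.single 0 1 : Fin (n + 1) →₀ ℕ) k.succ) = j := by
      funext k; simp [hj]
    have hk : ∀ l : Fin n, (fun k : Fin n => (m + Finsupp.single l.succ 1 : Fin (n + 1) →₀ ℕ) k.succ) =
        j + Pi.single l 1 := by
      intro l
      funext k
      simp [hj, Finsupp.single_apply, Pi.single_apply, eq_comm]
    have hksum : ∀ l : Fin n, Finset.univ.sum (j + Pi.single l 1) = (∑ k, j k) + 1 := by
      intro l
      simp [Finset.sum_add_distrib]
    rw [Fin.sum_univ_succ, h0]
    have hterm : ∀ l : Fin n, ((m l.succ : ℂ) + 1) * (m l.succ + s l.succ.succ) *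
        ((-1) ^ (∑ k : Fin n, (m + Finsupp.single l.succ 1 : Fin (n + 1) →₀ ℕ) k.succ) *
          pCoeff s i (fun k => (m + Finsupp.single l.succ 1 : Fin (n + 1) →₀ ℕ) k.succ)) =
        -((-1) ^ (∑ k, j k) * (s 1 + (∑ k, (i k : ℂ)) - (∑ k, (j k : ℂ)) - 1) * pCoeff s i j) *
          (i l - j l) := by
      intro l
      rw [hk l, hksum l]
      have := pCoeff_add_single hs₃ i j l
      rw [pow_succ]
      simp only [hj] at this ⊢
      linear_combination (-(-1) ^ (∑ k : Fin n, m k.succ)) * this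
    rw [Finset.sum_congr rfl fun l _ => hterm l, ← Finset.mul_sum, Finset.sum_sub_distrib]
    have hm0 : (m 0 : ℂ) + (∑ k, (j k : ℂ)) + 1 = ∑ k, (i k : ℂ) := by
      rw [Fin.sum_univ_succ] at h
      exact_mod_cast h
    rw [← hm0]
    simp only [Fin.succ_zero_eq_one]
    ring
  · simp

lemma aeval_homPoly {A : Type*} [CommRing A] [Algebra ℂ A] (s : Fin (n + 2) → ℂ)
    (i : Fin n → ℕ) (y : Fin (n + 1) → A) :
    MvPolynomial.aeval y (homPoly s i) = ∑ j ∈ Finset.Iic i,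
      pCoeff s i j • (y 0 ^ (∑ k, i k - ∑ k, j k) * ∏ k : Fin n, (-y k.succ) ^ j k) := by
  rw [homPoly, map_sum]
  refine Finset.sum_congr rfl fun j _ => ?_
  rw [MvPolynomial.aeval_monomial, Finsupp.prod_fintype _ _ (fun _ => pow_zero _),
    Fin.prod_univ_succ, Algebra.smul_def]
  simp only [homExponent, Finsupp.equivFunOnFinite_symm_apply_apply, Fin.cons_zero, Fin.cons_succ]
  have : ∏ k : Fin n, (-y k.succ) ^ j k =
      (-1) ^ (∑ k, j k) * ∏ k : Fin n, y k.succ ^ j k := by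
    rw [← Finset.prod_pow_eq_pow_sum, ← Finset.prod_mul_distrib]
    exact Finset.prod_congr rfl fun k _ => by rw [neg_pow]
  rw [this]
  simp only [map_mul, map_pow, map_neg, map_one]
  ring

/-- Only exponents j ≤ i occur, so the power of u₀ in front clears all inverses. The signs in -uₖ
match the node coordinates at the tₖ. -/
lemma homogenizedP_eq_aeval {m : ℕ} (t : Fin n → ℂ) (s : Fin (n + 2) → ℂ)
    (x : Fin (n + 1) → MvPowerSeries (Fin m) ℂ) (i : Fin n → ℕ)
    (hu : MvPowerSeries.constantCoeff (u₀ t x) ≠ 0) :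
    homogenizedP t s x i =
      MvPolynomial.aeval (Fin.cons (u₀ t x) (fun k => -u t x k)) (homPoly s i) := by
  have hP : P s i = ∑ j ∈ Finset.Iic i,
      MvPolynomial.C (pCoeff s i j) * ∏ k, MvPolynomial.X k ^ j k := rfl
  rw [homogenizedP, hP, aeval_homPoly, map_sum, Finset.mul_sum]
  refine Finset.sum_congr rfl fun j hj => ?_
  have hle : ∑ k, j k ≤ ∑ k, i k := Finset.sum_le_sum fun k _ => (Finset.mem_Iic.mp hj) k
  simp only [map_mul, map_prod, map_pow, MvPolynomial.aeval_X, MvPolynomial.aeval_C,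
    Fin.cons_zero, Fin.cons_succ, neg_neg, mul_pow, Finset.prod_mul_distrib]
  rw [Finset.prod_pow_eq_pow_sum, Algebra.smul_def]
  have h1 : u₀ t x ^ (∑ k, i k) * (u₀ t x)⁻¹ ^ (∑ k, j k) = u₀ t x ^ (∑ k, i k - ∑ k, j k) := by
    obtain ⟨d, hd⟩ := Nat.exists_eq_add_of_le hle
    rw [hd, Nat.add_sub_cancel_left, pow_add, mul_right_comm, ← mul_pow,
      MvPowerSeries.mul_inv_cancel _ hu, one_pow, one_mul]
  rw [← h1]
  ring

end HomPoly

/-! ### Substitution of a multiple of `x₁ ⋯ xₘ` into a power series -/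

lemma eq_zero_of_forall_X_pow_dvd {m : ℕ} (k : Fin m) {g : MvPowerSeries (Fin m) ℂ}
    (h : ∀ N, MvPowerSeries.X k ^ N ∣ g) : g = 0 := by
  ext a
  exact MvPowerSeries.X_pow_dvd_iff.mp (h (a k + 1)) a (Nat.lt_succ_self _)

/-- Peeling off constant terms makes E F divisible by every power of Xₖ. Identities about
substitution can thus be checked on c + X F alone, without continuity arguments. -/
lemma eq_zero_of_map_C_add_X_mul {m : ℕ} (k : Fin m) {z : MvPowerSeries (Fin m) ℂ}
    (hz : MvPowerSeries.X k ∣ z) (E : PowerSeries ℂ → MvPowerSeries (Fin m) ℂ)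
    (hE : ∀ c F, E (PowerSeries.C c + PowerSeries.X * F) = z * E F) (F : PowerSeries ℂ) :
    E F = 0 := by
  refine eq_zero_of_forall_X_pow_dvd k fun N => ?_
  induction N generalizing F with
  | zero => rw [pow_zero]; exact one_dvd _
  | succ N ih =>
    obtain ⟨c, G, rfl⟩ : ∃ c G, F = PowerSeries.C c + PowerSeries.X * G :=
      ⟨_, _, (PowerSeries.eq_X_mul_shift_add_const F).trans (add_comm _ _)⟩
    rw [hE, pow_succ']
    exact mul_dvd_mul hz (ih G)

section Subst

variable {m : ℕ} {z : MvPowerSeries (Fin m) ℂ}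

lemma subst_C_add_X_mul (hz : PowerSeries.HasSubst z) (c : ℂ) (F : PowerSeries ℂ) :
    (PowerSeries.C c + PowerSeries.X * F).subst z = MvPowerSeries.C c + z * F.subst z := by
  rw [PowerSeries.subst_add hz, PowerSeries.subst_mul hz, PowerSeries.subst_X hz,
    PowerSeries.subst_C]

lemma pderiv_subst (hz : PowerSeries.HasSubst z) (k : Fin m) (hk : MvPowerSeries.X k ∣ z)
    (i : Fin m) (F : PowerSeries ℂ) :
    MvPowerSeries.pderiv ℂ i (F.subst z) =
      (PowerSeries.derivative ℂ F).subst z * MvPowerSeries.pderiv ℂ i z := by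
  have := eq_zero_of_map_C_add_X_mul k hk
    (fun F => MvPowerSeries.pderiv ℂ i (F.subst z) -
      (PowerSeries.derivative ℂ F).subst z * MvPowerSeries.pderiv ℂ i z) (fun c F => ?_) F
  · exact sub_eq_zero.mp this
  · have h1 : PowerSeries.derivative ℂ (PowerSeries.C c + PowerSeries.X * F) =
        F + PowerSeries.X * PowerSeries.derivative ℂ F := by
      rw [map_add, PowerSeries.derivative_C, Derivation.leibniz, PowerSeries.derivative_X,
        smul_eq_mul, smul_eq_mul]
      ring
    rw [subst_C_add_X_mul hz, h1, PowerSeries.subst_add hz, PowerSeries.subst_mul hz,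
      PowerSeries.subst_X hz, map_add, MvPowerSeries.pderiv_C, Derivation.leibniz, smul_eq_mul,
      smul_eq_mul]
    ring

lemma algHom_subst (hz : PowerSeries.HasSubst z) (k : Fin m) (hk : MvPowerSeries.X k ∣ z)
    (e : MvPowerSeries (Fin m) ℂ →ₐ[ℂ] MvPowerSeries (Fin m) ℂ) (he : e z = z)
    (F : PowerSeries ℂ) : e (F.subst z) = F.subst z := by
  have := eq_zero_of_map_C_add_X_mul k hk (fun F => e (F.subst z) - F.subst z) (fun c F => ?_) F
  · exact sub_eq_zero.mp this
  · have hC : e (MvPowerSeries.C c) = MvPowerSeries.C c := e.commutes c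
    rw [subst_C_add_X_mul hz, map_add, map_mul, he, hC]
    ring

end Subst

/-! ### The Gauss differential equation -/

section Gauss

lemma gaussSeries_ode (a b c : ℂ) (hc : ∀ m : ℕ, c ≠ -(m : ℂ)) :
    (PowerSeries.X ^ 2 - PowerSeries.X) *
        PowerSeries.derivative ℂ (PowerSeries.derivative ℂ (gaussSeries a b c)) +
      (PowerSeries.C (a + b + 1) * PowerSeries.X - PowerSeries.C c) *
        PowerSeries.derivative ℂ (gaussSeries a b c) +
      PowerSeries.C (a * b) * gaussSeries a b c = 0 := by
  have hrec : ∀ m : ℕ, ordinaryHypergeometricCoefficient a b c (m + 1) * (m + 1) * (c + m) =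
      ordinaryHypergeometricCoefficient a b c m * (a + m) * (b + m) := by
    intro m
    have h1 : ∀ x : ℂ, (ascPochhammer ℂ (m + 1)).eval x = (ascPochhammer ℂ m).eval x * (x + m) := by
      intro x
      rw [ascPochhammer_succ_right]
      simp
    have h2 : (ascPochhammer ℂ m).eval c ≠ 0 := by
      clear h1
      induction m with
      | zero => simp
      | succ m ih =>
        rw [ascPochhammer_succ_right, Polynomial.eval_mul]
        refine mul_ne_zero ih fun h => hc m (eq_neg_of_add_eq_zero_left ?_)
        simpa using h
    have h3 : c + m ≠ 0 := fun h => hc m (eq_neg_of_add_eq_zero_left h)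
    have h4 : (m ! : ℂ) ≠ 0 := Nat.cast_ne_zero.mpr (Nat.factorial_ne_zero m)
    have h5 : (m + 1 : ℂ) ≠ 0 := Nat.cast_add_one_ne_zero m
    simp only [ordinaryHypergeometricCoefficient, h1, Nat.factorial_succ]
    push_cast
    field_simp
  have hg : ∀ m, PowerSeries.coeff m (gaussSeries a b c) =
      ordinaryHypergeometricCoefficient a b c m := fun m => PowerSeries.coeff_mk _ _
  generalize ordinaryHypergeometricCoefficient a b c = f at hrec hg
  generalize gaussSeries a b c = G at hg
  have key : PowerSeries.X * (PowerSeries.X *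
        PowerSeries.derivative ℂ (PowerSeries.derivative ℂ G)) -
      PowerSeries.X * PowerSeries.derivative ℂ (PowerSeries.derivative ℂ G) +
      (PowerSeries.C (a + b + 1) * (PowerSeries.X * PowerSeries.derivative ℂ G) -
        PowerSeries.C c * PowerSeries.derivative ℂ G) + PowerSeries.C (a * b) * G = 0 := by
    generalize hd : a + b + 1 = d
    generalize he : a * b = e
    ext l
    rw [map_add, map_add, map_sub, map_sub, PowerSeries.coeff_C_mul, PowerSeries.coeff_C_mul,
      PowerSeries.coeff_C_mul, map_zero]
    rcases l with _ | _ | l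
    · have h0 := hrec 0
      simp only [PowerSeries.coeff_zero_X_mul, PowerSeries.coeff_derivative, hg]
      push_cast at h0 ⊢
      rw [← he]
      linear_combination -h0
    · have h0 := hrec 1
      simp only [PowerSeries.coeff_succ_X_mul, PowerSeries.coeff_zero_X_mul,
        PowerSeries.coeff_derivative, hg]
      push_cast at h0 ⊢
      rw [← he, ← hd]
      norm_num at h0 ⊢
      linear_combination -h0
    · have h0 := hrec (l + 2)
      simp only [PowerSeries.coeff_succ_X_mul, PowerSeries.coeff_derivative, hg]
      push_cast at h0 ⊢
      rw [← he, ← hd]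
      linear_combination -h0
  linear_combination key

end Gauss

/-! ### The terms of the expansion -/

section ExpansionTerm

variable {n : ℕ} (t : Fin n → ℂ)

/-- The argument `x₁ ⋯ xₙ₊₁ / (t₁ ⋯ tₙ)` of the hypergeometric factor. -/
def gaussArg : MvPowerSeries (Fin (n + 1)) ℂ :=
  (∏ k, t k)⁻¹ • ∏ k : Fin (n + 1), (MvPowerSeries.X k : MvPowerSeries (Fin (n + 1)) ℂ)

lemma gaussFactor_eq (a b c : ℂ) :
    gaussFactor t a b c = (gaussSeries a b c).subst (gaussArg t) := rfl

lemma X_dvd_gaussArg (k : Fin (n + 1)) : MvPowerSeries.X k ∣ gaussArg t := by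
  rw [gaussArg, MvPowerSeries.smul_eq_C_mul]
  exact (Finset.dvd_prod_of_mem _ (Finset.mem_univ k)).mul_left _

lemma hasSubst_gaussArg : PowerSeries.HasSubst (gaussArg t) := by
  refine PowerSeries.HasSubst.of_constantCoeff_zero ?_
  obtain ⟨g, hg⟩ := X_dvd_gaussArg t 0
  rw [hg, map_mul, MvPowerSeries.constantCoeff_X, zero_mul]

lemma nodeValue_zero : nodeValue t 0 = (-1) ^ (n + 1) * ∏ k, t k := by
  have h : Finset.univ.erase (0 : Fin (n + 2)) = Finset.univ.image Fin.succ := by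
    ext k; simp
  rw [nodeValue, h, Finset.prod_image (by intro a _ b _ h; simpa using h), Fin.prod_univ_succ]
  simp only [singularPoint, Fin.cons_zero, Fin.cons_succ, zero_sub]
  rw [Finset.prod_neg, Finset.card_univ, Fintype.card_fin, pow_succ]
  ring

lemma nodeValue_succ_zero : nodeValue t (Fin.succ 0) = (-1) ^ n * ∏ k, (t k - 1) := by
  have h : Finset.univ.erase (Fin.succ 0 : Fin (n + 2)) =
      insert 0 (Finset.univ.image (fun k : Fin n => k.succ.succ)) := by
    ext k
    refine Fin.cases ?_ (fun k => Fin.cases ?_ (fun k => ?_) k) k <;> simp [Fin.ext_iff]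
  rw [nodeValue, h, Finset.prod_insert (by simp),
    Finset.prod_image (by intro a _ b _ h; simpa using h)]
  simp only [singularPoint, Fin.cons_zero, Fin.cons_succ, sub_zero, one_mul]
  have : ∀ k, 1 - t k = -(t k - 1) := fun k => by ring
  simp only [this]
  rw [Finset.prod_neg, Finset.card_univ, Fintype.card_fin]

lemma nodeValue_succ_succ (i : Fin n) : nodeValue t i.succ.succ =
    (-1) ^ (n + 1) * (t i * (t i - 1) * ∏ l ∈ Finset.univ.erase i, (t l - t i)) := by
  have h : Finset.univ.erase (i.succ.succ : Fin (n + 2)) =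
      insert 0 (insert (Fin.succ 0)
        ((Finset.univ.erase i).image (fun k : Fin n => k.succ.succ))) := by
    ext k
    refine Fin.cases ?_ (fun k => Fin.cases ?_ (fun k => ?_) k) k
    · simp [Fin.ext_iff]
    · simp [Fin.ext_iff]
    · simp only [Finset.mem_erase, Finset.mem_univ, and_true, Finset.mem_insert, Finset.mem_image,
        Fin.succ_inj, Fin.succ_ne_zero, false_or, ne_eq]
      exact ⟨fun h => ⟨k, h, rfl⟩, by rintro ⟨l, hl, rfl⟩; exact hl⟩
  rw [nodeValue, h, Finset.prod_insert (by simp [Fin.ext_iff]),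
    Finset.prod_insert (by simp [Fin.ext_iff]),
    Finset.prod_image (by intro a _ b _ h; simpa using h)]
  simp only [singularPoint, Fin.cons_zero, Fin.cons_succ, sub_zero]
  have : ∀ k, t i - t k = -(t k - t i) := fun k => by ring
  simp only [this (_ : Fin n)]
  rw [Finset.prod_neg, Finset.card_erase_of_mem (Finset.mem_univ i), Finset.card_univ,
    Fintype.card_fin]
  have hn : 1 ≤ n := by have := i.2; omega
  have hp : (-1 : ℂ) ^ (n + 1) = (-1) ^ (n - 1) := by
    rw [show n + 1 = n - 1 + 2 by omega, pow_add]
    norm_num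
  rw [hp]
  ring

lemma nodeCoord_zero : nodeCoord t 0 = -gaussArg t := by
  rw [nodeCoord, nodeValue_zero, gaussArg, shiftProd]
  simp only [singularPoint, Fin.cons_zero, map_zero, sub_zero]
  rw [← MvPowerSeries.smul_eq_C_mul, ← neg_smul]
  congr 1
  rw [mul_inv, ← mul_assoc, pow_succ, mul_inv, ← mul_assoc,
    mul_inv_cancel₀ (pow_ne_zero _ (by norm_num))]
  norm_num

lemma nodeCoord_succ_zero : nodeCoord t (Fin.succ 0) = u₀ t (xVars n) := by
  rw [nodeCoord, nodeValue_succ_zero, u₀, shiftProd, ← MvPowerSeries.smul_eq_C_mul]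
  simp only [singularPoint, Fin.cons_zero, Fin.cons_succ, map_one, xVars]
  congr 1
  rw [mul_inv, ← mul_assoc, mul_inv_cancel₀ (pow_ne_zero _ (by norm_num)), one_mul]

lemma nodeCoord_succ_succ (i : Fin n) : nodeCoord t i.succ.succ = -u t (xVars n) i := by
  rw [nodeCoord, nodeValue_succ_succ, u, shiftProd, ← MvPowerSeries.smul_eq_C_mul, ← neg_smul]
  simp only [singularPoint, Fin.cons_succ, xVars]
  have h1 : ∀ a b : ℂ, a = b → ∀ f : MvPowerSeries (Fin (n + 1)) ℂ, a • f = b • f := by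
    rintro a _ rfl f; rfl
  refine h1 _ _ ?_ _
  rw [mul_inv, ← mul_assoc, pow_succ, mul_inv, ← mul_assoc,
    mul_inv_cancel₀ (pow_ne_zero _ (by norm_num))]
  norm_num

lemma constantCoeff_u₀_ne_zero {t : Fin n → ℂ} (ht₁ : ∀ i, t i ≠ 1) {m : ℕ}
    {x : Fin (n + 1) → MvPowerSeries (Fin m) ℂ}
    (hx : ∀ k, MvPowerSeries.constantCoeff (x k) = 0) :
    MvPowerSeries.constantCoeff (u₀ t x) ≠ 0 := by
  rw [u₀, MvPowerSeries.smul_eq_C_mul, map_mul, MvPowerSeries.constantCoeff_C, map_prod]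
  simp only [map_sub, hx, map_one]
  refine mul_ne_zero (inv_ne_zero ?_) ?_
  · exact Finset.prod_ne_zero_iff.mpr fun l _ => sub_ne_zero.mpr (ht₁ l)
  · exact Finset.prod_ne_zero_iff.mpr fun l _ => by norm_num

lemma homogenizedP_xVars {t : Fin n → ℂ} (ht₁ : ∀ i, t i ≠ 1) (s : Fin (n + 2) → ℂ)
    (i : Fin n → ℕ) : homogenizedP t s (xVars n) i =
      MvPolynomial.aeval (fun k => nodeCoord t (Fin.succ k)) (homPoly s i) := by
  rw [homogenizedP_eq_aeval t s _ i
    (constantCoeff_u₀_ne_zero (x := xVars n) ht₁ fun k => MvPowerSeries.constantCoeff_X k)]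
  congr 2
  funext k
  refine Fin.cases ?_ (fun k => ?_) k
  · rw [Fin.cons_zero, nodeCoord_succ_zero]
  · rw [Fin.cons_succ, nodeCoord_succ_succ]

lemma kernelOp_eq (s : Fin (n + 2) → ℂ) (r₁ r₂ : ℂ) (g : MvPowerSeries (Fin (n + 1)) ℂ) :
    kernelOp t s r₁ r₂ g =
      diffusionOp t s g + MvPowerSeries.C (r₁ * r₂) * discr MvPowerSeries.X * g := by
  have h := sum_cofac_mul_aeval (n := n) (Polynomial.X ^ n)
    (by rw [Polynomial.degree_X_pow]; exact_mod_cast Nat.lt_succ_self n)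
  rw [Polynomial.coeff_X_pow_self, map_one, mul_one] at h
  rw [kernelOp, diffusionOp, ← h, Finset.mul_sum, Finset.sum_mul, ← Finset.sum_add_distrib]
  refine Finset.sum_congr rfl fun i _ => ?_
  rw [partialOp, MvPowerSeries.smul_eq_C_mul, map_pow, Polynomial.aeval_X]
  ring

lemma gammaForm_subst (F : PowerSeries ℂ) (g : MvPowerSeries (Fin (n + 1)) ℂ) :
    gammaForm t (F.subst (gaussArg t)) g =
      (PowerSeries.derivative ℂ F).subst (gaussArg t) * gammaForm t (gaussArg t) g := by
  rw [gammaForm, gammaForm, Finset.mul_sum]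
  refine Finset.sum_congr rfl fun i _ => ?_
  rw [pderiv_subst (hasSubst_gaussArg t) 0 (X_dvd_gaussArg t 0)]
  ring

lemma diffusionOp_subst (s : Fin (n + 2) → ℂ) (F : PowerSeries ℂ) :
    diffusionOp t s (F.subst (gaussArg t)) =
      (PowerSeries.derivative ℂ F).subst (gaussArg t) * diffusionOp t s (gaussArg t) +
      (PowerSeries.derivative ℂ (PowerSeries.derivative ℂ F)).subst (gaussArg t) *
        gammaForm t (gaussArg t) (gaussArg t) := by
  rw [gammaForm, diffusionOp, diffusionOp, Finset.mul_sum, Finset.mul_sum,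
    ← Finset.sum_add_distrib]
  refine Finset.sum_congr rfl fun i _ => ?_
  have hs := hasSubst_gaussArg t
  have hd := X_dvd_gaussArg t 0
  rw [pderiv_subst hs 0 hd, Derivation.leibniz, pderiv_subst hs 0 hd, smul_eq_mul, smul_eq_mul]
  ring

/-- With z = -w₀ and a harmonic h of degree d, the mixed term 2Γ(F(z), h) equals 2d Δ z F'(z) h, and
the Euler part contributes d² - d + d(r₁ + r₂ + 1). Together with r₁r₂ this is (r₁ + d)(r₂ + d), and
the first order coefficient becomes (r₁ + r₂ + 2d + 1)z - s₁: the Gauss equation with shifted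
parameters. -/
lemma kernelOp_expansionTerm {t : Fin n → ℂ} {s : Fin (n + 2) → ℂ} {r₁ r₂ : ℂ}
    (hinj : Function.Injective (singularPoint t)) (ht₁ : ∀ i, t i ≠ 1)
    (hsum : ∑ k, s k = r₁ + r₂ + 1) (hs₁ : ∀ m : ℕ, s 0 ≠ -(m : ℂ))
    (hs₃ : ∀ (k : Fin n) (m : ℕ), s k.succ.succ ≠ -(m : ℂ)) (i : Fin n → ℕ) :
    kernelOp t s r₁ r₂ (expansionTerm t s r₁ r₂ i) = 0 := by
  set d : ℂ := ∑ k, (i k : ℂ) with hd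
  rw [expansionTerm, homogenizedP_xVars ht₁, ← hd, gaussFactor_eq, kernelOp_eq, diffusionOp_mul,
    diffusionOp_subst, gammaForm_subst, diffusionOp_aeval s hinj, laplaceOp_homPoly hs₃,
    eulerOp_homPoly, eulerOp_mul, eulerOp_C, eulerOp_homPoly, ← hd, hsum]
  set F := gaussSeries (r₁ + d) (r₂ + d) (s 0) with hF
  set z := gaussArg t with hz
  have hzn : z = MvPowerSeries.C (-1) * nodeCoord t 0 := by
    rw [nodeCoord_zero, map_neg, map_one]
    ring
  set y : Fin (n + 1) → MvPowerSeries (Fin (n + 1)) ℂ := fun k => nodeCoord t (Fin.succ k) with hy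
  have hTz : diffusionOp t s z = discr MvPowerSeries.X *
      (MvPowerSeries.C (r₁ + r₂ + 1) * z - MvPowerSeries.C (s 0)) := by
    rw [hzn, diffusionOp_C_mul, diffusionOp_nodeCoord s hinj, hsum, map_neg, map_one]
    ring
  have hGz : gammaForm t z z = discr MvPowerSeries.X * (z ^ 2 - z) := by
    rw [hzn, gammaForm_C_mul, gammaForm_comm, gammaForm_C_mul, gammaForm_nodeCoord hinj,
      if_pos rfl, map_neg, map_one]
    ring
  have hGh : gammaForm t z (MvPolynomial.aeval y (homPoly s i)) = discr MvPowerSeries.X * z *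
      (MvPowerSeries.C d * MvPolynomial.aeval y (homPoly s i)) := by
    rw [hzn, gammaForm_comm, gammaForm_C_mul, gammaForm_comm, hy,
      gammaForm_nodeCoord_zero_aeval hinj, eulerOp_homPoly, map_mul, aeval_C_eq, ← hd]
    ring
  rw [hTz, hGz, hGh]
  have hode := congrArg (fun f => f.subst z) (gaussSeries_ode (r₁ + d) (r₂ + d) (s 0) hs₁)
  have hs := hasSubst_gaussArg t
  rw [← hz] at hs
  have hzero : (0 : PowerSeries ℂ).subst z = 0 := by
    rw [← PowerSeries.coe_substAlgHom hs, map_zero]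
  beta_reduce at hode
  rw [hzero, PowerSeries.subst_add hs, PowerSeries.subst_add hs, PowerSeries.subst_mul hs,
    PowerSeries.subst_mul hs, PowerSeries.subst_mul hs, PowerSeries.subst_sub hs,
    PowerSeries.subst_sub hs, PowerSeries.subst_mul hs, PowerSeries.subst_pow hs,
    PowerSeries.subst_X hs, PowerSeries.subst_C, PowerSeries.subst_C, PowerSeries.subst_C,
    ← hF] at hode
  simp only [map_add, map_mul, map_sub, map_one, zero_mul, zero_add, add_zero,
    aeval_C_eq] at hode ⊢
  linear_combination (discr MvPowerSeries.X * MvPolynomial.aeval y (homPoly s i)) * hode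

end ExpansionTerm

/-! ### Divisibility by variables -/

section Divisibility

variable {n : ℕ}

lemma X_dvd_iff_killCompl (k : Fin (n + 1)) (g : MvPowerSeries (Fin (n + 1)) ℂ) :
    MvPowerSeries.X k ∣ g ↔ MvPowerSeries.killCompl k.succAboveEmb g = 0 := by
  constructor
  · rintro ⟨h, rfl⟩
    rw [map_mul, MvPowerSeries.killCompl_X_eq_zero, zero_mul]
    rintro ⟨l, hl⟩
    exact Fin.succAbove_ne k _ hl
  · intro h
    rw [MvPowerSeries.X_dvd_iff]
    intro a ha
    have hmem : a ∈ Set.range (Finsupp.embDomain k.succAboveEmb) := by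
      rw [Finsupp.mem_range_embDomain_iff]
      intro l hl
      obtain ⟨j, rfl⟩ := Fin.exists_succAbove_eq (x := l) (y := k) (by
        rintro rfl
        exact Finsupp.mem_support_iff.mp hl ha)
      exact ⟨j, rfl⟩
    obtain ⟨b, rfl⟩ := hmem
    rw [← MvPowerSeries.coeff_killCompl, h, map_zero]

lemma mvPowerSeries_X_ne_zero (k : Fin n) : (MvPowerSeries.X k : MvPowerSeries (Fin n) ℂ) ≠ 0 := by
  have := X_sub_C_ne_zero 0 k
  rwa [map_zero, sub_zero] at this

/-- Divisibility by Xₖ is vanishing under xₖ = 0, and that substitution takes values in a domain. -/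
lemma prime_X (k : Fin (n + 1)) : Prime (MvPowerSeries.X k : MvPowerSeries (Fin (n + 1)) ℂ) := by
  refine ⟨mvPowerSeries_X_ne_zero k, fun h => ?_, fun f g h => ?_⟩
  · have h1 := h.map (MvPowerSeries.constantCoeff (R := ℂ))
    rw [MvPowerSeries.constantCoeff_X] at h1
    exact not_isUnit_zero h1
  · rw [X_dvd_iff_killCompl, map_mul, mul_eq_zero] at h
    rwa [X_dvd_iff_killCompl, X_dvd_iff_killCompl]

lemma not_X_dvd_X_sub_X {k a b : Fin n} (hab : a ≠ b) (hak : a ≠ k) :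
    ¬(MvPowerSeries.X k : MvPowerSeries (Fin n) ℂ) ∣ MvPowerSeries.X a - MvPowerSeries.X b := by
  intro h
  have h1 := MvPowerSeries.X_dvd_iff.mp h (Finsupp.single a 1) (Finsupp.single_eq_of_ne hak.symm)
  rw [map_sub, MvPowerSeries.coeff_X, MvPowerSeries.coeff_X, if_pos rfl, if_neg, sub_zero] at h1
  · exact one_ne_zero h1
  · rw [Finsupp.single_left_inj one_ne_zero]
    exact hab

lemma not_X_dvd_discr (k : Fin (n + 1)) : ¬MvPowerSeries.X k ∣
    discr (MvPowerSeries.X : Fin (n + 1) → MvPowerSeries (Fin (n + 1)) ℂ) := by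
  intro h
  obtain ⟨⟨a, b⟩, hab, h1⟩ := (prime_X k).exists_mem_finset_dvd h
  have hne : a ≠ b := (Finset.mem_offDiag.mp hab).2.2
  by_cases ha : a = k
  · refine not_X_dvd_X_sub_X hne.symm (fun hb => hne (ha.trans hb.symm)) ?_
    rw [← dvd_neg, neg_sub]
    exact h1
  · exact not_X_dvd_X_sub_X hne ha h1

lemma not_X_dvd_X {k l : Fin n} (h : l ≠ k) :
    ¬(MvPowerSeries.X k : MvPowerSeries (Fin n) ℂ) ∣ MvPowerSeries.X l := by
  intro h1
  have h2 := MvPowerSeries.X_dvd_iff.mp h1 (Finsupp.single l 1) (Finsupp.single_eq_of_ne h.symm)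
  rw [MvPowerSeries.coeff_X, if_pos rfl] at h2
  exact one_ne_zero h2

lemma prod_X_dvd {g : MvPowerSeries (Fin (n + 1)) ℂ} (h : ∀ k, MvPowerSeries.X k ∣ g) :
    ∏ k, MvPowerSeries.X k ∣ g := by
  suffices ∀ S : Finset (Fin (n + 1)), ∏ k ∈ S, MvPowerSeries.X k ∣ g from this _
  intro S
  induction S using Finset.induction_on with
  | empty => rw [Finset.prod_empty]; exact one_dvd _
  | insert k S hk ih =>
    obtain ⟨f, rfl⟩ := ih
    rw [Finset.prod_insert hk, mul_comm]
    refine mul_dvd_mul_left _ (((prime_X k).dvd_or_dvd (h k)).resolve_left fun h1 => ?_)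
    obtain ⟨l, hl, h2⟩ := (prime_X k).exists_mem_finset_dvd h1
    exact not_X_dvd_X (by rintro rfl; exact hk hl) h2

end Divisibility

/-! ### Uniqueness of solutions -/

section Uniqueness

variable {n : ℕ} {t : Fin n → ℂ}

lemma gammaForm_pow_right (f g : MvPowerSeries (Fin (n + 1)) ℂ) (m : ℕ) :
    gammaForm t f (g ^ (m + 1)) = ((m + 1 : ℕ) : MvPowerSeries (Fin (n + 1)) ℂ) *
      (g ^ m * gammaForm t f g) := by
  induction m with
  | zero => simp
  | succ m ih =>
    rw [pow_succ, gammaForm_mul, ih, pow_succ]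
    push_cast
    ring

lemma exists_gammaForm_nodeCoord (a : Fin (n + 2)) (g : MvPowerSeries (Fin (n + 1)) ℂ) :
    ∃ h, gammaForm t (nodeCoord t a) g = nodeCoord t a * h := by
  rw [nodeCoord, gammaForm_comm, gammaForm_C_mul, gammaForm_comm, gammaForm_shiftProd_left,
    ← mul_assoc]
  exact ⟨_, rfl⟩

lemma diffusionOp_nodeCoord_pow (hinj : Function.Injective (singularPoint t))
    (s : Fin (n + 2) → ℂ) (a : Fin (n + 2)) (m : ℕ) :
    diffusionOp t s (nodeCoord t a ^ (m + 1)) = discr MvPowerSeries.X * (nodeCoord t a ^ m *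
      (MvPowerSeries.C ((m + 1) * (m + ∑ k, s k)) * nodeCoord t a +
        MvPowerSeries.C ((m + 1) * (m + s a)))) := by
  induction m with
  | zero =>
    rw [zero_add, pow_one, diffusionOp_nodeCoord s hinj]
    simp
  | succ m ih =>
    rw [pow_succ, diffusionOp_mul, ih, gammaForm_comm, gammaForm_pow_right,
      gammaForm_nodeCoord hinj, if_pos rfl, diffusionOp_nodeCoord s hinj]
    push_cast
    simp only [map_mul, map_add, map_natCast, map_one]
    ring

lemma X_dvd_nodeCoord_zero (k : Fin (n + 1)) : MvPowerSeries.X k ∣ nodeCoord t 0 := by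
  rw [nodeCoord_zero, dvd_neg]
  exact X_dvd_gaussArg t k

lemma nodeCoord_zero_eq : nodeCoord t 0 =
    MvPowerSeries.C (-(∏ k, t k)⁻¹) * ∏ k, MvPowerSeries.X k := by
  rw [nodeCoord_zero, gaussArg, MvPowerSeries.smul_eq_C_mul, map_neg, neg_mul]

lemma nodeCoord_zero_dvd (ht₀ : ∀ i, t i ≠ 0) {g : MvPowerSeries (Fin (n + 1)) ℂ}
    (h : ∀ k, MvPowerSeries.X k ∣ g) : nodeCoord t 0 ∣ g := by
  rw [nodeCoord_zero_eq]
  have h1 : IsUnit (MvPowerSeries.C (-(∏ k, t k)⁻¹) : MvPowerSeries (Fin (n + 1)) ℂ) :=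
    (IsUnit.mk0 _ (neg_ne_zero.mpr (inv_ne_zero
      (Finset.prod_ne_zero_iff.mpr fun k _ => ht₀ k)))).map MvPowerSeries.C
  exact h1.mul_left_dvd.mpr (prod_X_dvd h)

lemma nodeCoord_zero_ne_zero (ht₀ : ∀ i, t i ≠ 0) : nodeCoord t 0 ≠ 0 := by
  rw [nodeCoord_zero_eq]
  refine mul_ne_zero ?_ (Finset.prod_ne_zero_iff.mpr fun k _ => mvPowerSeries_X_ne_zero k)
  rw [Ne, map_eq_zero_iff _ MvPowerSeries.C_injective]
  exact neg_ne_zero.mpr (inv_ne_zero (Finset.prod_ne_zero_iff.mpr fun k _ => ht₀ k))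

/-- After cancelling w₀ᵐ, every term except the indicial one (m + 1)(m + s₁)Δg still contains w₀.
Each Xₖ is prime and does not divide Δ, hence divides g. -/
lemma nodeCoord_zero_dvd_of_kernelOp {s : Fin (n + 2) → ℂ} {r₁ r₂ : ℂ}
    (hinj : Function.Injective (singularPoint t)) (ht₀ : ∀ i, t i ≠ 0)
    (hs₁ : ∀ m : ℕ, s 0 ≠ -(m : ℂ)) (m : ℕ) {g : MvPowerSeries (Fin (n + 1)) ℂ}
    (hg : kernelOp t s r₁ r₂ (nodeCoord t 0 ^ (m + 1) * g) = 0) : nodeCoord t 0 ∣ g := by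
  refine nodeCoord_zero_dvd ht₀ fun k => ?_
  obtain ⟨h, hh⟩ := exists_gammaForm_nodeCoord (t := t) 0 g
  rw [kernelOp_eq, diffusionOp_mul, diffusionOp_nodeCoord_pow hinj, gammaForm_comm,
    gammaForm_pow_right, gammaForm_comm, hh] at hg
  have h1 : nodeCoord t 0 ^ m * (nodeCoord t 0 * (diffusionOp t s g +
      g * discr MvPowerSeries.X * MvPowerSeries.C ((m + 1) * (m + ∑ k, s k)) +
      2 * ((m + 1 : ℕ) : MvPowerSeries (Fin (n + 1)) ℂ) * h +
      MvPowerSeries.C (r₁ * r₂) * discr MvPowerSeries.X * g) +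
      MvPowerSeries.C ((m + 1) * (m + s 0)) * (discr MvPowerSeries.X * g)) = 0 := by
    rw [← hg]
    ring
  have h2 := (mul_eq_zero.mp h1).resolve_left (pow_ne_zero _ (nodeCoord_zero_ne_zero ht₀))
  have h3 : MvPowerSeries.X k ∣
      MvPowerSeries.C ((m + 1) * (m + s 0)) * (discr MvPowerSeries.X * g) := by
    rw [eq_neg_of_add_eq_zero_right h2, dvd_neg]
    exact (X_dvd_nodeCoord_zero k).mul_right _
  have h4 : IsUnit
      (MvPowerSeries.C ((m + 1) * (m + s 0) : ℂ) : MvPowerSeries (Fin (n + 1)) ℂ) := by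
    refine (IsUnit.mk0 _ (mul_ne_zero (Nat.cast_add_one_ne_zero m) fun h => ?_)).map
      MvPowerSeries.C
    exact hs₁ m (eq_neg_of_add_eq_zero_right h)
  rw [h4.dvd_mul_left] at h3
  exact ((prime_X k).dvd_or_dvd h3).resolve_left (not_X_dvd_discr k)

/-- A solution of the equation of the kernel divisible by all the variables is zero. -/
lemma eq_zero_of_kernelOp_eq_zero {s : Fin (n + 2) → ℂ} {r₁ r₂ : ℂ}
    (hinj : Function.Injective (singularPoint t)) (ht₀ : ∀ i, t i ≠ 0)
    (hs₁ : ∀ m : ℕ, s 0 ≠ -(m : ℂ)) {g : MvPowerSeries (Fin (n + 1)) ℂ}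
    (hg : kernelOp t s r₁ r₂ g = 0) (hX : ∀ k, MvPowerSeries.X k ∣ g) : g = 0 := by
  refine eq_zero_of_forall_X_pow_dvd 0 fun N => ?_
  -- Divisibility by all the variables supplies the first factor w₀, and each further factor comes
  -- from the equation.
  have key : nodeCoord t 0 ^ (N + 1) ∣ g := by
    induction N with
    | zero =>
      rw [zero_add, pow_one]
      exact nodeCoord_zero_dvd ht₀ hX
    | succ N ih =>
      obtain ⟨f, rfl⟩ := ih
      rw [pow_succ]
      exact mul_dvd_mul_left _ (nodeCoord_zero_dvd_of_kernelOp hinj ht₀ hs₁ N hg)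
  exact (pow_dvd_pow_of_dvd (X_dvd_nodeCoord_zero 0) N).trans
    ((pow_dvd_pow _ (Nat.le_succ N)).trans key)

end Uniqueness

/-! ### Restriction to `xₙ₊₁ = 0` -/

section Restrict

variable {n : ℕ}

/-- The substitution `xₙ₊₁ = 0`. -/
def restrictLast (n : ℕ) : MvPowerSeries (Fin (n + 1)) ℂ →ₐ[ℂ] MvPowerSeries (Fin n) ℂ :=
  MvPowerSeries.killCompl (Fin.last n).succAboveEmb

lemma restrictLast_X_castSucc (k : Fin n) :
    restrictLast n (MvPowerSeries.X k.castSucc) = MvPowerSeries.X k := by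
  have h := MvPowerSeries.killCompl_X (R := ℂ) (e := (Fin.last n).succAboveEmb) k
  rwa [Fin.coe_succAboveEmb, Fin.succAbove_last] at h

lemma restrictLast_eq_zero_iff (g : MvPowerSeries (Fin (n + 1)) ℂ) :
    restrictLast n g = 0 ↔ MvPowerSeries.X (Fin.last n) ∣ g :=
  (X_dvd_iff_killCompl (Fin.last n) g).symm

lemma restrictLast_xVars (k : Fin (n + 1)) : restrictLast n (xVars n k) = xVarsBoundary n k := by
  refine Fin.lastCases ?_ (fun k => ?_) k
  · rw [xVarsBoundary, Fin.snoc_last, restrictLast_eq_zero_iff]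
    exact dvd_rfl
  · rw [xVarsBoundary, Fin.snoc_castSucc]
    exact restrictLast_X_castSucc k

lemma map_u₀ {A B : Type*} [CommRing A] [Algebra ℂ A] [CommRing B] [Algebra ℂ B] (e : A →ₐ[ℂ] B)
    (t : Fin n → ℂ) (x : Fin (n + 1) → A) : e (u₀ t x) = u₀ t (fun k => e (x k)) := by
  rw [u₀, u₀, map_smul, map_prod]
  simp only [map_sub, map_one]

lemma map_u {A B : Type*} [CommRing A] [Algebra ℂ A] [CommRing B] [Algebra ℂ B] (e : A →ₐ[ℂ] B)
    (t : Fin n → ℂ) (x : Fin (n + 1) → A) (i : Fin n) :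
    e (u t x i) = u t (fun k => e (x k)) i := by
  rw [u, u, map_smul, map_prod]
  simp only [map_sub, AlgHom.commutes]

lemma map_homogenizedP {m m' : ℕ} {t : Fin n → ℂ} (ht₁ : ∀ i, t i ≠ 1) (s : Fin (n + 2) → ℂ)
    (e : MvPowerSeries (Fin m) ℂ →ₐ[ℂ] MvPowerSeries (Fin m') ℂ)
    {x : Fin (n + 1) → MvPowerSeries (Fin m) ℂ}
    (hx : ∀ k, MvPowerSeries.constantCoeff (x k) = 0)
    (hx' : ∀ k, MvPowerSeries.constantCoeff (e (x k)) = 0) (i : Fin n → ℕ) :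
    e (homogenizedP t s x i) = homogenizedP t s (fun k => e (x k)) i := by
  rw [homogenizedP_eq_aeval t s _ i (constantCoeff_u₀_ne_zero ht₁ hx),
    homogenizedP_eq_aeval t s _ i (constantCoeff_u₀_ne_zero (x := fun k => e (x k)) ht₁ hx'),
    MvPolynomial.comp_aeval_apply]
  congr 2
  funext k
  refine Fin.cases ?_ (fun k => ?_) k
  · rw [Fin.cons_zero, Fin.cons_zero, map_u₀]
  · rw [Fin.cons_succ, Fin.cons_succ, map_neg, map_u]

lemma constantCoeff_xVarsBoundary (k : Fin (n + 1)) :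
    MvPowerSeries.constantCoeff (xVarsBoundary n k) = 0 := by
  refine Fin.lastCases ?_ (fun k => ?_) k
  · rw [xVarsBoundary, Fin.snoc_last, map_zero]
  · rw [xVarsBoundary, Fin.snoc_castSucc, MvPowerSeries.constantCoeff_X]

/-- At xₙ₊₁ = 0 the argument of F vanishes, so F becomes 1. -/
lemma restrictLast_expansionTerm {t : Fin n → ℂ} (ht₁ : ∀ i, t i ≠ 1) (s : Fin (n + 2) → ℂ)
    (r₁ r₂ : ℂ) (i : Fin n → ℕ) :
    restrictLast n (expansionTerm t s r₁ r₂ i) = homogenizedP t s (xVarsBoundary n) i := by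
  have h0 : restrictLast n (gaussArg t) = 0 :=
    (restrictLast_eq_zero_iff _).mpr (X_dvd_gaussArg t _)
  have h1 : ∀ a b c : ℂ, restrictLast n (gaussFactor t a b c) = 1 := by
    intro a b c
    obtain ⟨G, h2⟩ : ∃ G, gaussSeries a b c = PowerSeries.X * G + PowerSeries.C 1 := by
      have h3 := PowerSeries.eq_X_mul_shift_add_const (gaussSeries a b c)
      have h4 : PowerSeries.constantCoeff (gaussSeries a b c) = 1 := by
        rw [gaussSeries, ← PowerSeries.coeff_zero_eq_constantCoeff_apply, PowerSeries.coeff_mk]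
        simp [ordinaryHypergeometricCoefficient]
      rw [h4] at h3
      exact ⟨_, h3⟩
    rw [gaussFactor_eq, h2, add_comm (PowerSeries.X * G),
      subst_C_add_X_mul (hasSubst_gaussArg t), map_add, map_mul, h0, zero_mul, add_zero,
      map_one, map_one]
  rw [expansionTerm, map_mul, h1, one_mul, map_homogenizedP ht₁ s _ (x := xVars n)
    (fun k => MvPowerSeries.constantCoeff_X k)
    (fun k => by rw [restrictLast_xVars]; exact constantCoeff_xVarsBoundary k)]
  simp only [restrictLast_xVars]

lemma renameEquiv_expansionTerm {t : Fin n → ℂ} (ht₁ : ∀ i, t i ≠ 1) (s : Fin (n + 2) → ℂ)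
    (r₁ r₂ : ℂ) (i : Fin n → ℕ) (σ : Equiv.Perm (Fin (n + 1))) :
    MvPowerSeries.renameEquiv ℂ σ (expansionTerm t s r₁ r₂ i) = expansionTerm t s r₁ r₂ i := by
  set e : MvPowerSeries (Fin (n + 1)) ℂ →ₐ[ℂ] MvPowerSeries (Fin (n + 1)) ℂ :=
    MvPowerSeries.rename σ
  have hX : ∀ k, e (MvPowerSeries.X k) = MvPowerSeries.X (σ k) := fun k =>
    MvPowerSeries.rename_X σ k
  change e _ = _
  have h0 : e (gaussArg t) = gaussArg t := by
    rw [gaussArg, map_smul, map_prod]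
    simp only [hX]
    rw [Equiv.prod_comp σ fun k => (MvPowerSeries.X k : MvPowerSeries (Fin (n + 1)) ℂ)]
  rw [expansionTerm, map_mul, gaussFactor_eq,
    algHom_subst (hasSubst_gaussArg t) 0 (X_dvd_gaussArg t 0) e h0]
  congr 1
  rw [homogenizedP_eq_aeval t s _ i
    (constantCoeff_u₀_ne_zero (x := xVars n) ht₁ fun k => MvPowerSeries.constantCoeff_X k),
    MvPolynomial.comp_aeval_apply]
  congr 2
  funext k
  refine Fin.cases ?_ (fun k => ?_) k
  · rw [Fin.cons_zero, map_u₀]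
    simp only [u₀, xVars, hX]
    rw [Equiv.prod_comp σ fun k => (MvPowerSeries.X k - 1 : MvPowerSeries (Fin (n + 1)) ℂ)]
  · rw [Fin.cons_succ, map_neg, map_u]
    simp only [u, xVars, hX]
    rw [Equiv.prod_comp σ fun l =>
      (MvPowerSeries.X l - algebraMap ℂ _ (t k) : MvPowerSeries (Fin (n + 1)) ℂ)]

end Restrict

/-! ### The expansion of the kernel -/

section Expansion

variable {n : ℕ}

/-- `kernelOp` as a linear map. -/
def kernelOpLin (t : Fin n → ℂ) (s : Fin (n + 2) → ℂ) (r₁ r₂ : ℂ) :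
    MvPowerSeries (Fin (n + 1)) ℂ →ₗ[ℂ] MvPowerSeries (Fin (n + 1)) ℂ where
  toFun := kernelOp t s r₁ r₂
  map_add' f g := by
    rw [kernelOp_eq, kernelOp_eq, kernelOp_eq, diffusionOp_add]
    ring
  map_smul' c g := by
    rw [RingHom.id_apply, MvPowerSeries.smul_eq_C_mul, MvPowerSeries.smul_eq_C_mul, kernelOp_eq,
      kernelOp_eq, diffusionOp_C_mul]
    ring

lemma formalSum_eq_sum {A : Type*} [CommRing A] [Algebra ℂ A] (a : (Fin n → ℕ) → A)
    {Q : (Fin n → ℕ) → InvYSeries n ℂ} (hQ : IsLocallyFinite Q) (j : Fin n →₀ ℕ) :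
    MvPowerSeries.coeff j (formalSum a Q) =
      ∑ i ∈ (hQ j).toFinset, MvPowerSeries.coeff j (Q i) • a i := by
  refine finsum_eq_sum_of_support_subset _ fun i hi => ?_
  rw [Set.Finite.coe_toFinset, Set.mem_ofPred_eq]
  intro h
  exact hi (by beta_reduce; rw [h, zero_smul])

/-- The three conditions on K (equation, symmetry, boundary value) hold for the sum as well. Local
finiteness makes each y-coefficient a finite sum, so the operators act termwise. -/
lemma eq_formalSum_expansionTerm {t : Fin n → ℂ} {s : Fin (n + 2) → ℂ} {r₁ r₂ : ℂ}
    (hinj : Function.Injective (singularPoint t)) (ht₀ : ∀ i, t i ≠ 0) (ht₁ : ∀ i, t i ≠ 1)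
    (hsum : ∑ k, s k = r₁ + r₂ + 1) (hs₁ : ∀ m : ℕ, s 0 ≠ -(m : ℂ))
    (hs₃ : ∀ (k : Fin n) (m : ℕ), s k.succ.succ ≠ -(m : ℂ))
    {K : InvYSeries n (MvPowerSeries (Fin (n + 1)) ℂ)} {Q : (Fin n → ℕ) → InvYSeries n ℂ}
    (hQ : IsBoundaryFamily t s Q)
    (hop : ∀ j, kernelOp t s r₁ r₂ (MvPowerSeries.coeff j K) = 0)
    (hsymm : ∀ j σ, MvPowerSeries.renameEquiv ℂ σ (MvPowerSeries.coeff j K) =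
      MvPowerSeries.coeff j K)
    (hres : ∀ j, restrictLast n (MvPowerSeries.coeff j K) =
      MvPowerSeries.coeff j (boundaryValue n)) :
    K = formalSum (expansionTerm t s r₁ r₂) Q := by
  refine MvPowerSeries.ext fun j => ?_
  rw [← sub_eq_zero]
  refine eq_zero_of_kernelOp_eq_zero hinj ht₀ hs₁ (r₁ := r₁) (r₂ := r₂) ?_ ?_
  · change kernelOpLin t s r₁ r₂ _ = 0
    rw [map_sub, formalSum_eq_sum _ hQ.locallyFinite, map_sum]
    simp only [map_smul]
    have h1 : kernelOpLin t s r₁ r₂ (MvPowerSeries.coeff j K) = 0 := hop j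
    have h2 : ∀ i, kernelOpLin t s r₁ r₂ (expansionTerm t s r₁ r₂ i) = 0 :=
      kernelOp_expansionTerm hinj ht₁ hsum hs₁ hs₃
    simp only [h1, h2, smul_zero, Finset.sum_const_zero, sub_zero]
  · have hlast : MvPowerSeries.X (Fin.last n) ∣ MvPowerSeries.coeff j K -
        MvPowerSeries.coeff j (formalSum (expansionTerm t s r₁ r₂) Q) := by
      rw [← restrictLast_eq_zero_iff, map_sub, hres, ← hQ.system,
        formalSum_eq_sum _ hQ.locallyFinite, formalSum_eq_sum _ hQ.locallyFinite, map_sum]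
      simp only [map_smul, restrictLast_expansionTerm ht₁, sub_self]
    intro k
    -- Symmetry carries divisibility by the last variable over to every other variable.
    have h1 := map_dvd (MvPowerSeries.renameEquiv ℂ (Equiv.swap (Fin.last n) k)) hlast
    rw [map_sub, hsymm, formalSum_eq_sum _ hQ.locallyFinite, map_sum] at h1
    simp only [map_smul, renameEquiv_expansionTerm ht₁] at h1
    rw [← formalSum_eq_sum _ hQ.locallyFinite] at h1
    have h2 : MvPowerSeries.renameEquiv ℂ (Equiv.swap (Fin.last n) k)
        (MvPowerSeries.X (Fin.last n)) = MvPowerSeries.X k := by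
      refine (MvPowerSeries.rename_X (Equiv.swap (Fin.last n) k) (Fin.last n)).trans ?_
      rw [Equiv.swap_apply_left]
    rwa [h2] at h1

end Expansion

/-! ### The coefficients of the kernel and of the boundary value -/

section Coefficients

variable {n : ℕ}

lemma coeff_prod_X_mul {A : Type*} [CommRing A] (g : MvPowerSeries (Fin n) A) (j : Fin n →₀ ℕ) :
    MvPowerSeries.coeff j ((∏ k, MvPowerSeries.X k) * g) =
      if ∀ k, 1 ≤ j k then
        MvPowerSeries.coeff (j - Finsupp.equivFunOnFinite.symm 1) g else 0 := by
  have h1 : (∏ k, MvPowerSeries.X k : MvPowerSeries (Fin n) A) =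
      MvPowerSeries.monomial (Finsupp.equivFunOnFinite.symm 1) 1 := by
    rw [MvPowerSeries.monomial_one_eq, Finsupp.prod_fintype _ _ fun _ => pow_zero _]
    exact Finset.prod_congr rfl fun k _ => (pow_one _).symm
  rw [h1, MvPowerSeries.coeff_monomial_mul, one_mul]
  exact if_congr (by rw [Finsupp.le_def]; rfl) rfl rfl

/-- The product of the geometric series `∏_{k ∈ S} 1 / (1 - aₖ Xₖ)`. -/
def geomProd {A : Type*} [CommRing A] (a : Fin n → A) (S : Finset (Fin n)) :
    MvPowerSeries (Fin n) A :=
  fun j => if ∀ k, k ∉ S → j k = 0 then ∏ k, a k ^ j k else 0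

lemma coeff_geomProd {A : Type*} [CommRing A] (a : Fin n → A) (S : Finset (Fin n))
    (j : Fin n →₀ ℕ) : MvPowerSeries.coeff j (geomProd a S) =
      if ∀ k, k ∉ S → j k = 0 then ∏ k, a k ^ j k else 0 := rfl

/-- Allowing the exponent of one more variable to be nonzero amounts to dividing by 1 - aₖXₖ. -/
lemma one_sub_mul_geomProd {A : Type*} [CommRing A] (a : Fin n → A) {S : Finset (Fin n)}
    {k : Fin n} (hk : k ∉ S) :
    (1 - MvPowerSeries.C (a k) * MvPowerSeries.X k) * geomProd a (insert k S) =
      geomProd a S := by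
  ext j
  rw [sub_mul, one_mul, mul_assoc, map_sub, MvPowerSeries.coeff_C_mul, coeff_X_mul]
  simp only [coeff_geomProd]
  have hS : (∀ l, l ∉ S → j l = 0) ↔ j k = 0 ∧ ∀ l, l ∉ insert k S → j l = 0 := by
    constructor
    · exact fun h => ⟨h k hk, fun l hl => h l fun h' => hl (Finset.mem_insert_of_mem h')⟩
    · rintro ⟨h1, h2⟩ l hl
      by_cases hlk : l = k
      · rw [hlk, h1]
      · exact h2 l (by rw [Finset.mem_insert, not_or]; exact ⟨hlk, hl⟩)
  by_cases h0 : j k = 0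
  · rw [if_pos h0, mul_zero, sub_zero]
    exact if_congr (by rw [hS]; exact (and_iff_right h0).symm) rfl rfl
  · rw [if_neg h0, if_neg (c := ∀ l, l ∉ S → j l = 0) (fun h => h0 (h k hk)), sub_eq_zero]
    have h1 : (∀ l, l ∉ insert k S → (j - Finsupp.single k 1 : Fin n →₀ ℕ) l = 0) ↔
        ∀ l, l ∉ insert k S → j l = 0 := by
      refine forall₂_congr fun l hl => ?_
      have : l ≠ k := by rintro rfl; exact hl (Finset.mem_insert_self _ _)
      rw [Finsupp.tsub_apply, Finsupp.single_eq_of_ne this, tsub_zero]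
    rw [if_congr h1 rfl rfl, mul_ite, mul_zero]
    refine if_congr Iff.rfl ?_ rfl
    rw [← Finset.mul_prod_erase _ (fun l => a l ^ j l) (Finset.mem_univ k),
      ← Finset.mul_prod_erase _ (fun l => a l ^ (j - Finsupp.single k 1 : Fin n →₀ ℕ) l)
        (Finset.mem_univ k), ← mul_assoc, Finsupp.tsub_apply, Finsupp.single_eq_same,
      ← pow_succ', Nat.sub_add_cancel (Nat.one_le_iff_ne_zero.mpr h0)]
    congr 1
    refine Finset.prod_congr rfl fun l hl => ?_
    rw [Finsupp.tsub_apply, Finsupp.single_eq_of_ne (Finset.ne_of_mem_erase hl), tsub_zero]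

lemma prod_invOfUnit_eq_geomProd {A : Type*} [CommRing A] (a : Fin n → A) (S : Finset (Fin n)) :
    ∏ k ∈ S, MvPowerSeries.invOfUnit (1 - MvPowerSeries.C (a k) * MvPowerSeries.X k) 1 =
      geomProd a S := by
  induction S using Finset.induction_on with
  | empty =>
    rw [Finset.prod_empty]
    ext j
    rw [coeff_geomProd, MvPowerSeries.coeff_one]
    have : j = 0 ↔ ∀ k, k ∉ (∅ : Finset (Fin n)) → j k = 0 := by
      simp [Finsupp.ext_iff]
    split_ifs with h1 h2 h2
    · simp [h1]
    · exact absurd (this.mp h1) h2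
    · exact absurd (this.mpr h2) h1
    · rfl
  | insert k S hk ih =>
    rw [Finset.prod_insert hk, ih, ← one_sub_mul_geomProd a hk, ← mul_assoc,
      MvPowerSeries.invOfUnit_mul _ _ (by simp), one_mul]

lemma boundaryValue_eq : boundaryValue n = (∏ k, MvPowerSeries.X k) *
    ((n ! : ℂ)⁻¹ • ∑ σ : Equiv.Perm (Fin n), geomProd
      (fun k => (MvPowerSeries.X (σ.symm k) : MvPowerSeries (Fin n) ℂ)) Finset.univ) := by
  rw [boundaryValue, mul_smul_comm, Finset.mul_sum]
  congr 1
  refine Finset.sum_congr rfl fun σ _ => ?_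
  rw [← prod_invOfUnit_eq_geomProd, ← Finset.prod_mul_distrib, ← Equiv.prod_comp σ fun k =>
    MvPowerSeries.X k * MvPowerSeries.invOfUnit (1 - MvPowerSeries.C (MvPowerSeries.X (σ.symm k) :
      MvPowerSeries (Fin n) ℂ) * MvPowerSeries.X k) 1]
  refine Finset.prod_congr rfl fun k _ => ?_
  rw [cauchyFactor, Equiv.symm_apply_apply]

lemma coeff_boundaryValue (j : Fin n →₀ ℕ) : MvPowerSeries.coeff j (boundaryValue n) =
    if ∀ k, 1 ≤ j k then (n ! : ℂ)⁻¹ • ∑ σ : Equiv.Perm (Fin n), ∏ k,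
      (MvPowerSeries.X k : MvPowerSeries (Fin n) ℂ) ^ (j (σ k) - 1) else 0 := by
  rw [boundaryValue_eq, coeff_prod_X_mul]
  refine if_congr Iff.rfl ?_ rfl
  rw [coeff_smul_algebra, map_sum]
  congr 1
  refine Finset.sum_congr rfl fun σ _ => ?_
  rw [coeff_geomProd, if_pos fun k hk => absurd (Finset.mem_univ k) hk, ← Equiv.prod_comp σ]
  refine Finset.prod_congr rfl fun k _ => ?_
  rw [Equiv.symm_apply_apply]
  rfl

lemma coeff_coeff_boundaryValue {j : Fin n →₀ ℕ} (hj : ∀ k, 1 ≤ j k) (b : Fin n →₀ ℕ) :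
    MvPowerSeries.coeff b (MvPowerSeries.coeff j (boundaryValue n)) =
      symSingle b (fun k => j k - 1) := by
  rw [coeff_boundaryValue, if_pos hj, map_smul, map_sum, symSingle, Finsupp.smul_apply,
    Finsupp.finsetSum_apply, ← Equiv.sum_comp (Equiv.inv (Equiv.Perm (Fin n)))]
  congr 1
  refine Finset.sum_congr rfl fun σ _ => ?_
  set c : Fin n →₀ ℕ := Finsupp.equivFunOnFinite.symm fun k => j (σ.symm k) - 1 with hc
  have h1 : ∏ k, (MvPowerSeries.X k : MvPowerSeries (Fin n) ℂ) ^ (j (σ.symm k) - 1) =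
      MvPowerSeries.monomial c 1 := by
    rw [MvPowerSeries.monomial_one_eq, Finsupp.prod_fintype _ _ fun _ => pow_zero _]
    rfl
  change MvPowerSeries.coeff b (∏ k, (MvPowerSeries.X k : MvPowerSeries (Fin n) ℂ) ^
    (j (σ.symm k) - 1)) = _
  rw [h1, MvPowerSeries.coeff_monomial, Finsupp.single_apply]
  refine if_congr ?_ rfl rfl
  constructor
  · intro h
    funext k
    rw [Function.comp_apply, h, hc]
    simp
  · intro h
    ext k
    have := congrFun h (σ.symm k)
    rw [Function.comp_apply, Equiv.apply_symm_apply] at this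
    exact this

lemma coeff_kernel (C : (Fin (n + 1) → ℕ) → (Fin n → ℕ) → ℂ) (j : Fin n →₀ ℕ) :
    MvPowerSeries.coeff j (kernel C) = if ∀ k, 1 ≤ j k then
      (fun i : Fin (n + 1) →₀ ℕ => C i (fun k => j k - 1)) else 0 := by
  exact coeff_prod_X_mul _ j

variable {t : Fin n → ℂ} {s : Fin (n + 2) → ℂ} {r₁ r₂ : ℂ}
  {g : MvPolynomial (Fin n) ℂ →ₗ[ℂ] ((Fin n → ℕ) →₀ ℂ)}

lemma coeff_kernel_eq_mapCoeff (p : ℕ → MvPolynomial (Fin n) ℂ) {j : Fin n →₀ ℕ}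
    (hj : ∀ k, 1 ≤ j k) :
    MvPowerSeries.coeff j (kernel fun i => ⇑(g (∏ k, p (i k)))) =
      mapCoeff ((Finsupp.lapply fun k => j k - 1) ∘ₗ g) (n + 1) (prodSeries (n + 1) p) := by
  rw [coeff_kernel, if_pos hj]
  rfl

lemma kernelOp_coeff_kernel (ht₀ : ∀ i, t i ≠ 0) (hs₁ : ∀ m : ℕ, s 0 ≠ -(m : ℂ))
    (j : Fin n →₀ ℕ) :
    kernelOp t s r₁ r₂ (MvPowerSeries.coeff j
      (kernel fun i => ⇑(g (∏ k, solPoly t s r₁ r₂ (i k))))) = 0 := by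
  by_cases hj : ∀ k, 1 ≤ j k
  · rw [coeff_kernel_eq_mapCoeff _ hj, ← mapCoeff_kernelOp, solPoly,
      kernelOp_prodSeries r₁ r₂ ht₀ hs₁, map_zero]
  · rw [coeff_kernel, if_neg hj]
    exact map_zero (kernelOpLin t s r₁ r₂)

lemma renameEquiv_coeff_kernel (p : ℕ → MvPolynomial (Fin n) ℂ) (j : Fin n →₀ ℕ)
    (σ : Equiv.Perm (Fin (n + 1))) :
    MvPowerSeries.renameEquiv ℂ σ (MvPowerSeries.coeff j
      (kernel fun i => ⇑(g (∏ k, p (i k))))) =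
      MvPowerSeries.coeff j (kernel fun i => ⇑(g (∏ k, p (i k)))) := by
  by_cases hj : ∀ k, 1 ≤ j k
  · rw [coeff_kernel_eq_mapCoeff _ hj]
    ext a
    obtain ⟨b, rfl⟩ : ∃ b, a = Finsupp.embDomain σ.toEmbedding b :=
      ⟨Finsupp.equivMapDomain σ.symm a, by
        ext k
        obtain ⟨l, rfl⟩ := σ.surjective k
        have := Finsupp.embDomain_apply_self σ.toEmbedding (Finsupp.equivMapDomain σ.symm a) l
        rw [Equiv.coe_toEmbedding] at this
        rw [this]
        simp⟩
    have h1 := MvPowerSeries.coeff_embDomain_rename σ.toEmbedding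
      (mapCoeff ((Finsupp.lapply fun k => j k - 1) ∘ₗ g) (n + 1) (prodSeries (n + 1) p)) b
    refine h1.trans ?_
    rw [coeff_mapCoeff, coeff_mapCoeff, coeff_prodSeries, coeff_prodSeries,
      ← Equiv.prod_comp σ fun k => p (Finsupp.embDomain σ.toEmbedding b k)]
    congr 1
    refine Finset.prod_congr rfl fun k _ => ?_
    have := Finsupp.embDomain_apply_self σ.toEmbedding b k
    rw [Equiv.coe_toEmbedding] at this
    rw [this]
  · rw [coeff_kernel, if_neg hj]
    exact map_zero (MvPowerSeries.renameEquiv ℂ σ)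

/-- Setting xₙ₊₁ = 0 keeps the products with last factor p₀ = 1. These are already products of n
factors, so their expansion is the symmetrized indicator, which is also the coefficient of the
symmetrized Cauchy product. -/
lemma restrictLast_coeff_kernel {p : ℕ → MvPolynomial (Fin n) ℂ} (hp : p 0 = 1)
    (hg : ∀ b : Fin n → ℕ, g (∏ k, p (b k)) = symSingle b) (j : Fin n →₀ ℕ) :
    restrictLast n (MvPowerSeries.coeff j (kernel fun i => ⇑(g (∏ k, p (i k))))) =
      MvPowerSeries.coeff j (boundaryValue n) := by
  by_cases hj : ∀ k, 1 ≤ j k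
  · rw [coeff_kernel_eq_mapCoeff _ hj]
    ext b
    rw [coeff_coeff_boundaryValue hj, restrictLast, MvPowerSeries.coeff_killCompl, coeff_mapCoeff,
      coeff_prodSeries, ← hg, Fin.prod_univ_castSucc]
    have h1 : Finsupp.embDomain (Fin.last n).succAboveEmb b (Fin.last n) = 0 := by
      refine Finsupp.embDomain_of_notMem_range _ _ _ ?_
      rintro ⟨k, hk⟩
      exact Fin.succAbove_ne _ _ hk
    have h2 : ∀ k : Fin n, Finsupp.embDomain (Fin.last n).succAboveEmb b k.castSucc = b k := by
      intro k
      have := Finsupp.embDomain_apply_self (Fin.last n).succAboveEmb b k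
      rwa [Fin.coe_succAboveEmb, Fin.succAbove_last] at this
    rw [h1, hp, mul_one]
    simp only [h2]
    rfl
  · rw [coeff_kernel, coeff_boundaryValue, if_neg hj, if_neg hj]
    exact map_zero (restrictLast n)

end Coefficients

/-! ### The restriction to the hyperplane where the coordinates sum to `-1` -/

section Simplex

variable {N : ℕ}

/-- The affine form `1 + ∑ₐ Xₐ`. -/
def hyperplaneForm (N : ℕ) : MvPolynomial (Fin N) ℂ := 1 + ∑ a, MvPolynomial.X a

/-- `E² - E + σ E + ∑ₐ (Xₐ ∂ₐ² + cₐ ∂ₐ)` where `E` is the Euler operator and `σ` is the sum of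
the `cₐ`. -/
def simplexOp (c : Fin N → ℂ) (h : MvPolynomial (Fin N) ℂ) : MvPolynomial (Fin N) ℂ :=
  eulerOp (eulerOp h) - eulerOp h + MvPolynomial.C (∑ a, c a) * eulerOp h + laplaceOp c h

lemma simplexOp_add (c : Fin N → ℂ) (g h : MvPolynomial (Fin N) ℂ) :
    simplexOp c (g + h) = simplexOp c g + simplexOp c h := by
  simp only [simplexOp, eulerOp_add, laplaceOp_add]
  ring

lemma simplexOp_C_mul (c : Fin N → ℂ) (x : ℂ) (h : MvPolynomial (Fin N) ℂ) :
    simplexOp c (MvPolynomial.C x * h) = MvPolynomial.C x * simplexOp c h := by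
  simp only [simplexOp, eulerOp_mul, eulerOp_C, laplaceOp_mul, laplaceOp_C, MvPolynomial.pderiv_C,
    zero_mul, mul_zero, Finset.sum_const_zero, zero_add, add_zero]
  ring

lemma eulerOp_sum {ι : Type*} (S : Finset ι) (f : ι → MvPolynomial (Fin N) ℂ) :
    eulerOp (∑ i ∈ S, f i) = ∑ i ∈ S, eulerOp (f i) := by
  simp only [eulerOp, map_sum, Finset.mul_sum]
  exact Finset.sum_comm

lemma eulerOp_hyperplaneForm : eulerOp (hyperplaneForm N) = hyperplaneForm N - 1 := by
  rw [hyperplaneForm, eulerOp_add, eulerOp_sum, ← MvPolynomial.C_1, eulerOp_C]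
  simp only [eulerOp_X]
  ring

lemma pderiv_hyperplaneForm (a : Fin N) : MvPolynomial.pderiv a (hyperplaneForm N) = 1 := by
  rw [hyperplaneForm, map_add, MvPolynomial.pderiv_one, map_sum, Finset.sum_eq_single a]
  · rw [MvPolynomial.pderiv_X_self, zero_add]
  · intro b _ hb
    exact MvPolynomial.pderiv_X_of_ne hb
  · simp

lemma laplaceOp_hyperplaneForm_mul (c : Fin N → ℂ) (R : MvPolynomial (Fin N) ℂ) :
    laplaceOp c (hyperplaneForm N * R) = hyperplaneForm N * laplaceOp c R +
      MvPolynomial.C (∑ a, c a) * R + 2 * eulerOp R := by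
  rw [laplaceOp_mul]
  have h1 : laplaceOp c (hyperplaneForm N) = MvPolynomial.C (∑ a, c a) := by
    simp only [laplaceOp, pderiv_hyperplaneForm, MvPolynomial.pderiv_one, mul_zero, mul_one,
      zero_add, map_sum]
  simp only [h1, pderiv_hyperplaneForm, one_mul, eulerOp]
  ring

/-- The operator descends to the hyperplane because its Euler coefficient is the sum of the cₐ: the
terms σR and 2E(R) from the Laplacian cancel those from E applied to 1 + ∑ Xₐ. -/
lemma simplexOp_hyperplaneForm_mul (c : Fin N → ℂ) (R : MvPolynomial (Fin N) ℂ) :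
    hyperplaneForm N ∣ simplexOp c (hyperplaneForm N * R) := by
  refine ⟨simplexOp c R + 2 * eulerOp R + MvPolynomial.C (∑ a, c a) * R, ?_⟩
  rw [simplexOp, simplexOp, laplaceOp_hyperplaneForm_mul, eulerOp_mul, eulerOp_hyperplaneForm,
    eulerOp_add, eulerOp_mul, eulerOp_mul, sub_eq_add_neg (hyperplaneForm N) 1, eulerOp_add,
    eulerOp_hyperplaneForm, ← MvPolynomial.C_1, ← MvPolynomial.C_neg, eulerOp_C]
  simp only [MvPolynomial.C_neg, MvPolynomial.C_1]
  ring

/-- Independence of eigenvectors with distinct eigenvalues, applied modulo the hyperplane form. -/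
lemma dvd_of_dvd_sum_of_simplexOp (c : Fin N → ℂ) (μ : ℕ → ℂ) (hμ : Function.Injective μ)
    (D : Finset ℕ) (h : ℕ → MvPolynomial (Fin N) ℂ)
    (hh : ∀ d, simplexOp c (h d) = MvPolynomial.C (μ d) * h d)
    (hsum : hyperplaneForm N ∣ ∑ d ∈ D, h d) : ∀ d ∈ D, hyperplaneForm N ∣ h d := by
  induction D using Finset.induction_on generalizing h with
  | empty => simp
  | insert e D he ih =>
    have hop : simplexOp c (∑ d ∈ insert e D, h d) =
        ∑ d ∈ insert e D, MvPolynomial.C (μ d) * h d := by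
      have : ∀ S : Finset ℕ, simplexOp c (∑ d ∈ S, h d) =
          ∑ d ∈ S, MvPolynomial.C (μ d) * h d := by
        intro S
        induction S using Finset.induction_on with
        | empty =>
          have := simplexOp_C_mul c 0 0
          rwa [MvPolynomial.C_0, zero_mul, zero_mul] at this
        | insert d S hd ih => rw [Finset.sum_insert hd, Finset.sum_insert hd, simplexOp_add, ih, hh]
      exact this _
    -- Applying the operator minus μ e removes the summand e and scales the others by nonzero
    -- constants.
    have h1 : hyperplaneForm N ∣ ∑ d ∈ D, MvPolynomial.C (μ d - μ e) * h d := by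
      have h2 : hyperplaneForm N ∣ simplexOp c (∑ d ∈ insert e D, h d) := by
        obtain ⟨R, hR⟩ := hsum
        rw [hR]
        exact simplexOp_hyperplaneForm_mul c R
      have h3 := dvd_sub h2 (hsum.mul_left (MvPolynomial.C (μ e)))
      rw [hop, Finset.sum_insert he, Finset.sum_insert he, mul_add, add_sub_add_left_eq_sub,
        Finset.mul_sum, ← Finset.sum_sub_distrib] at h3
      simpa only [MvPolynomial.C_sub, sub_mul] using h3
    have h4 := ih (fun d => MvPolynomial.C (μ d - μ e) * h d) (fun d => by
      rw [simplexOp_C_mul, hh]; ring) h1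
    have h5 : ∀ d ∈ D, hyperplaneForm N ∣ h d := by
      intro d hd
      have hne : μ d - μ e ≠ 0 := sub_ne_zero.mpr fun h => he (hμ h ▸ hd)
      exact (((IsUnit.mk0 _ hne).map MvPolynomial.C).dvd_mul_left).mp (h4 d hd)
    intro d hd
    rcases Finset.mem_insert.mp hd with rfl | hd
    · rw [Finset.sum_insert he] at hsum
      exact (dvd_add_left (Finset.dvd_sum h5)).mp hsum
    · exact h5 d hd

end Simplex

/-! ### Harmonic polynomials restricted to the hyperplane form a basis -/

section Independence

variable {n : ℕ} {s : Fin (n + 2) → ℂ}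

lemma simplexOp_homPoly (hs₃ : ∀ (k : Fin n) (m : ℕ), s k.succ.succ ≠ -(m : ℂ))
    (i : Fin n → ℕ) : simplexOp (fun a => s a.succ) (homPoly s i) =
      MvPolynomial.C (((∑ k, i k : ℕ) : ℂ) *
        (((∑ k, i k : ℕ) : ℂ) - 1 + ∑ a : Fin (n + 1), s a.succ)) * homPoly s i := by
  rw [simplexOp, laplaceOp_homPoly hs₃, eulerOp_homPoly, eulerOp_mul, eulerOp_C, eulerOp_homPoly]
  push_cast
  simp only [map_mul, map_add, map_sub, map_one]
  ring

/-- Two eigenvalues differ by (d - e)(d + e - 1 + c), where d + e ≥ 1 as soon as d ≠ e. -/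
lemma injective_eigenvalue {c : ℂ} (hc : ∀ m : ℕ, c ≠ -(m : ℂ)) :
    Function.Injective fun d : ℕ => (d : ℂ) * (d - 1 + c) := by
  intro d e h
  by_contra hne
  beta_reduce at h
  have h1 : ((d : ℂ) - e) * (d + e - 1 + c) = 0 := by linear_combination h
  have h2 := (mul_eq_zero.mp h1).resolve_left
    (sub_ne_zero.mpr fun h => hne (Nat.cast_injective h))
  have h3 : 1 ≤ d + e := by omega
  refine hc (d + e - 1) ?_
  push_cast [Nat.cast_sub h3]
  linear_combination h2

lemma eval_homPoly_smul (i : Fin n → ℕ) (x : Fin (n + 1) → ℂ) (c : ℂ) :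
    MvPolynomial.aeval (fun a => c * x a) (homPoly s i) =
      c ^ (∑ k, i k) * MvPolynomial.aeval x (homPoly s i) := by
  rw [aeval_homPoly, aeval_homPoly, Finset.mul_sum]
  refine Finset.sum_congr rfl fun j hj => ?_
  have hle : ∑ k, j k ≤ ∑ k, i k := Finset.sum_le_sum fun k _ => Finset.mem_Iic.mp hj k
  have h1 : ∏ k : Fin n, (-(c * x k.succ)) ^ j k = c ^ (∑ k, j k) * ∏ k : Fin n, (-x k.succ) ^ j k := by
    rw [← Finset.prod_pow_eq_pow_sum, ← Finset.prod_mul_distrib]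
    refine Finset.prod_congr rfl fun k _ => ?_
    rw [← mul_pow]
    ring
  rw [h1, mul_pow, smul_eq_mul, smul_eq_mul, ← Nat.sub_add_cancel hle, pow_add,
    Nat.sub_add_cancel hle]
  ring

/-- A homogeneous polynomial vanishing on the hyperplane vanishes at every point with nonzero
coordinate sum, since such a point can be rescaled into the hyperplane. -/
lemma eq_zero_of_hyperplaneForm_dvd {S : Finset (Fin n → ℕ)} {d : ℕ}
    (hS : ∀ i ∈ S, ∑ k, i k = d) (q : (Fin n → ℕ) → ℂ)
    (h : hyperplaneForm (n + 1) ∣ ∑ i ∈ S, q i • homPoly s i) :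
    ∑ i ∈ S, q i • homPoly s i = 0 := by
  set G := ∑ i ∈ S, q i • homPoly s i with hG
  have hscale : ∀ (c : ℂ) (x : Fin (n + 1) → ℂ),
      MvPolynomial.aeval (fun a => c * x a) G = c ^ d * MvPolynomial.aeval x G := by
    intro c x
    rw [hG, map_sum, map_sum, Finset.mul_sum]
    refine Finset.sum_congr rfl fun i hi => ?_
    rw [map_smul, map_smul, eval_homPoly_smul, hS i hi, mul_smul_comm]
  obtain ⟨R, hR⟩ := h
  -- The extra factor handles the points with coordinate sum zero.
  have h1 : (∑ a : Fin (n + 1), MvPolynomial.X a) * G = 0 := by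
    refine MvPolynomial.funext fun x => ?_
    rw [map_zero, map_mul]
    by_cases hx : ∑ a, x a = 0
    · rw [map_sum]
      simp only [MvPolynomial.eval_X, hx, zero_mul]
    · have h2 := hscale (-(∑ a, x a)⁻¹) x
      have h3 : MvPolynomial.aeval (fun a => -(∑ a, x a)⁻¹ * x a) (hyperplaneForm (n + 1)) =
          (0 : ℂ) := by
        rw [hyperplaneForm, map_add, map_one, map_sum]
        simp only [MvPolynomial.aeval_X]
        rw [← Finset.mul_sum, neg_mul, inv_mul_cancel₀ hx, add_neg_cancel]
      rw [hR, map_mul, h3, zero_mul, ← hR] at h2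
      have h4 := (mul_eq_zero.mp h2.symm).resolve_left
        (pow_ne_zero _ (neg_ne_zero.mpr (inv_ne_zero hx)))
      rw [MvPolynomial.aeval_eq_eval] at h4
      change _ * MvPolynomial.eval x G = 0
      rw [show MvPolynomial.eval x G = 0 from h4, mul_zero]
  refine (mul_eq_zero.mp h1).resolve_left fun h5 => ?_
  have h6 := congrArg (MvPolynomial.eval (Pi.single 0 1 : Fin (n + 1) → ℂ)) h5
  rw [map_sum, map_zero] at h6
  simp only [MvPolynomial.eval_X, Finset.sum_pi_single', Finset.mem_univ, if_true] at h6
  exact one_ne_zero h6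

lemma pCoeff_self_ne_zero (hs₂ : ∀ m : ℕ, s 1 ≠ -(m : ℂ))
    (hs₃ : ∀ (k : Fin n) (m : ℕ), s k.succ.succ ≠ -(m : ℂ)) (i : Fin n → ℕ) :
    pCoeff s i i ≠ 0 := by
  refine div_ne_zero (mul_ne_zero ?_ ?_) (mul_ne_zero ?_ ?_)
  · refine Finset.prod_ne_zero_iff.mpr fun l hl h => hs₂ (∑ k, i k - l) ?_
    rw [Nat.cast_sub (Finset.mem_Icc.mp hl).2]
    push_cast
    linear_combination h
  · refine Finset.prod_ne_zero_iff.mpr fun k _ => Finset.prod_ne_zero_iff.mpr fun l hl h => ?_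
    have h1 := (Finset.mem_Icc.mp hl).2
    have h2 : ((i k - l + 1 : ℕ) : ℂ) = 0 := by
      rw [← h]
      push_cast [Nat.cast_sub h1]
      ring
    exact Nat.succ_ne_zero _ (Nat.cast_eq_zero.mp h2)
  · refine Finset.prod_ne_zero_iff.mpr fun k _ => Finset.prod_ne_zero_iff.mpr fun l hl h =>
      hs₃ k (l - 1) ?_
    rw [Nat.cast_sub (Finset.mem_Icc.mp hl).1]
    push_cast
    linear_combination h
  · exact Finset.prod_ne_zero_iff.mpr fun k _ => Nat.cast_ne_zero.mpr (Nat.factorial_ne_zero _)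

lemma linearIndependent_homPoly (hs₂ : n = 1 ∨ ∀ m : ℕ, s 1 ≠ -(m : ℂ))
    (hs₃ : ∀ (k : Fin n) (m : ℕ), s k.succ.succ ≠ -(m : ℂ)) :
    LinearIndependent ℂ (homPoly s) := by
  rw [linearIndependent_iff']
  intro S q hq i hi
  obtain ⟨m, hm, hm'⟩ : ∃ m : Fin (n + 1) →₀ ℕ, MvPolynomial.coeff m (homPoly s i) ≠ 0 ∧
      ∀ i', i' ≠ i → MvPolynomial.coeff m (homPoly s i') = 0 := by
    rcases hs₂ with rfl | hs₂
    -- For n = 1 the degree determines i, and the pure power of the first variable has coefficient 1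
    -- whatever s₂ is.
    · refine ⟨Finsupp.equivFunOnFinite.symm (Fin.cons (∑ k, i k) 0), ?_, fun i' hi' => ?_⟩
      · rw [coeff_homPoly, if_pos]
        · simp [pCoeff]
        · rw [Fin.sum_univ_succ]
          simp
      · rw [coeff_homPoly, if_neg]
        intro h
        apply hi'
        rw [Fin.sum_univ_succ] at h
        funext k
        rw [Subsingleton.elim k 0]
        simpa using h.symm
    -- This monomial occurs in the polynomial of i' only if |i'| = |i| and i ≤ i', hence only for i'
    -- = i. Its coefficient there is nonzero by the hypothesis on s₂.
    · refine ⟨Finsupp.equivFunOnFinite.symm (Fin.cons 0 i), ?_, fun i' hi' => ?_⟩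
      · rw [coeff_homPoly, if_pos]
        · refine mul_ne_zero (pow_ne_zero _ (by norm_num)) ?_
          exact pCoeff_self_ne_zero hs₂ hs₃ i
        · rw [Fin.sum_univ_succ]
          simp
      · rw [coeff_homPoly]
        split_ifs with h
        · rw [Fin.sum_univ_succ] at h
          simp only [Finsupp.equivFunOnFinite_symm_apply_apply, Fin.cons_zero, Fin.cons_succ,
            zero_add] at h
          change _ * pCoeff s i' i = 0
          rw [pCoeff_eq_zero, mul_zero]
          intro hle
          refine hi' (funext fun k => ?_)
          exact ((Finset.sum_eq_sum_iff_of_le fun k _ => hle k).mp h k (Finset.mem_univ k)).symm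
        · rfl
  have h1 := congrArg (MvPolynomial.coeff m) hq
  rw [MvPolynomial.coeff_sum, Finset.sum_eq_single i, MvPolynomial.coeff_smul, smul_eq_mul,
    MvPolynomial.coeff_zero] at h1
  · exact (mul_eq_zero.mp h1).resolve_right hm
  · intro i' _ hne
    rw [MvPolynomial.coeff_smul, hm' i' hne, smul_zero]
  · exact fun h => absurd hi h

/-- The coordinates `-1 - X₁ - ⋯ - Xₙ, X₁, …, Xₙ` on the hyperplane. -/
def hyperplaneCoord (n : ℕ) : Fin (n + 1) → MvPolynomial (Fin n) ℂ :=
  Fin.cons (-1 - ∑ k, MvPolynomial.X k) MvPolynomial.X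

/-- Modulo the hyperplane form the first variable equals -1 minus the others, so the quotient map
factors through this elimination. -/
lemma hyperplaneForm_dvd_of_aeval_eq_zero {h : MvPolynomial (Fin (n + 1)) ℂ}
    (hh : MvPolynomial.aeval (hyperplaneCoord n) h = 0) : hyperplaneForm (n + 1) ∣ h := by
  set I : Ideal (MvPolynomial (Fin (n + 1)) ℂ) := Ideal.span {hyperplaneForm (n + 1)} with hI
  have h1 : Ideal.Quotient.mkₐ ℂ I = ((Ideal.Quotient.mkₐ ℂ I).comp
      (MvPolynomial.aeval fun k : Fin n => MvPolynomial.X k.succ)).comp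
        (MvPolynomial.aeval (hyperplaneCoord n)) := by
    refine MvPolynomial.algHom_ext fun a => ?_
    refine Fin.cases ?_ (fun k => ?_) a
    · rw [AlgHom.comp_apply, AlgHom.comp_apply, MvPolynomial.aeval_X, hyperplaneCoord,
        Fin.cons_zero, map_sub, map_neg, map_one, map_sum]
      simp only [MvPolynomial.aeval_X]
      rw [Ideal.Quotient.mkₐ_eq_mk, Ideal.Quotient.mk_eq_mk_iff_sub_mem, hI,
        Ideal.mem_span_singleton, hyperplaneForm, Fin.sum_univ_succ]
      exact dvd_of_eq (by ring)
    · rw [AlgHom.comp_apply, AlgHom.comp_apply, MvPolynomial.aeval_X, hyperplaneCoord,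
        Fin.cons_succ, MvPolynomial.aeval_X]
  have h2 := AlgHom.congr_fun h1 h
  rw [AlgHom.comp_apply, hh, map_zero, Ideal.Quotient.mkₐ_eq_mk, Ideal.Quotient.eq_zero_iff_mem,
    hI, Ideal.mem_span_singleton] at h2
  exact h2

/-- The restriction of `homPoly` to the hyperplane. -/
def hyperplanePoly (s : Fin (n + 2) → ℂ) (i : Fin n → ℕ) : MvPolynomial (Fin n) ℂ :=
  MvPolynomial.aeval (hyperplaneCoord n) (homPoly s i)

lemma linearIndependent_hyperplanePoly (hs₂ : n = 1 ∨ ∀ m : ℕ, s 1 ≠ -(m : ℂ))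
    (hs₃ : ∀ (k : Fin n) (m : ℕ), s k.succ.succ ≠ -(m : ℂ))
    (hσ : ∀ m : ℕ, ∑ k : Fin (n + 1), s k.succ ≠ -(m : ℂ)) :
    LinearIndependent ℂ (hyperplanePoly s) := by
  rw [linearIndependent_iff']
  intro S q hq
  have h1 : hyperplaneForm (n + 1) ∣ ∑ i ∈ S, q i • homPoly s i := by
    refine hyperplaneForm_dvd_of_aeval_eq_zero ?_
    rw [map_sum, ← hq]
    exact Finset.sum_congr rfl fun i _ => map_smul _ _ _
  set h : ℕ → MvPolynomial (Fin (n + 1)) ℂ :=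
    fun d => ∑ i ∈ S with ∑ k, i k = d, q i • homPoly s i with hh
  have h2 : ∑ d ∈ S.image (fun i => ∑ k, i k), h d = ∑ i ∈ S, q i • homPoly s i :=
    Finset.sum_fiberwise_of_maps_to (fun i hi => Finset.mem_image_of_mem _ hi) _
  have h3 : ∀ d, simplexOp (fun a => s a.succ) (h d) = MvPolynomial.C
      ((d : ℂ) * (d - 1 + ∑ a : Fin (n + 1), s a.succ)) * h d := by
    intro d
    have : ∀ T : Finset (Fin n → ℕ), (∀ i ∈ T, ∑ k, i k = d) →
        simplexOp (fun a => s a.succ) (∑ i ∈ T, q i • homPoly s i) = MvPolynomial.C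
          ((d : ℂ) * (d - 1 + ∑ a : Fin (n + 1), s a.succ)) * ∑ i ∈ T, q i • homPoly s i := by
      intro T hT
      induction T using Finset.induction_on with
      | empty =>
        have := simplexOp_C_mul (fun a : Fin (n + 1) => s a.succ) 0 0
        rw [MvPolynomial.C_0, zero_mul, zero_mul] at this
        rw [Finset.sum_empty, this, mul_zero]
      | insert i T hi ih =>
        rw [Finset.sum_insert hi, simplexOp_add, ih fun j hj => hT j (Finset.mem_insert_of_mem hj),
          MvPolynomial.smul_eq_C_mul, simplexOp_C_mul, simplexOp_homPoly hs₃,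
          hT i (Finset.mem_insert_self _ _)]
        ring
    exact this _ fun i hi => (Finset.mem_filter.mp hi).2
  have h4 := dvd_of_dvd_sum_of_simplexOp _ _ (injective_eigenvalue hσ) _ h h3 (h2 ▸ h1)
  have h5 : ∑ i ∈ S, q i • homPoly s i = 0 := by
    rw [← h2]
    refine Finset.sum_eq_zero fun d hd => ?_
    exact eq_zero_of_hyperplaneForm_dvd (fun i hi => (Finset.mem_filter.mp hi).2) q (h4 d hd)
  exact linearIndependent_iff'.mp (linearIndependent_homPoly hs₂ hs₃) S q h5

lemma totalDegree_hyperplanePoly_le (i : Fin n → ℕ) :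
    (hyperplanePoly s i).totalDegree ≤ ∑ k, i k := by
  rw [hyperplanePoly, aeval_homPoly]
  refine MvPolynomial.totalDegree_finsetSum_le fun j hj => ?_
  refine (MvPolynomial.totalDegree_smul_le _ _).trans ((MvPolynomial.totalDegree_mul _ _).trans ?_)
  have hle : ∑ k, j k ≤ ∑ k, i k := Finset.sum_le_sum fun k _ => Finset.mem_Iic.mp hj k
  have h0 : (hyperplaneCoord n 0).totalDegree ≤ 1 := by
    rw [hyperplaneCoord, Fin.cons_zero]
    refine (MvPolynomial.totalDegree_sub _ _).trans (max_le ?_ ?_)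
    · rw [MvPolynomial.totalDegree_neg, MvPolynomial.totalDegree_one]
      exact Nat.zero_le _
    · exact MvPolynomial.totalDegree_finsetSum_le fun k _ => (MvPolynomial.totalDegree_X k).le
  have h1 : (hyperplaneCoord n 0 ^ (∑ k, i k - ∑ k, j k)).totalDegree ≤
      ∑ k, i k - ∑ k, j k :=
    (MvPolynomial.totalDegree_pow _ _).trans ((Nat.mul_le_mul_left _ h0).trans (mul_one _).le)
  have h2 : (∏ k : Fin n, (-hyperplaneCoord n k.succ) ^ j k).totalDegree ≤ ∑ k, j k := by
    refine (MvPolynomial.totalDegree_finsetProd _ _).trans (Finset.sum_le_sum fun k _ => ?_)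
    refine (MvPolynomial.totalDegree_pow _ _).trans ?_
    rw [MvPolynomial.totalDegree_neg, hyperplaneCoord, Fin.cons_succ, MvPolynomial.totalDegree_X,
      mul_one]
  omega

/-- The restrictions have degree at most |i|, are independent, and are indexed like the monomials,
so in each degree bound they fill the whole space. -/
lemma span_hyperplanePoly (hs₂ : n = 1 ∨ ∀ m : ℕ, s 1 ≠ -(m : ℂ))
    (hs₃ : ∀ (k : Fin n) (m : ℕ), s k.succ.succ ≠ -(m : ℂ))
    (hσ : ∀ m : ℕ, ∑ k : Fin (n + 1), s k.succ ≠ -(m : ℂ)) :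
    Submodule.span ℂ (Set.range (hyperplanePoly s)) = ⊤ := by
  set e : (Fin n → ℕ) → MvPolynomial (Fin n) ℂ :=
    fun i => MvPolynomial.monomial (Finsupp.equivFunOnFinite.symm i) 1 with he
  have heli : LinearIndependent ℂ e := by
    have h1 := (MvPolynomial.basisMonomials (Fin n) ℂ).linearIndependent
    rw [MvPolynomial.coe_basisMonomials] at h1
    exact h1.comp _ Finsupp.equivFunOnFinite.symm.injective
  have hea : ∀ a : Fin n →₀ ℕ, e a = MvPolynomial.monomial a 1 := fun a => by
    rw [he]
    beta_reduce
    rw [Finsupp.equivFunOnFinite_symm_coe]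
  have hfin : ∀ N, {i : Fin n → ℕ | ∑ k, i k ≤ N}.Finite := by
    intro N
    refine Set.Finite.subset (Set.finite_Iic (fun _ : Fin n => N)) ?_
    intro i hi k
    exact (Finset.single_le_sum (f := i) (fun _ _ => Nat.zero_le _) (Finset.mem_univ k)).trans hi
  have h2 := mem_span_le_of_linearIndependent (fun i : Fin n → ℕ => ∑ k, i k) hfin heli
    (linearIndependent_hyperplanePoly hs₂ hs₃ hσ) fun i => by
      rw [MvPolynomial.as_sum (hyperplanePoly s i)]
      refine Submodule.sum_mem _ fun a ha => ?_
      have h3 : MvPolynomial.monomial a (MvPolynomial.coeff a (hyperplanePoly s i)) =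
          MvPolynomial.coeff a (hyperplanePoly s i) • e a := by
        rw [hea, MvPolynomial.smul_monomial, smul_eq_mul, mul_one]
      rw [h3]
      refine Submodule.smul_mem _ _ (Submodule.subset_span ⟨a, ?_, rfl⟩)
      have h4 := (MvPolynomial.le_totalDegree ha).trans (totalDegree_hyperplanePoly_le i)
      rwa [Finsupp.sum_fintype _ _ fun _ => rfl] at h4
  rw [eq_top_iff, ← (MvPolynomial.basisMonomials (Fin n) ℂ).span_eq, Submodule.span_le]
  rintro _ ⟨a, rfl⟩
  have h5 := h2 a
  rw [hea] at h5
  rw [MvPolynomial.coe_basisMonomials]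
  exact Submodule.span_mono (Set.image_subset_range _ _) h5

end Independence

/-! ### Generators of the algebra of symmetric polynomials -/

/-- The kernels of the iterates stabilize, say at fᵐ. An element of ker f has the form fᵐ(b), so b
lies in ker fᵐ⁺¹ = ker fᵐ and the element is zero. This replaces a direct proof that the uₖ are
algebraically independent. -/
lemma injective_of_surjective_ringHom {R : Type*} [CommRing R] [IsNoetherianRing R] (f : R →+* R)
    (hf : Function.Surjective f) : Function.Injective f := by
  let K : ℕ →o Ideal R :=
    ⟨fun m => RingHom.ker (f ^ m), monotone_nat_of_le_succ fun m a ha => by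
      rw [RingHom.mem_ker] at ha ⊢
      rw [pow_succ', RingHom.mul_def, RingHom.comp_apply, ha, map_zero]⟩
  obtain ⟨m, hm⟩ := monotone_stabilizes_iff_noetherian.mpr ‹IsNoetherianRing R› K
  rw [injective_iff_map_eq_zero]
  intro a ha
  have hsurj : Function.Surjective (f ^ m : R →+* R) := by
    rw [RingHom.coe_pow]
    exact hf.iterate m
  obtain ⟨b, rfl⟩ := hsurj a
  have h1 : b ∈ K (m + 1) := by
    change b ∈ RingHom.ker (f ^ (m + 1))
    rw [RingHom.mem_ker, pow_succ', RingHom.mul_def, RingHom.comp_apply, ha]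
  rw [← hm (m + 1) (Nat.le_succ m)] at h1
  exact h1

section Symmetric

variable {n : ℕ} {t : Fin n → ℂ}

/-- The polynomial `∏ₗ (xₗ - a)`. -/
def symNode (n : ℕ) (a : ℂ) : MvPolynomial (Fin n) ℂ :=
  ∏ l, (MvPolynomial.X l - MvPolynomial.C a)

/-- The products ∏(x_l - tₖ) are combinations of the elementary symmetric polynomials with
Vandermonde coefficients, and the tₖ are distinct, so the system can be inverted. -/
lemma esymm_mem_of_symNode_mem (ht : Function.Injective t)
    (S : Subalgebra ℂ (MvPolynomial (Fin n) ℂ)) (hS : ∀ k, symNode n (t k) ∈ S) (j : Fin n) :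
    MvPolynomial.esymm (Fin n) ℂ (j + 1) ∈ S := by
  set q : Polynomial (MvPolynomial (Fin n) ℂ) :=
    ∏ i : Fin n, (Polynomial.X + Polynomial.C (MvPolynomial.X i)) with hq
  have hmonic : q.Monic := Polynomial.monic_prod_of_monic _ _ fun i _ => Polynomial.monic_X_add_C _
  have hdeg : q.natDegree = n := by
    rw [hq, Polynomial.natDegree_prod_of_monic _ _ fun i _ => Polynomial.monic_X_add_C _]
    simp
  have hval : ∀ k, symNode n (t k) = ∑ m : Fin n,
      MvPolynomial.C ((-t k) ^ (m : ℕ)) * q.coeff m + MvPolynomial.C ((-t k) ^ n) := by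
    intro k
    have h1 : q.eval (MvPolynomial.C (-t k)) = symNode n (t k) := by
      rw [hq, Polynomial.eval_prod, symNode]
      refine Finset.prod_congr rfl fun l _ => ?_
      rw [Polynomial.eval_add, Polynomial.eval_X, Polynomial.eval_C, MvPolynomial.C_neg]
      ring
    rw [← h1, Polynomial.eval_eq_sum_range, hdeg, Finset.sum_range_succ, Finset.sum_range]
    have h2 : q.coeff n = 1 := by rw [← hmonic.coeff_natDegree, hdeg]
    rw [h2, one_mul, MvPolynomial.C_pow]
    congr 1
    refine Finset.sum_congr rfl fun m _ => ?_
    rw [MvPolynomial.C_pow, mul_comm]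
  set V := Matrix.vandermonde fun k => -t k with hV
  have hdet : IsUnit V.det :=
    (Matrix.det_vandermonde_ne_zero_iff.mpr fun a b h => ht (neg_injective h)).isUnit
  have hcoeff : ∀ j : Fin n, q.coeff j = ∑ k, MvPolynomial.C (V⁻¹ j k) *
      (symNode n (t k) - MvPolynomial.C ((-t k) ^ n)) := by
    intro j
    have h1 : ∀ k, symNode n (t k) - MvPolynomial.C ((-t k) ^ n) =
        ∑ m : Fin n, MvPolynomial.C (V k m) * q.coeff m := by
      intro k
      rw [hval, add_sub_cancel_right]
      rfl
    simp only [h1, Finset.mul_sum]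
    rw [Finset.sum_comm]
    have h2 : ∀ m : Fin n, ∑ k, MvPolynomial.C (V⁻¹ j k) * (MvPolynomial.C (V k m) * q.coeff m) =
        MvPolynomial.C ((1 : Matrix (Fin n) (Fin n) ℂ) j m) * q.coeff m := by
      intro m
      rw [← Matrix.nonsing_inv_mul V hdet, Matrix.mul_apply, map_sum, Finset.sum_mul]
      exact Finset.sum_congr rfl fun k _ => by rw [MvPolynomial.C_mul, mul_assoc]
    rw [Finset.sum_congr rfl fun m _ => h2 m, Finset.sum_eq_single j]
    · rw [Matrix.one_apply_eq, MvPolynomial.C_1, one_mul]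
    · intro m _ hm
      rw [Matrix.one_apply_ne hm.symm, MvPolynomial.C_0, zero_mul]
    · simp
  have hmem : ∀ j : Fin n, q.coeff j ∈ S := by
    intro j
    rw [hcoeff]
    refine Subalgebra.sum_mem _ fun k _ => S.mul_mem (S.algebraMap_mem _) ?_
    exact S.sub_mem (hS k) (S.algebraMap_mem _)
  have h3 := hmem j.rev
  rw [hq, MvPolynomial.prod_X_add_C_coeff _ _ _ (by rw [Fintype.card_fin]; exact j.rev.2.le),
    Fintype.card_fin, Fin.val_rev, Nat.sub_sub_self (by have := j.2; omega)] at h3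
  exact h3

lemma mem_of_isSymmetric (ht : Function.Injective t)
    (S : Subalgebra ℂ (MvPolynomial (Fin n) ℂ)) (hS : ∀ k, symNode n (t k) ∈ S)
    {p : MvPolynomial (Fin n) ℂ} (hp : p.IsSymmetric) : p ∈ S := by
  obtain ⟨f, hf⟩ := MvPolynomial.esymmAlgHom_surjective (σ := Fin n) (n := n) ℂ
    (Fintype.card_fin n).le ⟨p, hp⟩
  have h1 := MvPolynomial.esymmAlgHom_apply f (σ := Fin n)
  rw [hf] at h1
  change p = _ at h1
  rw [h1]
  have h2 : MvPolynomial.aeval (fun i : Fin n => MvPolynomial.esymm (Fin n) ℂ (i + 1)) f ∈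
      Algebra.adjoin ℂ (Set.range fun i : Fin n => MvPolynomial.esymm (Fin n) ℂ (i + 1)) := by
    rw [Algebra.adjoin_range_eq_range_aeval]
    exact ⟨f, rfl⟩
  refine Algebra.adjoin_le ?_ h2
  rintro _ ⟨i, rfl⟩
  exact esymm_mem_of_symNode_mem ht S hS i

lemma isSymmetric_symNode (a : ℂ) : (symNode n a).IsSymmetric := by
  intro e
  rw [symNode, map_prod]
  simp only [map_sub, MvPolynomial.rename_X, MvPolynomial.rename_C]
  exact Equiv.prod_comp e fun l => MvPolynomial.X l - MvPolynomial.C a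

/-- The variables `x₁, …, xₙ, 0` as polynomials. -/
def boundaryVar (n : ℕ) : Fin (n + 1) → MvPolynomial (Fin n) ℂ :=
  Fin.snoc MvPolynomial.X 0

/-- The substitution `Xₖ ↦ -uₖ`, where `xₙ₊₁ = 0`. -/
def boundarySubst (t : Fin n → ℂ) : MvPolynomial (Fin n) ℂ →ₐ[ℂ] MvPolynomial (Fin n) ℂ :=
  MvPolynomial.aeval fun k => -u t (boundaryVar n) k

lemma exists_neg_u_boundaryVar (ht : Function.Injective t) (ht₀ : ∀ i, t i ≠ 0)
    (ht₁ : ∀ i, t i ≠ 1) (k : Fin n) : ∃ c : ℂ, c ≠ 0 ∧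
      -u t (boundaryVar n) k = MvPolynomial.C c * symNode n (t k) := by
  refine ⟨(t k * (t k - 1) * ∏ l ∈ Finset.univ.erase k, (t l - t k))⁻¹ * t k,
    mul_ne_zero (inv_ne_zero (mul_ne_zero (mul_ne_zero (ht₀ k) (sub_ne_zero.mpr (ht₁ k))) ?_))
      (ht₀ k), ?_⟩
  · exact Finset.prod_ne_zero_iff.mpr fun l hl =>
      sub_ne_zero.mpr fun h => Finset.ne_of_mem_erase hl (ht h)
  · rw [u, MvPolynomial.smul_eq_C_mul, Fin.prod_univ_castSucc, boundaryVar]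
    simp only [Fin.snoc_castSucc, Fin.snoc_last, MvPolynomial.algebraMap_eq]
    rw [symNode, MvPolynomial.C_mul]
    ring

lemma isSymmetric_boundarySubst (ht : Function.Injective t) (ht₀ : ∀ i, t i ≠ 0)
    (ht₁ : ∀ i, t i ≠ 1) (f : MvPolynomial (Fin n) ℂ) :
    boundarySubst t f ∈ MvPolynomial.symmetricSubalgebra (Fin n) ℂ := by
  have h2 : boundarySubst t f ∈ Algebra.adjoin ℂ (Set.range fun k => -u t (boundaryVar n) k) := by
    rw [Algebra.adjoin_range_eq_range_aeval]
    exact ⟨f, rfl⟩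
  refine Algebra.adjoin_le ?_ h2
  rintro _ ⟨k, rfl⟩
  obtain ⟨c, -, hc⟩ := exists_neg_u_boundaryVar ht ht₀ ht₁ k
  beta_reduce
  rw [hc]
  exact (MvPolynomial.symmetricSubalgebra (Fin n) ℂ).mul_mem
    ((MvPolynomial.symmetricSubalgebra (Fin n) ℂ).algebraMap_mem c) (isSymmetric_symNode (t k))

lemma exists_boundarySubst_eq (ht : Function.Injective t) (ht₀ : ∀ i, t i ≠ 0)
    (ht₁ : ∀ i, t i ≠ 1) {p : MvPolynomial (Fin n) ℂ} (hp : p.IsSymmetric) :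
    ∃ f, boundarySubst t f = p := by
  refine mem_of_isSymmetric ht (boundarySubst t).range (fun k => ?_) hp
  obtain ⟨c, hc0, hc⟩ := exists_neg_u_boundaryVar ht ht₀ ht₁ k
  refine ⟨MvPolynomial.C c⁻¹ * MvPolynomial.X k, ?_⟩
  change boundarySubst t _ = _
  rw [boundarySubst, map_mul, MvPolynomial.aeval_X, hc, MvPolynomial.aeval_C,
    MvPolynomial.algebraMap_eq, ← mul_assoc, ← MvPolynomial.C_mul, inv_mul_cancel₀ hc0,
    MvPolynomial.C_1, one_mul]

/-- The symmetric polynomials are themselves a polynomial ring in n variables, so a surjection onto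
them is a surjective endomorphism of a Noetherian ring. -/
lemma boundarySubst_injective (ht : Function.Injective t) (ht₀ : ∀ i, t i ≠ 0)
    (ht₁ : ∀ i, t i ≠ 1) : Function.Injective (boundarySubst t) := by
  set e := MvPolynomial.esymmAlgEquiv (Fin n) ℂ (Fintype.card_fin n) with he
  set f := (boundarySubst t).codRestrict (MvPolynomial.symmetricSubalgebra (Fin n) ℂ)
    (isSymmetric_boundarySubst ht ht₀ ht₁) with hf
  have hsurj : Function.Surjective f := by
    rintro ⟨p, hp⟩
    obtain ⟨g, hg⟩ := exists_boundarySubst_eq ht ht₀ ht₁ hp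
    exact ⟨g, Subtype.ext hg⟩
  have hinj := injective_of_surjective_ringHom (e.symm.toAlgHom.comp f).toRingHom
    (e.symm.surjective.comp hsurj)
  intro a b hab
  refine hinj ?_
  change e.symm (f a) = e.symm (f b)
  congr 1
  exact Subtype.ext hab

end Symmetric

/-! ### The boundary condition -/

section Boundary

variable {n : ℕ} {t : Fin n → ℂ}

/-- Lagrange's formula for the monic polynomial ∏(y - xₖ) of degree n + 1, this time at the n + 2
singular points as nodes. -/
lemma sum_nodeCoord (hinj : Function.Injective (singularPoint t)) :
    ∑ a, nodeCoord t a = -1 := by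
  set q : Polynomial (MvPowerSeries (Fin (n + 1)) ℂ) :=
    ∏ k : Fin (n + 1), (Polynomial.X - Polynomial.C (MvPowerSeries.X k)) with hq
  have hmonic : q.Monic := Polynomial.monic_prod_X_sub_C _ _
  have hdeg : q.natDegree = n + 1 := by
    rw [hq, Polynomial.natDegree_finsetProd_X_sub_C_eq_card, Finset.card_univ, Fintype.card_fin]
  have hx : Function.Injective fun a =>
      (MvPowerSeries.C (singularPoint t a) : MvPowerSeries (Fin (n + 1)) ℂ) :=
    MvPowerSeries.C_injective.comp hinj
  have h1 := sum_cofac_mul_eval hx (q := q) (by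
    rw [Polynomial.degree_eq_natDegree hmonic.ne_zero, hdeg, Fintype.card_fin]
    exact_mod_cast Nat.lt_succ_self (n + 1))
  have h2 : q.coeff (Fintype.card (Fin (n + 2)) - 1) = 1 := by
    rw [Fintype.card_fin, ← hmonic.coeff_natDegree, hdeg]
    rfl
  rw [h2, mul_one] at h1
  have h3 : ∀ a, q.eval (MvPowerSeries.C (singularPoint t a)) =
      (-1) ^ (n + 1) * shiftProd (singularPoint t a) := by
    intro a
    rw [hq, Polynomial.eval_prod, shiftProd]
    have : ∀ k : Fin (n + 1), (MvPowerSeries.X k - MvPowerSeries.C (singularPoint t a) :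
        MvPowerSeries (Fin (n + 1)) ℂ) =
        -(MvPowerSeries.C (singularPoint t a) - MvPowerSeries.X k) := fun k => by ring
    simp only [this, Polynomial.eval_sub, Polynomial.eval_X, Polynomial.eval_C]
    rw [Finset.prod_neg, Finset.card_univ, Fintype.card_fin, ← mul_assoc, ← mul_pow]
    norm_num
  refine mul_left_cancel₀ (discr_ne_zero hx) ?_
  rw [Finset.mul_sum]
  have h4 : ∀ a, discr (fun a => (MvPowerSeries.C (singularPoint t a) :
      MvPowerSeries (Fin (n + 1)) ℂ)) * nodeCoord t a =
      -(cofac (fun a => (MvPowerSeries.C (singularPoint t a) :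
        MvPowerSeries (Fin (n + 1)) ℂ)) a * q.eval (MvPowerSeries.C (singularPoint t a))) := by
    intro a
    have h5 : ∏ b ∈ Finset.univ.erase a, (MvPowerSeries.C (singularPoint t a) -
        MvPowerSeries.C (singularPoint t b) : MvPowerSeries (Fin (n + 1)) ℂ) =
          MvPowerSeries.C (nodeValue t a) := by
      rw [nodeValue, map_prod]
      simp only [map_sub]
    have h6 := C_mul_C_eq_one hinj a
    have h7 : ((-1) ^ n * (-1) ^ n : MvPowerSeries (Fin (n + 1)) ℂ) = 1 := by
      rw [← mul_pow]
      norm_num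
    rw [discr_eq_cofac_mul _ a, h5, h3, nodeCoord, pow_succ]
    set y := MvPowerSeries.C ((-1) ^ n * (nodeValue t a)⁻¹) with hy
    linear_combination (cofac (fun a => (MvPowerSeries.C (singularPoint t a) :
        MvPowerSeries (Fin (n + 1)) ℂ)) a * shiftProd (singularPoint t a)) *
      ((-1) ^ n * h6 - MvPowerSeries.C (nodeValue t a) * y * h7)
  rw [Finset.sum_congr rfl fun a _ => h4 a, Finset.sum_neg_distrib, h1, mul_neg, mul_one]

lemma u₀_boundary (hinj : Function.Injective (singularPoint t)) :
    u₀ t (xVarsBoundary n) = -1 - ∑ k, -u t (xVarsBoundary n) k := by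
  have h1 := congrArg (restrictLast n) (sum_nodeCoord hinj)
  rw [Fin.sum_univ_succ, Fin.sum_univ_succ, map_add, map_add, map_sum,
    (restrictLast_eq_zero_iff _).mpr (X_dvd_nodeCoord_zero _), nodeCoord_succ_zero, map_u₀,
    map_neg, map_one, zero_add] at h1
  simp only [nodeCoord_succ_succ, map_neg, map_u, restrictLast_xVars] at h1
  linear_combination h1

/-- The inclusion of polynomials into power series. -/
def toSeries (n : ℕ) : MvPolynomial (Fin n) ℂ →ₐ[ℂ] MvPowerSeries (Fin n) ℂ :=
  MvPolynomial.coeToMvPowerSeries.algHom ℂ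

lemma toSeries_apply (f : MvPolynomial (Fin n) ℂ) : toSeries n f = (f : MvPowerSeries (Fin n) ℂ) := by
  rw [toSeries, MvPolynomial.coeToMvPowerSeries.algHom_apply, Algebra.algebraMap_self,
    MvPowerSeries.map_id, RingHom.id_apply]

lemma toSeries_injective : Function.Injective (toSeries n) := by
  intro f g h
  rw [toSeries_apply, toSeries_apply] at h
  exact MvPolynomial.coe_injective _ _ h

lemma toSeries_boundaryVar (k : Fin (n + 1)) :
    toSeries n (boundaryVar n k) = xVarsBoundary n k := by
  refine Fin.lastCases ?_ (fun k => ?_) k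
  · rw [boundaryVar, xVarsBoundary, Fin.snoc_last, Fin.snoc_last, map_zero]
  · rw [boundaryVar, xVarsBoundary, Fin.snoc_castSucc, Fin.snoc_castSucc, toSeries_apply,
      MvPolynomial.coe_X]

/-- At xₙ₊₁ = 0 the coordinate w₀ vanishes, so the remaining ones sum to -1 and the harmonic
polynomial is evaluated on the hyperplane. -/
lemma homogenizedP_boundary (ht : Function.Injective t) (ht₀ : ∀ i, t i ≠ 0) (ht₁ : ∀ i, t i ≠ 1)
    (s : Fin (n + 2) → ℂ) (i : Fin n → ℕ) : homogenizedP t s (xVarsBoundary n) i =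
      toSeries n (boundarySubst t (hyperplanePoly s i)) := by
  have hinj := singularPoint_injective ht ht₀ ht₁
  rw [homogenizedP_eq_aeval t s _ i (constantCoeff_u₀_ne_zero ht₁ constantCoeff_xVarsBoundary),
    hyperplanePoly, boundarySubst, MvPolynomial.comp_aeval_apply, MvPolynomial.comp_aeval_apply]
  congr 2
  have hX : ∀ k, toSeries n (-u t (boundaryVar n) k) = -u t (xVarsBoundary n) k := by
    intro k
    rw [map_neg, map_u]
    simp only [toSeries_boundaryVar]
  funext a
  refine Fin.cases ?_ (fun k => ?_) a
  · rw [Fin.cons_zero, hyperplaneCoord, Fin.cons_zero, u₀_boundary hinj, map_sub, map_neg, map_one, map_sum]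
    simp only [MvPolynomial.aeval_X, hX]
  · rw [Fin.cons_succ, hyperplaneCoord, Fin.cons_succ, MvPolynomial.aeval_X, hX]

lemma coeff_boundaryValue_mem_range (ht : Function.Injective t) (ht₀ : ∀ i, t i ≠ 0)
    (ht₁ : ∀ i, t i ≠ 1) (j : Fin n →₀ ℕ) :
    ∃ f, toSeries n (boundarySubst t f) = MvPowerSeries.coeff j (boundaryValue n) := by
  rw [coeff_boundaryValue]
  by_cases hj : ∀ k, 1 ≤ j k
  · obtain ⟨f, hf⟩ := exists_boundarySubst_eq ht ht₀ ht₁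
      (p := (n ! : ℂ)⁻¹ • ∑ σ : Equiv.Perm (Fin n), ∏ k,
        (MvPolynomial.X k : MvPolynomial (Fin n) ℂ) ^ (j (σ k) - 1)) (fun e => by
      rw [map_smul, map_sum, ← Equiv.sum_comp (Equiv.mulRight e)]
      congr 1
      refine Finset.sum_congr rfl fun σ _ => ?_
      rw [map_prod, ← Equiv.prod_comp e fun k =>
        (MvPolynomial.X k : MvPolynomial (Fin n) ℂ) ^ (j (σ k) - 1)]
      refine Finset.prod_congr rfl fun k _ => ?_
      rw [map_pow, MvPolynomial.rename_X]
      rfl)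
    refine ⟨f, ?_⟩
    rw [if_pos hj, hf, map_smul, map_sum]
    congr 1
    refine Finset.sum_congr rfl fun σ _ => ?_
    rw [map_prod]
    refine Finset.prod_congr rfl fun k _ => ?_
    rw [map_pow, toSeries_apply, MvPolynomial.coe_X]
  · exact ⟨0, by rw [if_neg hj, map_zero, map_zero]⟩

/-- The system (*) splits by monomials in the 1/yₖ. Each one asks for the coordinates of a symmetric
polynomial in a basis of symmetric polynomials, and local finiteness says that these coordinates
form a finite family. -/
lemma existsUnique_isBoundaryFamily (ht : Function.Injective t) (ht₀ : ∀ i, t i ≠ 0)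
    (ht₁ : ∀ i, t i ≠ 1) {s : Fin (n + 2) → ℂ} (hs₂ : n = 1 ∨ ∀ m : ℕ, s 1 ≠ -(m : ℂ))
    (hs₃ : ∀ (k : Fin n) (m : ℕ), s k.succ.succ ≠ -(m : ℂ))
    (hσ : ∀ m : ℕ, ∑ k : Fin (n + 1), s k.succ ≠ -(m : ℂ)) :
    ∃! Q, IsBoundaryFamily t s Q := by
  set L : MvPolynomial (Fin n) ℂ →ₗ[ℂ] MvPowerSeries (Fin n) ℂ :=
    ((toSeries n).comp (boundarySubst t)).toLinearMap with hL
  have hLinj : Function.Injective L :=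
    toSeries_injective.comp (boundarySubst_injective ht ht₀ ht₁)
  have hH : homogenizedP t s (xVarsBoundary n) = L ∘ hyperplanePoly s :=
    funext fun i => homogenizedP_boundary ht ht₀ ht₁ s i
  have hli : LinearIndependent ℂ (homogenizedP t s (xVarsBoundary n)) := by
    rw [hH]
    exact (linearIndependent_hyperplanePoly hs₂ hs₃ hσ).map' L (LinearMap.ker_eq_bot.mpr hLinj)
  have hex : ∀ j : Fin n →₀ ℕ, ∃ c : (Fin n → ℕ) →₀ ℂ,
      Finsupp.linearCombination ℂ (homogenizedP t s (xVarsBoundary n)) c =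
        MvPowerSeries.coeff j (boundaryValue n) := by
    intro j
    obtain ⟨f, hf⟩ := coeff_boundaryValue_mem_range ht ht₀ ht₁ j
    obtain ⟨c, hc⟩ := (Finsupp.mem_span_range_iff_exists_finsupp (R := ℂ)).mp
      (show f ∈ Submodule.span ℂ (Set.range (hyperplanePoly s)) by
        rw [span_hyperplanePoly hs₂ hs₃ hσ]; trivial)
    refine ⟨c, ?_⟩
    rw [hH, ← Finsupp.apply_linearCombination, ← hf, Finsupp.linearCombination_apply, hc]
    rfl
  choose c hc using hex
  refine ⟨fun i j => c j i, ⟨fun j => (c j).hasFiniteSupport, ?_⟩, fun Q hQ => ?_⟩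
  · refine MvPowerSeries.ext fun j => ?_
    rw [← hc, ← finsum_smul_eq_linearCombination]
    rfl
  · funext i
    refine MvPowerSeries.ext fun j => ?_
    set d : (Fin n → ℕ) →₀ ℂ :=
      Finsupp.ofSupportFinite (fun i => MvPowerSeries.coeff j (Q i)) (hQ.locallyFinite j) with hd
    have h1 : Finsupp.linearCombination ℂ (homogenizedP t s (xVarsBoundary n)) d =
        MvPowerSeries.coeff j (boundaryValue n) := by
      rw [← hQ.system, ← finsum_smul_eq_linearCombination]
      rfl
    have h2 : d = c j := hli (h1.trans (hc j).symm)
    exact congrArg (fun c : (Fin n → ℕ) →₀ ℂ => c i) h2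

end Boundary

end FuchsianKernel

end

theorem theorem5p4p1 (n : ℕ) (hn : 1 ≤ n) (t : Fin n → ℂ) (s : Fin (n + 2) → ℂ) (r₁ r₂ : ℂ)
    (ht : Function.Injective t) (ht₀ : ∀ i, t i ≠ 0) (ht₁ : ∀ i, t i ≠ 1)
    (hsum : ∑ k, s k = r₁ + r₂ + 1)
    (hs₁ : ∀ m : ℕ, s 0 ≠ -(m : ℂ))
    (hs₃ : ∀ (k : Fin n) (m : ℕ), s k.succ.succ ≠ -(m : ℂ)) :
    (∃! p : ℕ → MvPolynomial (Fin n) ℂ, FuchsianKernel.IsTaylorFamily t s r₁ r₂ p) ∧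
    (∀ p : ℕ → MvPolynomial (Fin n) ℂ, FuchsianKernel.IsTaylorFamily t s r₁ r₂ p →
      LinearIndependent ℂ (fun j : {j : Fin n → ℕ // Monotone j} => ∏ k, p (j.1 k)) ∧
      Submodule.span ℂ (Set.range fun j : {j : Fin n → ℕ // Monotone j} => ∏ k, p (j.1 k)) = ⊤ ∧
      (∃! C, FuchsianKernel.IsStructureConstants p C) ∧
      ∀ C, FuchsianKernel.IsStructureConstants p C →
        ∀ Q, FuchsianKernel.IsBoundaryFamily t s Q →
          FuchsianKernel.kernel C =
            FuchsianKernel.formalSum (FuchsianKernel.expansionTerm t s r₁ r₂) Q) ∧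
    ((n = 1 ∨ ∀ m : ℕ, s 1 ≠ -(m : ℂ)) →
      (∀ m : ℕ, ∑ k : Fin (n + 1), s k.succ ≠ -(m : ℂ)) →
      ∃! Q, FuchsianKernel.IsBoundaryFamily t s Q) := by
  refine ⟨⟨_, (FuchsianKernel.isTaylorFamily_iff r₁ r₂ ht₀ hs₁ _).mpr rfl, fun p hp =>
    (FuchsianKernel.isTaylorFamily_iff r₁ r₂ ht₀ hs₁ p).mp hp⟩, ?_, fun hs₂ hσ =>
    FuchsianKernel.existsUnique_isBoundaryFamily ht ht₀ ht₁ hs₂ hs₃ hσ⟩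
  intro p hp
  obtain rfl := (FuchsianKernel.isTaylorFamily_iff r₁ r₂ ht₀ hs₁ p).mp hp
  have hli := FuchsianKernel.linearIndependent_prod_solPoly (s := s) r₁ r₂ ht₀ hs₁
  have hsp := FuchsianKernel.span_prod_solPoly (s := s) r₁ r₂ ht₀ hs₁
  obtain ⟨g, hg⟩ := FuchsianKernel.exists_symCoeff hli hsp
  have hC := FuchsianKernel.isStructureConstants_iff hg hsp
  refine ⟨hli, hsp, ⟨_, (hC _).mpr rfl, fun C h => (hC C).mp h⟩, fun C h Q hQ => ?_⟩
  obtain rfl := (hC C).mp h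
  exact FuchsianKernel.eq_formalSum_expansionTerm
    (FuchsianKernel.singularPoint_injective ht ht₀ ht₁) ht₀ ht₁ hsum hs₁ hs₃ hQ
    (FuchsianKernel.kernelOp_coeff_kernel ht₀ hs₁) (FuchsianKernel.renameEquiv_coeff_kernel _)
    (FuchsianKernel.restrictLast_coeff_kernel (by
      rw [FuchsianKernel.solPoly, FuchsianKernel.solSeq]) hg)
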